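/- **Setting.** For each $N$ let $H=(h_{ij})$ be an $N\times N$ Hermitian random matrix with $h_{ij}=N^{-1/2}(x_{ij}+\sqrt{-1}\,y_{ij})$ for $i<j$ and $h_{ii}=N^{-1/2}x_{ii}$, where $x_{ij},y_{ij}$ $(i<j)$ and $x_{ii}$ are independent real random variables of mean zero; the $x_{ij},y_{ij}$ $(i<j)$ have common law $d\nu=\mathrm{const}\cdot e^{-g(x)}dx$ with variance $1/2$, and the $x_{ii}$ have common law $d\widetilde\nu=\mathrm{const}\cdot e^{-\widetilde g(x)}dx$. The laws $\nu,\widetilde\nu$ do not depend on $N$. Assume: - (C1) $g$ is twice differentiable and $\sup_{x\in\mathbb R}g''(x)<\infty$; - (C2) $\int e^{\delta x^2}\,d\widetilde\nu(x)<\infty$ for some $\delta>0$; - (C4) there is a constant $C_{\rm sob}$ such that $\int u\log u\,d\nu\le C_{\rm sob}\int|\nabla\sqrt u|^2\,d\nu$ for every ($C^1$) density $u>0$ with $\int u\,d\nu=1$ for which both sides are finite. Let $\mu_1\le\dots\le\mu_N$ be the eigenvalues of $H$. For $z=E+i\eta$, $\eta>0$, put $m_N(z)=\frac1N\operatorname{Tr}(H-z)^{-1}$,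 $\varrho_\eta(E)=\frac1\pi\operatorname{Im}m_N(E+i\eta)$ and $\mathcal N_{\eta}(E)=|\{\alpha:|\mu_\alpha-E|\le\eta\}|$. Let $\varrho_{sc}(x)=\frac1{2\pi}\sqrt{4-x^2}\,\mathbf 1(|x|\le2)$ and $m_{sc}(z)=\int_{\mathbb R}\frac{\varrho_{sc}(x)}{x-z}\,dx$. **Theorem.** Let $\kappa>0$ and $\varepsilon>0$. There is $c>0$, depending only on $\kappa,\varepsilon$ and the laws $\nu,\widetilde\nu$, such that the following hold. (a) For all sufficiently large $N$, $$\mathbb P\Big\{\sup_{|E|\le2-\kappa,\ (\log N)^8/N\le\eta\le1}|m_N(E+i\eta)-m_{sc}(E+i\eta)|\ge\varepsilon\Big\}\le e^{-c(\log N)^2}.$$ In particular, the density of states converges uniformly, in probability, on all these scales: for all sufficiently large $N$, $$\mathbb P\Big\{\sup_{|E|\le2-\kappa,\ (\log N)^8/N\le\eta\le1}\big|\varrho_\eta(E)-\tfrac1\pi\operatorname{Im}m_{sc}(E+i\eta)\big|\ge\varepsilon\Big\}\le e^{-c(\log N)^2}.$$ (b) Let $\eta^*=\eta^*(N)$ satisfy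 $(\log N)^8/N\ll\eta^*\ll1$, that is, $\eta^*(N)\,N/(\log N)^8\to\infty$ and $\eta^*(N)\to0$ as $N\to\infty$. Then for all sufficiently large $N$ (depending also on the sequence $\eta^*$), $$\mathbb P\Big\{\sup_{|E|\le2-\kappa,\ (\log N)^8/N\le\eta\le\eta^*}|\varrho_\eta(E)-\varrho_{sc}(E)|\ge\varepsilon\Big\}\le e^{-c(\log N)^2},$$ $$\mathbb P\Big\{\sup_{|E|\le2-\kappa}\Big|\frac{\mathcal N_{\eta^*}(E)}{2N\eta^*}-\varrho_{sc}(E)\Big|\ge\varepsilon\Big\}\le e^{-c(\log N)^2}.$$ -/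

import Mathlib

open MeasureTheory ProbabilityTheory Filter Topology

noncomputable section

namespace LocalSemicircle

/-- `HasDensityExpNeg μ g`: `μ` is the probability measure `const · e^{-g(x)} dx` on the line. -/
structure HasDensityExpNeg (μ : Measure ℝ) (g : ℝ → ℝ) : Prop where
  isProbabilityMeasure : IsProbabilityMeasure μ
  measurable : Measurable g
  eq_withDensity : ∃ C : ℝ, 0 < C ∧
    μ = volume.withDensity (fun x => ENNReal.ofReal (C * Real.exp (-g x)))

/-- Condition C1: `g` is twice differentiable and `g''` is bounded above. -/
structure CondC1 (g : ℝ → ℝ) : Prop where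
  differentiable : Differentiable ℝ g
  differentiable_deriv : Differentiable ℝ (deriv g)
  bddAbove : BddAbove (Set.range (deriv (deriv g)))

/-- Condition C2: Gaussian decay, `∫ e^{δ x²} dμ < ∞` for some `δ > 0`. -/
def CondC2 (μ : Measure ℝ) : Prop :=
  ∃ δ : ℝ, 0 < δ ∧ Integrable (fun x => Real.exp (δ * x ^ 2)) μ

/-- Condition C4: the logarithmic Sobolev inequality
`∫ u log u dμ ≤ C ∫ |(√u)'|² dμ`, required for those positive `C¹` probability densities `u`
with respect to `μ` for which both sides are finite. -/
def CondC4 (μ : Measure ℝ) : Prop :=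
  ∃ C : ℝ, ∀ u : ℝ → ℝ, ContDiff ℝ 1 u → (∀ x, 0 < u x) →
    Integrable u μ → ∫ x, u x ∂μ = 1 →
    Integrable (fun x => u x * Real.log (u x)) μ →
    Integrable (fun x => (deriv (fun t => Real.sqrt (u t)) x) ^ 2) μ →
    ∫ x, u x * Real.log (u x) ∂μ ≤ C * ∫ x, (deriv (fun t => Real.sqrt (u t)) x) ^ 2 ∂μ

/-- The Hermitian matrix with entries `N^{-1/2} (x i j + √-1 y i j)` above the diagonal and
`N^{-1/2} x i i` on the diagonal. The remaining values of `x` and `y` are not used. -/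
def wignerMatrix {N : ℕ} (x y : Fin N → Fin N → ℝ) : Matrix (Fin N) (Fin N) ℂ :=
  Matrix.of fun i j =>
    if i < j then ((Real.sqrt N)⁻¹ : ℂ) * (x i j + Complex.I * y i j)
    else if j < i then ((Real.sqrt N)⁻¹ : ℂ) * (x j i - Complex.I * y j i)
    else ((Real.sqrt N)⁻¹ : ℂ) * x i i

theorem wignerMatrix_isHermitian {N : ℕ} (x y : Fin N → Fin N → ℝ) :
    (wignerMatrix x y).IsHermitian := by
  ext i j
  rcases lt_trichotomy i j with h | h | h
  · simp [wignerMatrix, h, h.not_gt, sub_eq_add_neg]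
  · subst h
    simp [wignerMatrix]
  · simp only [wignerMatrix, Matrix.conjTranspose_apply, Matrix.of_apply, h, h.not_gt, if_true,
      if_false]
    simp [sub_eq_add_neg]

/-- The random variables `x i j` (`i ≤ j`) and `y i j` (`i < j`) on `(Ω, P)` are jointly
independent, the off-diagonal ones have law `ν` and the diagonal ones have law `ν'`. -/
structure IsWignerFamily {Ω : Type*} [MeasurableSpace Ω] (P : Measure Ω) (ν ν' : Measure ℝ)
    {N : ℕ} (x y : Fin N → Fin N → Ω → ℝ) : Prop where
  law_re : ∀ i j, i < j → HasLaw (x i j) ν P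
  law_im : ∀ i j, i < j → HasLaw (y i j) ν P
  law_diag : ∀ i, HasLaw (x i i) ν' P
  indep : iIndepFun
    (Sum.elim (fun p : {p : Fin N × Fin N // p.1 ≤ p.2} => x p.1.1 p.1.2)
      (fun p : {p : Fin N × Fin N // p.1 < p.2} => y p.1.1 p.1.2)) P

/-- The random matrix built from the entries `x`, `y`, at the sample point `ω`. -/
def randomMatrix {Ω : Type*} {N : ℕ} (x y : Fin N → Fin N → Ω → ℝ) (ω : Ω) :
    Matrix (Fin N) (Fin N) ℂ :=
  wignerMatrix (fun i j => x i j ω) (fun i j => y i j ω)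

/-- The Stieltjes transform `m(z) = N⁻¹ Tr (H - z)⁻¹` of the empirical eigenvalue distribution. -/
def stieltjes {N : ℕ} (H : Matrix (Fin N) (Fin N) ℂ) (z : ℂ) : ℂ :=
  (N : ℂ)⁻¹ * ((H - z • (1 : Matrix (Fin N) (Fin N) ℂ))⁻¹).trace

/-- The density of states `ρ_η(E) = π⁻¹ Im m(E + iη)` regularized on scale `η`. -/
def densityOfStates {N : ℕ} (H : Matrix (Fin N) (Fin N) ℂ) (η E : ℝ) : ℝ :=
  (stieltjes H (E + η * Complex.I)).im / Real.pi

/-- The number of eigenvalues, with multiplicity, in `[E - η, E + η]`. -/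
def eigenvalueCount {N : ℕ} {H : Matrix (Fin N) (Fin N) ℂ} (hH : H.IsHermitian) (η E : ℝ) : ℕ :=
  (Finset.univ.filter fun α : Fin N => |hH.eigenvalues α - E| ≤ η).card

/-- The eigenvalue count of the random matrix built from the entries `x`, `y`, at `ω`. -/
def randomCount {Ω : Type*} {N : ℕ} (x y : Fin N → Fin N → Ω → ℝ) (ω : Ω) (η E : ℝ) : ℕ :=
  eigenvalueCount
    (wignerMatrix_isHermitian (fun i j => x i j ω) (fun i j => y i j ω)) η E

/-- The semicircle density. -/
def rhoSC (x : ℝ) : ℝ :=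
  if |x| ≤ 2 then (2 * Real.pi)⁻¹ * Real.sqrt (4 - x ^ 2) else 0

/-- The Stieltjes transform of the semicircle distribution. -/
def mSC (z : ℂ) : ℂ := ∫ x : ℝ, (rhoSC x : ℂ) / ((x : ℂ) - z)

/-- The smallest scale `(log N)⁸ / N`. -/
def minScale (N : ℕ) : ℝ := (Real.log N) ^ 8 / N

/-- The spectral domain: `|E| ≤ 2 - κ` and `(log N)⁸ / N ≤ η ≤ η₁`, for `z = E + iη`. -/
def spectralDomain (N : ℕ) (κ η₁ : ℝ) : Set ℂ :=
  {z | |z.re| ≤ 2 - κ ∧ minScale N ≤ z.im ∧ z.im ≤ η₁}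

end LocalSemicircle

end

open LocalSemicircle

/-!
# The local semicircle law on scales `(log N)⁸ / N`

The proof compares the empirical Stieltjes transform `m = stieltjes H z` with the root `mSC z` of
the quadratic equation `m (z + m) = -1` in the upper half plane, one spectral parameter at a time,
and pays for uniformity in `z` with a union bound over polynomially many points.

**Concentration.** By Herbst's argument the logarithmic Sobolev inequality makes `ν` sub-Gaussian
(`CondC4.exists_subgaussian`). For sub-Gaussian laws the Hanson–Wright inequality
(`exists_hansonWright`) bounds the deviations of a quadratic form with coefficient matrix `A` in
units of the Hilbert–Schmidt norm of `A`, with exponential tails. The off-diagonal part of the form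
is an average of decoupled bilinear forms, and the squares which remain after integrating out one
half of the variables are linearized by an auxiliary Gaussian variable.

**Self-consistent equation.** By Schur's complement formula (`green_diag_mul_schur`),
`G i i * (h i i - z - ∑ j k, h i j * G⁽ⁱ⁾ j k * h k i) = 1`, where `G⁽ⁱ⁾` is the resolvent of the
`i`-th minor. This minor is independent of the `i`-th row, so the quadratic form is within
`t ‖G⁽ⁱ⁾‖₂ / N` of `N⁻¹ Tr G⁽ⁱ⁾` with probability `1 - O(exp (-c t))`
(`measure_not_regularAt_le`). By the Ward identity `‖G⁽ⁱ⁾‖₂ ^ 2` is `Im Tr G⁽ⁱ⁾ / η`, and deleting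
a row changes the trace of the resolvent by at most `1 / η`. Averaging over `i` gives
`m (z + m) + 1 = O(d)` with `d` of order `t / √(N η)`, provided that `z + m` is not small. No a
priori bound on `Im m` is needed: the error grows like `√(Im m)`, while `|z + m| ≥ Im m`
(`norm_selfConsistent_le`).

**Stability.** `m (z + m) + 1 = (m - mSC) (m - mSC⁻¹)`, and `mSC⁻¹` has imaginary part at most
`-Im mSC`, which is bounded away from zero in the bulk. As `Im m ≥ 0`, the second factor is bounded
below (`norm_sub_mSC_le`).

**Uniformity.** The estimates hold simultaneously on a lattice of mesh `N⁻⁴`. The condition that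
`z + m` is not small holds at height one, and it propagates down to the smallest scale by
continuity in `η`: as long as `m` is moderately close to `mSC` the lattice estimate shows that it is
very close (`norm_stieltjes_sub_mSC_lt_of_net`). With `t` a large multiple of `(log N) ^ 2` the
failure probability is at most `exp (-(log N) ^ 2)`, while `d` is of order
`(log N) ^ 2 / √((log N) ^ 8)`, which tends to zero.

**Density of states and counting.** The imaginary part of `mSC` converges to `π ϱ_sc` with rate
`O(η)` in the bulk (`abs_im_mSC_sub_rhoSC_le`). The number of eigenvalues in a window of half-width
`η*` is compared with the integral of the density of states on the scale `a³ η*`, for a small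
constant `a`, over slightly enlarged and slightly shrunk windows (`abs_eigenvalueCount_sub_le`). For
large `N` this scale still exceeds `(log N)⁸ / N`.
-/

namespace LocalSemicircle

open scoped ENNReal

/-! ### The Herbst argument: a logarithmic Sobolev inequality implies sub-Gaussian tails -/

/-- Entropy bound along the exponential family generated by a bounded observable. -/
theorem mul_deriv_cgf_sub_cgf_le {μ : Measure ℝ} [IsProbabilityMeasure μ] {C : ℝ} (hC0 : 0 ≤ C)
    (hC : ∀ u : ℝ → ℝ, ContDiff ℝ 1 u → (∀ x, 0 < u x) →
      Integrable u μ → ∫ x, u x ∂μ = 1 →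
      Integrable (fun x => u x * Real.log (u x)) μ →
      Integrable (fun x => (deriv (fun t => Real.sqrt (u t)) x) ^ 2) μ →
      ∫ x, u x * Real.log (u x) ∂μ ≤ C * ∫ x, (deriv (fun t => Real.sqrt (u t)) x) ^ 2 ∂μ)
    {f : ℝ → ℝ} (hf : ContDiff ℝ 1 f) {B : ℝ} (hB : ∀ x, |f x| ≤ B) (hf' : ∀ x, |deriv f x| ≤ 1)
    (t : ℝ) : t * deriv (cgf f μ) t - cgf f μ t ≤ C * t ^ 2 / 4 := by
  have hmeas : Measurable f := hf.continuous.measurable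
  have hint : ∀ s : ℝ, Integrable (fun x => Real.exp (s * f x)) μ := fun s =>
    integrable_exp_mul_of_mem_Icc (a := -B) (b := B) hmeas.aemeasurable
      (Eventually.of_forall fun x => abs_le.mp (hB x))
  have hset : integrableExpSet f μ = Set.univ := Set.eq_univ_of_forall hint
  have hder : deriv (cgf f μ) t = (∫ x, f x * Real.exp (t * f x) ∂μ) / mgf f μ t :=
    deriv_cgf (by simp [hset])
  set H := cgf f μ t with hH
  have hZ : 0 < mgf f μ t := mgf_pos (hint t)
  have hexpH : Real.exp H = mgf f μ t := exp_cgf (hint t)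
  set u : ℝ → ℝ := fun x => Real.exp (t * f x - H) with hu
  have hu_eq : ∀ x, u x = Real.exp (t * f x) / mgf f μ t := fun x => by
    simp only [hu, Real.exp_sub, hexpH]
  have hu_int : Integrable u μ := by
    have : u = fun x => Real.exp (t * f x) / mgf f μ t := funext hu_eq
    rw [this]; exact (hint t).div_const _
  have hu_one : ∫ x, u x ∂μ = 1 := by
    simp_rw [hu_eq, integral_div]
    exact div_self hZ.ne'
  have hfu_int : Integrable (fun x => f x * u x) μ := by
    refine hu_int.bdd_mul (c := B) hmeas.aestronglyMeasurable ?_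
    exact Eventually.of_forall fun x => by simpa using hB x
  have hulog : (fun x => u x * Real.log (u x)) = fun x => t * (f x * u x) - H * u x := by
    funext x; simp only [hu, Real.log_exp]; ring
  have hsqrt : (fun x => Real.sqrt (u x)) = fun x => Real.exp ((t * f x - H) / 2) := by
    funext x; simp only [hu, Real.exp_half]
  have hdf : Differentiable ℝ f := hf.differentiable (by norm_num)
  have hdsqrt : ∀ x, deriv (fun x => Real.sqrt (u x)) x
      = Real.exp ((t * f x - H) / 2) * (t * deriv f x / 2) := fun x => by
    rw [hsqrt]
    exact (((((hdf x).hasDerivAt).const_mul t).sub_const H).div_const 2).exp.deriv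
  have hsq : ∀ x, (deriv (fun x => Real.sqrt (u x)) x) ^ 2 = (t ^ 2 / 4) * (deriv f x ^ 2 * u x) :=
    fun x => by
    have : Real.exp ((t * f x - H) / 2) ^ 2 = u x := by
      rw [← Real.exp_nat_mul]; simp only [hu]; congr 1; push_cast; ring
    rw [hdsqrt, mul_pow, this]; ring
  have hdc : Continuous (deriv f) := hf.continuous_deriv (by norm_num)
  have hle : ∀ x, deriv f x ^ 2 ≤ 1 := fun x => by
    rw [← sq_abs]; exact pow_le_one₀ (abs_nonneg _) (hf' x)
  have hd2_int : Integrable (fun x => deriv f x ^ 2 * u x) μ := by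
    refine hu_int.bdd_mul (c := 1) (hdc.pow 2).measurable.aestronglyMeasurable ?_
    exact Eventually.of_forall fun x => by
      rw [Real.norm_eq_abs, abs_of_nonneg (sq_nonneg _)]; exact hle x
  have key := hC u (Real.contDiff_exp.comp ((contDiff_const.mul hf).sub contDiff_const))
    (fun x => Real.exp_pos _) hu_int hu_one
    (by rw [hulog]; exact (hfu_int.const_mul t).sub (hu_int.const_mul H))
    (by simp_rw [hsq]; exact hd2_int.const_mul _)
  rw [hulog, integral_sub (hfu_int.const_mul t) (hu_int.const_mul H), integral_const_mul,
    integral_const_mul, hu_one] at key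
  have h1 : ∫ x, f x * u x ∂μ = deriv (cgf f μ) t := by
    rw [hder, ← integral_div]
    exact integral_congr_ae (Eventually.of_forall fun x => by simp only [hu_eq]; ring)
  have h2 : ∫ x, (deriv (fun x => Real.sqrt (u x)) x) ^ 2 ∂μ ≤ t ^ 2 / 4 := by
    simp_rw [hsq]
    rw [integral_const_mul]
    have : ∫ x, deriv f x ^ 2 * u x ∂μ ≤ ∫ x, u x ∂μ :=
      integral_mono hd2_int hu_int fun x =>
        mul_le_of_le_one_left (Real.exp_pos _).le (hle x)
    rw [hu_one] at this
    nlinarith [sq_nonneg t]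
  rw [h1] at key
  nlinarith [mul_le_mul_of_nonneg_left h2 hC0]

theorem cgf_le_of_entropy_bound {μ : Measure ℝ} [IsProbabilityMeasure μ] {C : ℝ}
    {f : ℝ → ℝ} (hf : Continuous f) {B : ℝ} (hB : ∀ x, |f x| ≤ B)
    (h : ∀ t, t * deriv (cgf f μ) t - cgf f μ t ≤ C * t ^ 2 / 4)
    {t : ℝ} (ht : 0 < t) : cgf f μ t ≤ t * ∫ x, f x ∂μ + C * t ^ 2 / 4 := by
  have hint : ∀ s : ℝ, Integrable (fun x => Real.exp (s * f x)) μ := fun s =>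
    integrable_exp_mul_of_mem_Icc (a := -B) (b := B) hf.measurable.aemeasurable
      (Eventually.of_forall fun x => abs_le.mp (hB x))
  have hset : integrableExpSet f μ = Set.univ := Set.eq_univ_of_forall hint
  have hd : ∀ s, HasDerivAt (cgf f μ) (deriv (cgf f μ) s) s := fun s =>
    (analyticAt_cgf (by simp [hset])).differentiableAt.hasDerivAt
  have hφ : ∀ s, 0 < s → HasDerivAt (fun s => cgf f μ s / s - C * s / 4)
      ((deriv (cgf f μ) s * s - cgf f μ s * 1) / s ^ 2 - C * 1 / 4) s := fun s hs =>
    ((hd s).div (hasDerivAt_id s) hs.ne').sub (((hasDerivAt_id s).const_mul C).div_const 4)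
  have hanti : AntitoneOn (fun s => cgf f μ s / s - C * s / 4) (Set.Ioi 0) := by
    refine antitoneOn_of_deriv_nonpos (convex_Ioi 0)
      (fun s hs => (hφ s hs).continuousAt.continuousWithinAt)
      (fun s hs => ((hφ s (interior_subset hs)).differentiableAt).differentiableWithinAt) ?_
    intro s hs
    have hs : 0 < s := interior_subset hs
    rw [(hφ s hs).deriv, sub_nonpos, div_le_iff₀ (by positivity)]
    linarith [h s]
  have h0 : deriv (cgf f μ) 0 = ∫ x, f x ∂μ := by
    rw [deriv_cgf_zero (by simp [hset])]; simp
  have hlim : Tendsto (fun s => cgf f μ s / s - C * s / 4) (𝓝[>] 0) (𝓝 (∫ x, f x ∂μ)) := by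
    have h1 := (hd 0).tendsto_slope_zero_right
    rw [h0] at h1
    have h2 : Tendsto (fun s : ℝ => C * s / 4) (𝓝[>] 0) (𝓝 0) := by
      have : Tendsto (fun s : ℝ => C * s / 4) (𝓝 0) (𝓝 (C * 0 / 4)) :=
        (by fun_prop : Continuous fun s : ℝ => C * s / 4).tendsto 0
      simpa using this.mono_left nhdsWithin_le_nhds
    have h3 := h1.sub h2
    rw [sub_zero] at h3
    refine h3.congr fun s => ?_
    simp [cgf_zero, div_eq_inv_mul]
  have hle : cgf f μ t / t - C * t / 4 ≤ ∫ x, f x ∂μ := by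
    refine ge_of_tendsto hlim ?_
    filter_upwards [Ioo_mem_nhdsGT ht] with s hs
    exact hanti hs.1 ht hs.2.le
  have : cgf f μ t = t * (cgf f μ t / t) := by field_simp
  rw [this]
  nlinarith

/-- A bounded smooth truncation of the identity with slope at most one. -/
noncomputable def truncId (n : ℕ) (x : ℝ) : ℝ := (n + 1) * Real.arctan (x / (n + 1))

theorem contDiff_truncId (n : ℕ) : ContDiff ℝ 1 (truncId n) := by
  unfold truncId
  exact contDiff_const.mul (Real.contDiff_arctan.comp (contDiff_id.div_const _))

theorem abs_truncId_le (n : ℕ) (x : ℝ) : |truncId n x| ≤ (n + 1) * (Real.pi / 2) := by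
  unfold truncId
  rw [abs_mul, abs_of_pos (by positivity : (0 : ℝ) < n + 1)]
  gcongr
  exact abs_le.mpr ⟨(Real.neg_pi_div_two_lt_arctan _).le, (Real.arctan_lt_pi_div_two _).le⟩

theorem hasDerivAt_truncId (n : ℕ) (x : ℝ) :
    HasDerivAt (truncId n) (1 / (1 + (x / (n + 1)) ^ 2)) x := by
  unfold truncId
  have h := (((hasDerivAt_id x).div_const ((n : ℝ) + 1)).arctan).const_mul ((n : ℝ) + 1)
  refine h.congr_deriv ?_
  have : (n : ℝ) + 1 ≠ 0 := by positivity
  simp only [id]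
  field_simp

theorem abs_deriv_truncId_le (n : ℕ) (x : ℝ) : |deriv (truncId n) x| ≤ 1 := by
  rw [(hasDerivAt_truncId n x).deriv, abs_of_nonneg (by positivity)]
  exact div_le_one_of_le₀ (by nlinarith [sq_nonneg (x / (n + 1))]) (by positivity)

theorem abs_truncId_le_abs (n : ℕ) (x : ℝ) : |truncId n x| ≤ |x| := by
  have h := Convex.norm_image_sub_le_of_norm_deriv_le (f := truncId n) (C := 1) (s := Set.univ)
    (x := 0) (y := x) (fun y _ => (hasDerivAt_truncId n y).differentiableAt)
    (fun y _ => by simpa using abs_deriv_truncId_le n y) convex_univ trivial trivial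
  simpa [truncId] using h

theorem tendsto_truncId (x : ℝ) : Tendsto (fun n => truncId n x) atTop (𝓝 x) := by
  rcases eq_or_ne x 0 with rfl | hx
  · simp [truncId]
  have h0 : Tendsto (fun n : ℕ => x / ((n : ℝ) + 1)) atTop (𝓝[≠] 0) := by
    refine tendsto_nhdsWithin_iff.mpr ⟨?_, Eventually.of_forall fun n => ?_⟩
    · have := (tendsto_one_div_add_atTop_nhds_zero_nat (𝕜 := ℝ)).const_mul x
      simpa [div_eq_mul_inv] using this
    · exact div_ne_zero hx (by positivity)
  have h1 := (Real.hasDerivAt_arctan 0).tendsto_slope_zero.comp h0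
  have h2 := h1.const_mul x
  simp only [zero_add, Real.arctan_zero, sub_zero, ne_eq, OfNat.ofNat_ne_zero, not_false_eq_true,
    zero_pow, add_zero, div_one, mul_one] at h2
  refine h2.congr fun n => ?_
  have : (n : ℝ) + 1 ≠ 0 := by positivity
  simp only [Function.comp, truncId, smul_eq_mul]
  field_simp

/-- Herbst's argument: a centred measure satisfying the logarithmic Sobolev inequality has a
sub-Gaussian moment generating function. -/
theorem CondC4.exists_subgaussian {μ : Measure ℝ} [IsProbabilityMeasure μ] (h : CondC4 μ)
    (hint : Integrable (fun x : ℝ => x) μ) (hmean : ∫ x, x ∂μ = 0) :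
    ∃ K : ℝ, 0 < K ∧ ∀ t : ℝ,
      ∫⁻ x, ENNReal.ofReal (Real.exp (t * x)) ∂μ ≤ ENNReal.ofReal (Real.exp (K * t ^ 2)) := by
  obtain ⟨C₀, hC₀⟩ := h
  set C := max C₀ 1 with hCdef
  have hCpos : 0 < C := lt_of_lt_of_le one_pos (le_max_right _ _)
  have hC : ∀ u : ℝ → ℝ, ContDiff ℝ 1 u → (∀ x, 0 < u x) →
      Integrable u μ → ∫ x, u x ∂μ = 1 →
      Integrable (fun x => u x * Real.log (u x)) μ →
      Integrable (fun x => (deriv (fun t => Real.sqrt (u t)) x) ^ 2) μ →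
      ∫ x, u x * Real.log (u x) ∂μ ≤ C * ∫ x, (deriv (fun t => Real.sqrt (u t)) x) ^ 2 ∂μ := by
    intro u a1 a2 a3 a4 a5 a6
    refine (hC₀ u a1 a2 a3 a4 a5 a6).trans ?_
    exact mul_le_mul_of_nonneg_right (le_max_left _ _) (integral_nonneg fun x => sq_nonneg _)
  -- For `σ = ±1` the bound for `t > 0` is passed to the limit along the truncations.
  have main : ∀ σ : ℝ, |σ| = 1 → ∀ t : ℝ, 0 < t →
      ∫⁻ x, ENNReal.ofReal (Real.exp (t * (σ * x))) ∂μ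
        ≤ ENNReal.ofReal (Real.exp (C / 4 * t ^ 2)) := by
    intro σ hσ t ht
    have hcont : ∀ n, Continuous fun x => σ * truncId n x := fun n =>
      continuous_const.mul (contDiff_truncId n).continuous
    have hbd : ∀ n x, |σ * truncId n x| ≤ (n + 1) * (Real.pi / 2) := fun n x => by
      rw [abs_mul, hσ, one_mul]; exact abs_truncId_le n x
    have hn : ∀ n, ∫⁻ x, ENNReal.ofReal (Real.exp (t * (σ * truncId n x))) ∂μ
        ≤ ENNReal.ofReal (Real.exp (t * ∫ x, σ * truncId n x ∂μ + C * t ^ 2 / 4)) := by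
      intro n
      have hI : Integrable (fun x => Real.exp (t * (σ * truncId n x))) μ :=
        integrable_exp_mul_of_mem_Icc (a := -((n + 1) * (Real.pi / 2)))
          (b := (n + 1) * (Real.pi / 2)) (hcont n).measurable.aemeasurable
          (Eventually.of_forall fun x => abs_le.mp (hbd n x))
      rw [← ofReal_integral_eq_lintegral_ofReal hI
        (Eventually.of_forall fun x => (Real.exp_pos _).le)]
      refine ENNReal.ofReal_le_ofReal ?_
      have h1 := cgf_le_of_entropy_bound (hcont n) (hbd n)
        (mul_deriv_cgf_sub_cgf_le hCpos.le hC (contDiff_const.mul (contDiff_truncId n)) (hbd n)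
          (fun x => by
            rw [deriv_const_mul _ (hasDerivAt_truncId n x).differentiableAt, abs_mul, hσ, one_mul]
            exact abs_deriv_truncId_le n x)) ht
      have h2 := exp_cgf hI
      calc _ = mgf (fun x => σ * truncId n x) μ t := rfl
        _ = Real.exp (cgf (fun x => σ * truncId n x) μ t) := h2.symm
        _ ≤ _ := Real.exp_le_exp.mpr h1
    have hmeanlim : Tendsto (fun n => ∫ x, σ * truncId n x ∂μ) atTop (𝓝 0) := by
      have : Tendsto (fun n => ∫ x, σ * truncId n x ∂μ) atTop (𝓝 (∫ x, σ * x ∂μ)) := by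
        refine tendsto_integral_of_dominated_convergence (fun x => |x|)
          (fun n => (hcont n).aestronglyMeasurable) hint.abs
          (fun n => Eventually.of_forall fun x => ?_)
          (Eventually.of_forall fun x => (tendsto_truncId x).const_mul σ)
        rw [Real.norm_eq_abs, abs_mul, hσ, one_mul]
        exact abs_truncId_le_abs n x
      rwa [integral_const_mul, hmean, mul_zero] at this
    have hlim : Tendsto (fun n =>
        ENNReal.ofReal (Real.exp (t * ∫ x, σ * truncId n x ∂μ + C * t ^ 2 / 4))) atTop
        (𝓝 (ENNReal.ofReal (Real.exp (C / 4 * t ^ 2)))) := by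
      have h1 := ((hmeanlim.const_mul t).add_const (C * t ^ 2 / 4))
      have h2 := ENNReal.tendsto_ofReal ((Real.continuous_exp.tendsto _).comp h1)
      rw [mul_zero, zero_add, show C * t ^ 2 / 4 = C / 4 * t ^ 2 by ring] at h2
      refine h2.congr fun n => ?_
      simp only [Function.comp]
      congr 3; ring
    have hpt : ∀ x, liminf (fun n => ENNReal.ofReal (Real.exp (t * (σ * truncId n x)))) atTop
        = ENNReal.ofReal (Real.exp (t * (σ * x))) := fun x =>
      (ENNReal.tendsto_ofReal ((Real.continuous_exp.tendsto _).comp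
        (((tendsto_truncId x).const_mul σ).const_mul t))).liminf_eq
    calc ∫⁻ x, ENNReal.ofReal (Real.exp (t * (σ * x))) ∂μ
        = ∫⁻ x, liminf (fun n => ENNReal.ofReal (Real.exp (t * (σ * truncId n x)))) atTop ∂μ := by
          simp_rw [hpt]
      _ ≤ liminf (fun n => ∫⁻ x, ENNReal.ofReal (Real.exp (t * (σ * truncId n x))) ∂μ) atTop :=
          lintegral_liminf_le fun n =>
            (Real.measurable_exp.comp ((hcont n).measurable.const_mul t)).ennreal_ofReal
      _ ≤ liminf (fun n => ENNReal.ofReal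
            (Real.exp (t * ∫ x, σ * truncId n x ∂μ + C * t ^ 2 / 4))) atTop :=
          liminf_le_liminf (Eventually.of_forall hn)
      _ = _ := hlim.liminf_eq
  refine ⟨C / 4, by positivity, fun t => ?_⟩
  rcases lt_trichotomy t 0 with ht | rfl | ht
  · have := main (-1) (by simp) (-t) (by linarith)
    simpa using this
  · simp
  · simpa using main 1 (by simp) t ht

/-! ### Product measures and exponential moments -/

/-- The exponential with values in the extended nonnegative reals. -/
noncomputable def eexp (t : ℝ) : ℝ≥0∞ := ENNReal.ofReal (Real.exp t)

theorem eexp_add (s t : ℝ) : eexp (s + t) = eexp s * eexp t := by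
  rw [eexp, Real.exp_add, ENNReal.ofReal_mul (Real.exp_pos _).le, eexp, eexp]

@[simp] theorem eexp_zero : eexp 0 = 1 := by simp [eexp]

theorem eexp_sum {ι : Type*} (s : Finset ι) (f : ι → ℝ) :
    eexp (∑ i ∈ s, f i) = ∏ i ∈ s, eexp (f i) := by
  classical
  induction s using Finset.induction_on with
  | empty => simp
  | insert a s ha ih => rw [Finset.sum_insert ha, Finset.prod_insert ha, eexp_add, ih]

theorem eexp_le_eexp {s t : ℝ} (h : s ≤ t) : eexp s ≤ eexp t :=
  ENNReal.ofReal_le_ofReal (Real.exp_le_exp.mpr h)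

@[fun_prop]
theorem measurable_eexp : Measurable eexp := Real.measurable_exp.ennreal_ofReal

/-- Chernoff's bound. -/
theorem measure_le_eexp_of_lintegral_le {α : Type*} [MeasurableSpace α] {μ : Measure α} {f : α → ℝ}
    (hf : Measurable f) {l : ℝ} {M : ℝ≥0∞} (hM : ∫⁻ x, eexp (f x) ∂μ ≤ M) :
    μ {x | l ≤ f x} ≤ M * eexp (-l) := by
  have h := mul_meas_ge_le_lintegral (μ := μ) (measurable_eexp.comp hf) (eexp l)
  have h1 : μ {x | l ≤ f x} ≤ μ {x | eexp l ≤ (eexp ∘ f) x} :=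
    measure_mono fun x hx => eexp_le_eexp hx
  calc μ {x | l ≤ f x} = (eexp l * μ {x | l ≤ f x}) * eexp (-l) := by
        rw [mul_right_comm, ← eexp_add]; simp
    _ ≤ M * eexp (-l) := by
        gcongr
        exact (mul_le_mul_right h1 _).trans (h.trans hM)

section Pi

variable {ι : Type*} [Fintype ι]

/-- Resampling the coordinates in `S` from an independent copy preserves a product measure. -/
theorem measurePreserving_piecewise [DecidableEq ι] (μ : ι → Measure ℝ)
    [∀ i, IsProbabilityMeasure (μ i)] (S : Finset ι) :
    MeasurePreserving (fun p : (ι → ℝ) × (ι → ℝ) => S.piecewise p.1 p.2)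
      ((Measure.pi μ).prod (Measure.pi μ)) (Measure.pi μ) := by
  have hm : Measurable (fun p : (ι → ℝ) × (ι → ℝ) => S.piecewise p.1 p.2) := by
    refine measurable_pi_iff.mpr fun i => ?_
    by_cases hi : i ∈ S
    · simp only [Finset.piecewise_eq_of_mem _ _ _ hi]; fun_prop
    · simp only [Finset.piecewise_eq_of_notMem _ _ _ hi]; fun_prop
  refine ⟨hm, (Measure.pi_eq fun s hs => ?_).symm⟩
  rw [Measure.map_apply hm (MeasurableSet.univ_pi hs)]
  have : (fun p : (ι → ℝ) × (ι → ℝ) => S.piecewise p.1 p.2) ⁻¹' (Set.univ.pi s)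
      = (Set.univ.pi fun i => if i ∈ S then s i else Set.univ) ×ˢ
        (Set.univ.pi fun i => if i ∈ S then Set.univ else s i) := by
    ext p
    simp only [Set.mem_preimage, Set.mem_pi, Set.mem_univ, true_imp_iff, Set.mem_prod,
      ← forall_and]
    refine forall_congr' fun i => ?_
    by_cases hi : i ∈ S <;> simp [hi]
  rw [this, Measure.prod_prod, Measure.pi_pi, Measure.pi_pi, ← Finset.prod_mul_distrib]
  refine Finset.prod_congr rfl fun i _ => ?_
  by_cases hi : i ∈ S <;> simp [hi]

theorem lintegral_pi_piecewise [DecidableEq ι] (μ : ι → Measure ℝ)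
    [∀ i, IsProbabilityMeasure (μ i)] (S : Finset ι) {f : (ι → ℝ) → ℝ≥0∞} (hf : Measurable f) :
    ∫⁻ x, f x ∂Measure.pi μ
      = ∫⁻ y, ∫⁻ x, f (S.piecewise x y) ∂Measure.pi μ ∂Measure.pi μ := by
  have h := measurePreserving_piecewise μ S
  rw [← h.lintegral_comp hf]
  exact lintegral_prod_symm' _ (hf.comp h.measurable)

theorem lintegral_pi_prod (μ : ι → Measure ℝ) [∀ i, IsProbabilityMeasure (μ i)]
    {f : ι → ℝ → ℝ≥0∞} (hf : ∀ i, Measurable (f i)) :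
    ∫⁻ x, ∏ i, f i (x i) ∂Measure.pi μ = ∏ i, ∫⁻ t, f i t ∂μ i := by
  have h := lintegral_prod_eq_prod_lintegral_of_indepFun (μ := Measure.pi μ) Finset.univ
    (fun i x => f i (x i)) (iIndepFun_pi fun i => (hf i).aemeasurable)
    (fun i => (hf i).comp (measurable_pi_apply i))
  rw [h]
  exact Finset.prod_congr rfl fun i _ => (measurePreserving_eval μ i).lintegral_comp (hf i)

variable {ν : Measure ℝ} [IsProbabilityMeasure ν] {K : ℝ}

theorem lintegral_eexp_linear_le
    (hK : ∀ t : ℝ, ∫⁻ x, eexp (t * x) ∂ν ≤ eexp (K * t ^ 2)) (b : ι → ℝ) :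
    ∫⁻ x, eexp (∑ i, b i * x i) ∂Measure.pi (fun _ : ι => ν) ≤ eexp (K * ∑ i, b i ^ 2) := by
  simp_rw [eexp_sum]
  rw [lintegral_pi_prod (fun _ => ν) (f := fun i t => eexp (b i * t))
    (fun i => by fun_prop), Finset.mul_sum, eexp_sum]
  exact Finset.prod_le_prod' fun i _ => hK (b i)

theorem lintegral_eexp_gaussianReal (a : ℝ) :
    ∫⁻ g, eexp (a * g) ∂gaussianReal 0 1 = eexp (a ^ 2 / 2) := by
  have h := congrFun (mgf_id_gaussianReal (μ := 0) (v := 1)) a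
  simp only [mgf, id] at h
  simp only [eexp]
  rw [← ofReal_integral_eq_lintegral_ofReal (integrable_exp_mul_gaussianReal a)
    (Eventually.of_forall fun x => (Real.exp_pos _).le), h]
  simp

theorem lintegral_eexp_sq_gaussianReal :
    ∫⁻ g, eexp (3 / 8 * g ^ 2) ∂gaussianReal 0 1 = 2 := by
  have h := integral_gaussian (1 / 8)
  have hint : Integrable fun x : ℝ => Real.exp (-(1 / 8) * x ^ 2) :=
    integrable_exp_neg_mul_sq (by norm_num)
  rw [gaussianReal_of_var_ne_zero _ one_ne_zero,
    lintegral_withDensity_eq_lintegral_mul _ (measurable_gaussianPDF 0 1) (by fun_prop)]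
  have : ∀ x : ℝ, (gaussianPDF 0 1 * fun g => eexp (3 / 8 * g ^ 2)) x
      = ENNReal.ofReal ((√(2 * Real.pi))⁻¹ * Real.exp (-(1 / 8) * x ^ 2)) := fun x => by
    rw [Pi.mul_apply, gaussianPDF, gaussianPDFReal, eexp, ← ENNReal.ofReal_mul (by positivity),
      mul_assoc, ← Real.exp_add]
    simp only [NNReal.coe_one, mul_one]
    congr 3; ring
  simp_rw [this]
  rw [← ofReal_integral_eq_lintegral_ofReal (hint.const_mul _)
    (Eventually.of_forall fun x => by positivity), integral_const_mul, h]
  have h4 : Real.pi / (1 / 8) = 2 ^ 2 * (2 * Real.pi) := by ring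
  have h0 : √(2 * Real.pi) ≠ 0 := by positivity
  have h5 : √(2 ^ 2 * (2 * Real.pi)) = 2 * √(2 * Real.pi) := by
    rw [Real.sqrt_mul (by positivity), Real.sqrt_sq (by norm_num)]
  rw [h4, h5, mul_left_comm, inv_mul_cancel₀ h0]
  simp

/-- Exponential square integrability of linear forms, by linearizing the square with an auxiliary
Gaussian variable. -/
theorem lintegral_eexp_linear_sq_le
    (hK : ∀ t : ℝ, ∫⁻ x, eexp (t * x) ∂ν ≤ eexp (K * t ^ 2)) (b : ι → ℝ) {s : ℝ} (hs : 0 ≤ s)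
    (hsb : 16 * (K * s * ∑ i, b i ^ 2) ≤ 3) :
    ∫⁻ x, eexp (s * (∑ i, b i * x i) ^ 2) ∂Measure.pi (fun _ : ι => ν) ≤ 2 := by
  have h1 : ∀ x : ι → ℝ, eexp (s * (∑ i, b i * x i) ^ 2)
      = ∫⁻ g, eexp (∑ i, (√(2 * s) * g * b i) * x i) ∂gaussianReal 0 1 := fun x => by
    have : ∀ g : ℝ, ∑ i, (√(2 * s) * g * b i) * x i = (√(2 * s) * ∑ i, b i * x i) * g := fun g => by
      rw [Finset.mul_sum, Finset.sum_mul]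
      exact Finset.sum_congr rfl fun i _ => by ring
    simp_rw [this]
    rw [lintegral_eexp_gaussianReal, mul_pow, Real.sq_sqrt (by positivity)]
    congr 1; ring
  simp_rw [h1]
  rw [lintegral_lintegral_swap (by fun_prop)]
  calc _ ≤ ∫⁻ g, eexp (3 / 8 * g ^ 2) ∂gaussianReal 0 1 := by
        refine lintegral_mono fun g => (lintegral_eexp_linear_le hK _).trans (eexp_le_eexp ?_)
        have : ∑ i, (√(2 * s) * g * b i) ^ 2 = 2 * s * g ^ 2 * ∑ i, b i ^ 2 := by
          rw [Finset.mul_sum]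
          refine Finset.sum_congr rfl fun i _ => ?_
          rw [mul_pow, mul_pow, Real.sq_sqrt (by positivity)]
        rw [this]
        nlinarith [mul_le_mul_of_nonneg_right hsb (sq_nonneg g)]
    _ = 2 := lintegral_eexp_sq_gaussianReal

/-! ### Exponential moments of quadratic forms -/

theorem eexp_sum_le {κ : Type*} (t : Finset κ) {w p : κ → ℝ} (hw : ∀ i ∈ t, 0 ≤ w i)
    (hw1 : ∑ i ∈ t, w i ≤ 1) :
    eexp (∑ i ∈ t, w i * p i) ≤ 1 + ∑ i ∈ t, ENNReal.ofReal (w i) * eexp (p i) := by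
  have h := convexOn_exp.map_add_sum_le (t := t) (w := w) (p := p) (v := 1 - ∑ i ∈ t, w i) (q := 0)
    hw (by ring) (fun _ _ => trivial) (by linarith) trivial
  simp only [smul_eq_mul, mul_zero, zero_add, Real.exp_zero, mul_one] at h
  have h2 : Real.exp (∑ i ∈ t, w i * p i) ≤ 1 + ∑ i ∈ t, w i * Real.exp (p i) := by
    have := Finset.sum_nonneg hw
    linarith
  calc eexp (∑ i ∈ t, w i * p i) ≤ ENNReal.ofReal (1 + ∑ i ∈ t, w i * Real.exp (p i)) :=
        ENNReal.ofReal_le_ofReal h2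
    _ = _ := by
        have hnn : ∀ i ∈ t, 0 ≤ w i * Real.exp (p i) := fun i hi =>
          mul_nonneg (hw i hi) (Real.exp_pos _).le
        rw [ENNReal.ofReal_add zero_le_one (Finset.sum_nonneg hnn), ENNReal.ofReal_one,
          ENNReal.ofReal_sum_of_nonneg hnn]
        congr 1
        exact Finset.sum_congr rfl fun i hi => by rw [ENNReal.ofReal_mul (hw i hi), eexp]

/-- Exponential moment of a decoupled bilinear form: only products of a variable in `S` with a
variable outside `S` occur. -/
theorem lintegral_eexp_decoupled_le [DecidableEq ι] (hK0 : 0 ≤ K)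
    (hK : ∀ t : ℝ, ∫⁻ x, eexp (t * x) ∂ν ≤ eexp (K * t ^ 2)) (A : ι → ι → ℝ)
    (hA : ∑ i, ∑ j, A i j ^ 2 ≤ 1) {l : ℝ} (hl : 16 * (K * l) ^ 2 ≤ 3) (S : Finset ι) :
    ∫⁻ x, eexp (∑ i ∈ S, ∑ j ∈ Sᶜ, l * A i j * x i * x j) ∂Measure.pi (fun _ : ι => ν) ≤ 3 := by
  rw [lintegral_pi_piecewise _ S (by fun_prop)]
  set r : ι → ℝ := fun i => ∑ j ∈ Sᶜ, A i j ^ 2 with hr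
  have hr0 : ∀ i, 0 ≤ r i := fun i => Finset.sum_nonneg fun j _ => sq_nonneg _
  have hr1 : ∑ i ∈ S, r i ≤ 1 := by
    refine le_trans ?_ hA
    refine (Finset.sum_le_sum fun i _ => Finset.sum_le_sum_of_subset_of_nonneg
      (Finset.subset_univ _) fun _ _ _ => sq_nonneg _).trans ?_
    exact Finset.sum_le_sum_of_subset_of_nonneg (Finset.subset_univ _)
      fun i _ _ => Finset.sum_nonneg fun j _ => sq_nonneg _
  set L : ι → (ι → ℝ) → ℝ := fun i y => ∑ j, (if j ∈ S then 0 else A i j) * y j with hL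
  have hLr : ∀ i y, L i y ^ 2 = r i * (L i y ^ 2 / r i) := fun i y => by
    rcases eq_or_ne (r i) 0 with h0 | h0
    · have hz : ∀ j ∈ Sᶜ, A i j ^ 2 = 0 :=
        (Finset.sum_eq_zero_iff_of_nonneg fun j _ => sq_nonneg _).mp h0
      have : L i y = 0 := Finset.sum_eq_zero fun j _ => by
        by_cases hj : j ∈ S
        · simp [hj]
        · simp [hj, pow_eq_zero_iff (two_ne_zero) |>.mp (hz j (by simpa using hj))]
      simp [this]
    · field_simp
  have hLmeas : ∀ i, Measurable (L i) := fun i => by simp only [hL]; fun_prop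
  have inner : ∀ y : ι → ℝ, ∫⁻ x, eexp (∑ i ∈ S, ∑ j ∈ Sᶜ,
      l * A i j * S.piecewise x y i * S.piecewise x y j) ∂Measure.pi (fun _ : ι => ν)
      ≤ 1 + ∑ i ∈ S, ENNReal.ofReal (r i) * eexp (K * l ^ 2 / r i * L i y ^ 2) := by
    intro y
    have h1 : ∀ x : ι → ℝ, ∑ i ∈ S, ∑ j ∈ Sᶜ, l * A i j * S.piecewise x y i * S.piecewise x y j
        = ∑ i, (if i ∈ S then l * L i y else 0) * x i := fun x => by
      simp only [ite_mul, zero_mul, Finset.sum_ite_mem, Finset.univ_inter]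
      refine Finset.sum_congr rfl fun i hi => ?_
      have h2 : L i y = ∑ j ∈ Sᶜ, A i j * y j := by
        simp only [hL, ite_mul, zero_mul]
        rw [Finset.sum_ite, Finset.sum_const_zero, zero_add]
        congr 1; ext j; simp
      rw [h2, Finset.mul_sum, Finset.sum_mul]
      refine Finset.sum_congr rfl fun j hj => ?_
      rw [Finset.piecewise_eq_of_mem _ _ _ hi,
        Finset.piecewise_eq_of_notMem _ _ _ (Finset.mem_compl.mp hj)]
      ring
    simp_rw [h1]
    refine (lintegral_eexp_linear_le hK _).trans ?_
    have h3 : K * ∑ i, (if i ∈ S then l * L i y else 0) ^ 2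
        = ∑ i ∈ S, r i * (K * l ^ 2 / r i * L i y ^ 2) := by
      rw [Finset.mul_sum]
      simp only [ite_pow, ne_eq, OfNat.ofNat_ne_zero, not_false_eq_true, zero_pow, mul_ite,
        mul_zero, Finset.sum_ite_mem, Finset.univ_inter]
      refine Finset.sum_congr rfl fun i _ => ?_
      rw [mul_pow, hLr i y]; ring_nf
      by_cases h0 : r i = 0
      · simp [h0]
      · field_simp
    rw [h3]
    exact eexp_sum_le S (fun i _ => hr0 i) hr1
  refine (lintegral_mono inner).trans ?_
  rw [lintegral_add_left measurable_const, lintegral_finsetSum _ (fun i _ => by fun_prop)]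
  have h5 : ∀ i ∈ S, ∫⁻ y, ENNReal.ofReal (r i) * eexp (K * l ^ 2 / r i * L i y ^ 2)
      ∂Measure.pi (fun _ : ι => ν) ≤ ENNReal.ofReal (r i) * 2 := fun i _ => by
    rw [lintegral_const_mul _ (by fun_prop)]
    gcongr
    refine lintegral_eexp_linear_sq_le hK _ (by have := hr0 i; positivity) ?_
    have h6 : ∑ j, (if j ∈ S then 0 else A i j) ^ 2 = r i := by
      simp only [hr, ite_pow, ne_eq, OfNat.ofNat_ne_zero, not_false_eq_true, zero_pow]
      rw [Finset.sum_ite, Finset.sum_const_zero, zero_add]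
      congr 1; ext j; simp
    rw [h6]
    rcases eq_or_ne (r i) 0 with h0 | h0
    · simp [h0]
    · have : K * (K * l ^ 2 / r i) * r i = (K * l) ^ 2 := by field_simp
      rw [this]; exact hl
  have h7 := Finset.sum_le_sum h5
  rw [← Finset.sum_mul, ← ENNReal.ofReal_sum_of_nonneg (fun i _ => hr0 i)] at h7
  calc _ ≤ 1 + ENNReal.ofReal (∑ i ∈ S, r i) * 2 := by
        gcongr
        simp
    _ ≤ 1 + 1 * 2 := by
        gcongr
        simpa using ENNReal.ofReal_le_ofReal hr1
    _ = 3 := by norm_num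

/-- Summing a matrix over all the blocks `S × Sᶜ` counts each off-diagonal entry with
multiplicity `2 ^ n / 4`. -/
theorem sum_powerset_block [DecidableEq ι] (B : ι → ι → ℝ) (hB : ∀ i, B i i = 0) :
    4 * ∑ S : Finset ι, ∑ i ∈ S, ∑ j ∈ Sᶜ, B i j = 2 ^ Fintype.card ι * ∑ i, ∑ j, B i j := by
  have hcount : ∀ i j : ι, i ≠ j → (4 : ℝ) * ∑ S : Finset ι, (if i ∈ S ∧ j ∉ S then 1 else 0)
      = 2 ^ Fintype.card ι := by
    intro i j hij
    have h := Finset.prod_add (fun k => if k ≠ j then (1 : ℝ) else 0)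
      (fun k => if k ≠ i then (1 : ℝ) else 0) Finset.univ
    have h1 : ∀ S : Finset ι, ((∏ k ∈ S, if k ≠ j then (1 : ℝ) else 0) *
        ∏ k ∈ Finset.univ \ S, if k ≠ i then (1 : ℝ) else 0) = if i ∈ S ∧ j ∉ S then 1 else 0 := by
      intro S
      have e1 : (∀ k ∈ S, k ≠ j) ↔ j ∉ S := ⟨fun h hj => h j hj rfl, fun h k hk e => h (e ▸ hk)⟩
      have e2 : (∀ k ∈ Finset.univ \ S, k ≠ i) ↔ i ∈ S :=
        ⟨fun h => by_contra fun hi => h i (by simpa using hi) rfl,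
          fun h k hk e => by simp [e, h] at hk⟩
      rw [Finset.prod_ite_zero, Finset.prod_ite_zero]
      simp only [e1, e2, Finset.prod_const_one]
      by_cases hi : i ∈ S <;> by_cases hj : j ∈ S <;> simp [hi, hj]
    rw [Finset.powerset_univ, Finset.sum_congr rfl fun S _ => h1 S] at h
    rw [← h]
    have e3 : (∏ k, if k = i then (2 : ℝ) else 1) = 2 := by simp
    have e4 : (∏ k, if k = j then (2 : ℝ) else 1) = 2 := by simp
    calc (4 : ℝ) * ∏ k, ((if k ≠ j then (1 : ℝ) else 0) + if k ≠ i then (1 : ℝ) else 0)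
        = (∏ k, if k = i then (2 : ℝ) else 1) * (∏ k, if k = j then (2 : ℝ) else 1) *
          ∏ k, ((if k ≠ j then (1 : ℝ) else 0) + if k ≠ i then (1 : ℝ) else 0) := by
          rw [e3, e4]; norm_num
      _ = ∏ _k : ι, (2 : ℝ) := by
          rw [← Finset.prod_mul_distrib, ← Finset.prod_mul_distrib]
          refine Finset.prod_congr rfl fun k _ => ?_
          by_cases hi : k = i
          · have : k ≠ j := fun hj => hij (hi ▸ hj)
            simp [hi, hij]
          · by_cases hj : k = j
            · simp [hj, Ne.symm hij]
            · simp [hi, hj]; norm_num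
      _ = _ := by simp
  have hS : ∀ S : Finset ι, ∑ i ∈ S, ∑ j ∈ Sᶜ, B i j
      = ∑ i, ∑ j, B i j * (if i ∈ S ∧ j ∉ S then 1 else 0) := fun S => by
    rw [← Finset.sum_subset (Finset.subset_univ S)
      (fun i _ hi => Finset.sum_eq_zero fun j _ => by simp [hi])]
    refine Finset.sum_congr rfl fun i hi => ?_
    rw [← Finset.sum_subset (Finset.subset_univ Sᶜ)
      (fun j _ hj => by simp [Finset.mem_compl.not_left.mp hj])]
    exact Finset.sum_congr rfl fun j hj => by simp [hi, Finset.mem_compl.mp hj]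
  simp_rw [hS]
  rw [Finset.sum_comm, Finset.mul_sum, Finset.mul_sum]
  refine Finset.sum_congr rfl fun i _ => ?_
  rw [Finset.sum_comm, Finset.mul_sum, Finset.mul_sum]
  refine Finset.sum_congr rfl fun j _ => ?_
  rw [← Finset.mul_sum]
  rcases eq_or_ne i j with rfl | hij
  · simp [hB]
  · rw [← hcount i j hij]; ring

/-- Exponential moment of a quadratic form without diagonal terms, by averaging the decoupled
bilinear forms over all the blocks `S × Sᶜ`. -/
theorem lintegral_eexp_offDiag_le [DecidableEq ι] (hK0 : 0 ≤ K)
    (hK : ∀ t : ℝ, ∫⁻ x, eexp (t * x) ∂ν ≤ eexp (K * t ^ 2)) (A : ι → ι → ℝ)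
    (hA : ∑ i, ∑ j, A i j ^ 2 ≤ 1) (hA0 : ∀ i, A i i = 0) {l : ℝ} (hl : (16 * (K * l)) ^ 2 ≤ 3) :
    ∫⁻ x, eexp (l * ∑ i, ∑ j, A i j * x i * x j) ∂Measure.pi (fun _ : ι => ν) ≤ 4 := by
  set w : ℝ := (2 ^ Fintype.card ι)⁻¹ with hw
  have hw0 : 0 < w := by positivity
  have hcard : ((Finset.univ : Finset (Finset ι)).card : ℝ) * w = 1 := by
    rw [Finset.card_univ, Fintype.card_finset, hw]; push_cast
    exact mul_inv_cancel₀ (by positivity)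
  have hp : ∀ x : ι → ℝ, l * ∑ i, ∑ j, A i j * x i * x j
      = ∑ S : Finset ι, w * (∑ i ∈ S, ∑ j ∈ Sᶜ, (4 * l) * A i j * x i * x j) := fun x => by
    have h := sum_powerset_block (fun i j => l * A i j * x i * x j) (fun i => by simp [hA0])
    have h1 : ∀ S : Finset ι, ∑ i ∈ S, ∑ j ∈ Sᶜ, (4 * l) * A i j * x i * x j
        = 4 * ∑ i ∈ S, ∑ j ∈ Sᶜ, l * A i j * x i * x j := fun S => by
      simp_rw [Finset.mul_sum, mul_assoc]
    simp_rw [h1]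
    rw [← Finset.mul_sum, ← Finset.mul_sum, h, hw, inv_mul_cancel_left₀ (by positivity),
      Finset.mul_sum]
    simp_rw [Finset.mul_sum, mul_assoc]
  simp_rw [hp]
  have hone : ∑ _S : Finset ι, w = 1 := by rw [Finset.sum_const, nsmul_eq_mul, hcard]
  refine (lintegral_mono fun x => eexp_sum_le Finset.univ (fun _ _ => hw0.le) hone.le).trans ?_
  rw [lintegral_add_left measurable_const, lintegral_finsetSum _ (fun i _ => by fun_prop)]
  have h5 : ∀ S ∈ (Finset.univ : Finset (Finset ι)), ∫⁻ x, ENNReal.ofReal w *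
      eexp (∑ i ∈ S, ∑ j ∈ Sᶜ, (4 * l) * A i j * x i * x j) ∂Measure.pi (fun _ : ι => ν)
      ≤ ENNReal.ofReal w * 3 := fun S _ => by
    rw [lintegral_const_mul _ (by fun_prop)]
    gcongr
    exact lintegral_eexp_decoupled_le hK0 hK A hA (by nlinarith) S
  have h7 := Finset.sum_le_sum h5
  rw [← Finset.sum_mul, ← ENNReal.ofReal_sum_of_nonneg (fun _ _ => hw0.le), hone] at h7
  refine (add_le_add_right h7 _).trans ?_
  simp only [lintegral_const, measure_univ, mul_one, ENNReal.ofReal_one, one_mul]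
  norm_num

theorem lintegral_eexp_diag_le {v D u₀ : ℝ}
    (hD : ∀ u : ℝ, |u| ≤ u₀ → ∫⁻ x, eexp (u * (x ^ 2 - v)) ∂ν ≤ eexp (D * u ^ 2)) (a : ι → ℝ)
    (ha : ∀ i, |a i| ≤ u₀) :
    ∫⁻ x, eexp (∑ i, a i * (x i ^ 2 - v)) ∂Measure.pi (fun _ : ι => ν)
      ≤ eexp (D * ∑ i, a i ^ 2) := by
  simp_rw [eexp_sum]
  rw [lintegral_pi_prod (fun _ => ν) (f := fun i t => eexp (a i * (t ^ 2 - v)))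
    (fun i => by fun_prop), Finset.mul_sum, eexp_sum]
  exact Finset.prod_le_prod' fun i _ => hD (a i) (ha i)

end Pi

/-- The centred square of a sub-Gaussian variable has a quadratically bounded log-Laplace
transform near zero. -/
theorem exists_lintegral_eexp_sq_sub_le {ν : Measure ℝ} [IsProbabilityMeasure ν] {K : ℝ}
    (hK0 : 0 < K) (hK : ∀ t : ℝ, ∫⁻ x, eexp (t * x) ∂ν ≤ eexp (K * t ^ 2)) {v : ℝ} (hv : 0 ≤ v)
    (hvar : ∫ x, x ^ 2 ∂ν = v) (hint : Integrable (fun x : ℝ => x ^ 2) ν) :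
    ∃ D u₀ : ℝ, 0 ≤ D ∧ 0 < u₀ ∧
      ∀ u : ℝ, |u| ≤ u₀ → ∫⁻ x, eexp (u * (x ^ 2 - v)) ∂ν ≤ eexp (D * u ^ 2) := by
  set s : ℝ := 3 / (16 * K) with hs
  have hs0 : 0 < s := by positivity
  have h1 : ∫⁻ x, eexp (s * x ^ 2) ∂ν ≤ 2 := by
    have h := lintegral_eexp_linear_sq_le (ι := Unit) hK (fun _ => 1) hs0.le
      (by simp [hs]; field_simp; norm_num)
    simp only [Finset.univ_unique, one_mul, Finset.sum_singleton] at h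
    rwa [(measurePreserving_eval (fun _ : Unit => ν) default).lintegral_comp
      (f := fun t => eexp (s * t ^ 2)) (by fun_prop)] at h
  have hexp : Integrable (fun x : ℝ => Real.exp (s * x ^ 2)) ν := by
    refine ⟨by fun_prop, ?_⟩
    rw [hasFiniteIntegral_iff_ofReal (Eventually.of_forall fun x => (Real.exp_pos _).le)]
    exact h1.trans_lt (by simp)
  have hexp' : Integrable (fun x : ℝ => Real.exp (s * (x ^ 2 + v))) ν := by
    have := hexp.mul_const (Real.exp (s * v))
    refine this.congr (Eventually.of_forall fun x => ?_)
    simp only [← Real.exp_add]; congr 1; ring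
  set M := ∫ x, Real.exp (s * (x ^ 2 + v)) ∂ν with hM
  have hM0 : 0 ≤ M := integral_nonneg fun x => (Real.exp_pos _).le
  refine ⟨8 / s ^ 2 * M, s / 2, by positivity, by positivity, fun u hu => ?_⟩
  -- `exp y ≤ 1 + y + y² exp |y|`, and `y² exp |y|` is absorbed by the exponential of rate `s`.
  have hpt : ∀ x : ℝ, Real.exp (u * (x ^ 2 - v))
      ≤ 1 + u * (x ^ 2 - v) + 8 / s ^ 2 * u ^ 2 * Real.exp (s * (x ^ 2 + v)) := fun x => by
    set W := x ^ 2 + v with hW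
    have hW0 : 0 ≤ W := by positivity
    have hy : |u * (x ^ 2 - v)| ≤ |u| * W := by
      rw [abs_mul]
      gcongr
      rw [abs_le]; constructor <;> nlinarith [sq_nonneg x]
    set y := u * (x ^ 2 - v)
    have e1 : Real.exp y ≤ 1 + y + y ^ 2 * Real.exp |y| := by
      have h := Complex.norm_exp_sub_sum_le_norm_mul_exp (y : ℂ) 2
      simp only [Finset.sum_range_succ, Finset.sum_range_zero, pow_zero, pow_one, Nat.factorial,
        Nat.cast_one, div_one, zero_add, mul_one] at h
      rw [← Complex.ofReal_exp, ← Complex.ofReal_one, ← Complex.ofReal_add, ← Complex.ofReal_sub,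
        Complex.norm_real, Complex.norm_real, Real.norm_eq_abs, Real.norm_eq_abs, sq_abs] at h
      have := le_abs_self (Real.exp y - (1 + y))
      linarith
    have e2 : y ^ 2 ≤ u ^ 2 * W ^ 2 := by
      rw [← sq_abs y, ← sq_abs u, ← mul_pow]
      exact pow_le_pow_left₀ (abs_nonneg _) hy 2
    have e3 : |y| ≤ s / 2 * W := hy.trans (by gcongr)
    have e4 : (s / 2 * W) ^ 2 / 2 ≤ Real.exp (s / 2 * W) := by
      have := Real.quadratic_le_exp_of_nonneg (x := s / 2 * W) (by positivity)
      have : 0 ≤ s / 2 * W := by positivity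
      linarith
    have e5 : W ^ 2 ≤ 8 / s ^ 2 * Real.exp (s / 2 * W) := by
      have : W ^ 2 = 8 / s ^ 2 * ((s / 2 * W) ^ 2 / 2) := by field_simp; ring
      rw [this]; gcongr
    have e6 : y ^ 2 * Real.exp |y| ≤ 8 / s ^ 2 * u ^ 2 * Real.exp (s * W) := by
      calc y ^ 2 * Real.exp |y| ≤ (u ^ 2 * (8 / s ^ 2 * Real.exp (s / 2 * W))) *
            Real.exp (s / 2 * W) := by
            gcongr
            exact e2.trans (by gcongr)
        _ = 8 / s ^ 2 * u ^ 2 * (Real.exp (s / 2 * W) * Real.exp (s / 2 * W)) := by ring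
        _ = _ := by rw [← Real.exp_add]; congr 2; ring
    linarith
  have hi1 : Integrable (fun x : ℝ => u * (x ^ 2 - v)) ν :=
    (hint.sub (integrable_const v)).const_mul u
  have hi2 : Integrable (fun x : ℝ => 1 + u * (x ^ 2 - v)) ν := (integrable_const 1).add hi1
  have hi3 := hexp'.const_mul (8 / s ^ 2 * u ^ 2)
  have hz : ∫ x, (x ^ 2 - v) ∂ν = 0 := by
    rw [integral_sub hint (integrable_const v), hvar]; simp
  calc ∫⁻ x, eexp (u * (x ^ 2 - v)) ∂ν
      ≤ ∫⁻ x, ENNReal.ofReal (1 + u * (x ^ 2 - v) +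
          8 / s ^ 2 * u ^ 2 * Real.exp (s * (x ^ 2 + v))) ∂ν :=
        lintegral_mono fun x => ENNReal.ofReal_le_ofReal (hpt x)
    _ = ENNReal.ofReal (∫ x, (1 + u * (x ^ 2 - v) +
          8 / s ^ 2 * u ^ 2 * Real.exp (s * (x ^ 2 + v))) ∂ν) :=
        (ofReal_integral_eq_lintegral_ofReal (hi2.add hi3)
          (Eventually.of_forall fun x => (Real.exp_pos _).le.trans (hpt x))).symm
    _ ≤ _ := by
        refine ENNReal.ofReal_le_ofReal ?_
        rw [integral_add hi2 hi3, integral_add (integrable_const 1) hi1, integral_const_mul,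
          integral_const_mul, hz, ← hM]
        have := Real.add_one_le_exp (8 / s ^ 2 * M * u ^ 2)
        simp only [integral_const, probReal_univ, smul_eq_mul, mul_one, mul_zero, add_zero]
        linarith

/-! ### The Hanson–Wright inequality -/

/-- The upper tail of a centred real quadratic form, normalized in Hilbert–Schmidt norm. The
diagonal and the off-diagonal parts are estimated separately. -/
theorem measure_quadratic_ge_le {ι : Type*} [Fintype ι] [DecidableEq ι] {ν : Measure ℝ}
    [IsProbabilityMeasure ν] {K : ℝ} (hK0 : 0 < K)
    (hK : ∀ t : ℝ, ∫⁻ x, eexp (t * x) ∂ν ≤ eexp (K * t ^ 2)) {v D u₀ : ℝ} (hD0 : 0 ≤ D)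
    (hu₀ : 0 < u₀)
    (hD : ∀ u : ℝ, |u| ≤ u₀ → ∫⁻ x, eexp (u * (x ^ 2 - v)) ∂ν ≤ eexp (D * u ^ 2))
    (A : ι → ι → ℝ) (hA : ∑ i, ∑ j, A i j ^ 2 ≤ 1) {t : ℝ} (ht : 0 ≤ t) :
    Measure.pi (fun _ : ι => ν) {x | t ≤ ∑ i, ∑ j, A i j * x i * x j - v * ∑ i, A i i}
      ≤ ENNReal.ofReal ((4 + Real.exp (D * u₀ ^ 2)) *
          Real.exp (-(min (1 / (16 * K)) u₀ / 2 * t))) := by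
  set l : ℝ := 1 / (16 * K) with hl
  have hl0 : 0 < l := by positivity
  set off : (ι → ℝ) → ℝ := fun x => ∑ i, ∑ j, (if i = j then 0 else A i j) * x i * x j with hoff
  set dg : (ι → ℝ) → ℝ := fun x => ∑ i, A i i * (x i ^ 2 - v) with hdg
  have hrow : ∀ i, A i i ^ 2 ≤ ∑ j, A i j ^ 2 := fun i =>
    Finset.single_le_sum (f := fun j => A i j ^ 2) (fun j _ => sq_nonneg _) (Finset.mem_univ i)
  have hdiag : ∑ i, A i i ^ 2 ≤ 1 := (Finset.sum_le_sum fun i _ => hrow i).trans hA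
  have hsplit : ∀ x : ι → ℝ, ∑ i, ∑ j, A i j * x i * x j - v * ∑ i, A i i = off x + dg x := by
    intro x
    simp only [hoff, hdg, Finset.mul_sum, ← Finset.sum_add_distrib, ← Finset.sum_sub_distrib]
    refine Finset.sum_congr rfl fun i _ => ?_
    have : ∀ j, A i j * x i * x j = (if i = j then 0 else A i j) * x i * x j +
        if i = j then A i j * x i * x j else 0 := fun j => by split_ifs <;> simp
    rw [Finset.sum_congr rfl fun j _ => this j, Finset.sum_add_distrib, Finset.sum_ite_eq]
    simp only [Finset.mem_univ, if_true]
    ring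
  have h1 : Measure.pi (fun _ : ι => ν) {x | l * (t / 2) ≤ l * off x}
      ≤ 4 * eexp (-(l * (t / 2))) := by
    refine measure_le_eexp_of_lintegral_le (by simp only [hoff]; fun_prop) ?_
    refine lintegral_eexp_offDiag_le hK0.le hK _ ?_ (fun i => by simp) ?_
    · refine le_trans (Finset.sum_le_sum fun i _ => Finset.sum_le_sum fun j _ => ?_) hA
      split_ifs
      · simpa using sq_nonneg (A i j)
      · exact le_rfl
    · rw [hl]; field_simp; norm_num
  have h2 : Measure.pi (fun _ : ι => ν) {x | u₀ * (t / 2) ≤ u₀ * dg x}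
      ≤ eexp (D * u₀ ^ 2) * eexp (-(u₀ * (t / 2))) := by
    refine measure_le_eexp_of_lintegral_le (by simp only [hdg]; fun_prop) ?_
    have h3 := lintegral_eexp_diag_le hD (fun i => u₀ * A i i) (fun i => by
      rw [abs_mul, abs_of_pos hu₀]
      have : |A i i| ≤ 1 := by
        rw [← sq_le_one_iff_abs_le_one]
        exact (Finset.single_le_sum (f := fun i => A i i ^ 2) (fun j _ => sq_nonneg _)
          (Finset.mem_univ i)).trans hdiag
      nlinarith)
    simp only [hdg, Finset.mul_sum, ← mul_assoc]
    refine h3.trans (eexp_le_eexp ?_)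
    simp only [mul_pow, ← Finset.mul_sum]
    nlinarith [mul_le_mul_of_nonneg_left hdiag (by positivity : 0 ≤ D * u₀ ^ 2)]
  have hsub : {x : ι → ℝ | t ≤ ∑ i, ∑ j, A i j * x i * x j - v * ∑ i, A i i}
      ⊆ {x | l * (t / 2) ≤ l * off x} ∪ {x | u₀ * (t / 2) ≤ u₀ * dg x} := by
    intro x hx
    rw [Set.mem_ofPred_eq, hsplit] at hx
    simp only [Set.mem_union, Set.mem_ofPred_eq, mul_le_mul_iff_right₀ hl0,
      mul_le_mul_iff_right₀ hu₀]
    by_contra! h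
    linarith
  calc _ ≤ _ := measure_mono hsub
    _ ≤ _ := measure_union_le _ _
    _ ≤ 4 * eexp (-(l * (t / 2))) + eexp (D * u₀ ^ 2) * eexp (-(u₀ * (t / 2))) := add_le_add h1 h2
    _ ≤ 4 * eexp (-(min l u₀ / 2 * t)) + eexp (D * u₀ ^ 2) * eexp (-(min l u₀ / 2 * t)) := by
        gcongr <;> refine eexp_le_eexp ?_
        · nlinarith [mul_le_mul_of_nonneg_right (min_le_left l u₀) ht]
        · nlinarith [mul_le_mul_of_nonneg_right (min_le_right l u₀) ht]
    _ = _ := by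
        rw [← add_mul, ENNReal.ofReal_mul (by positivity),
          ENNReal.ofReal_add (by norm_num) (Real.exp_pos _).le]
        simp [eexp]

/-- The Hanson–Wright inequality in its exponential form, for complex coefficient matrices and
independent copies of a centred sub-Gaussian variable: deviations are measured in units of the
Hilbert–Schmidt norm of the matrix. -/
theorem exists_hansonWright {ν : Measure ℝ} [IsProbabilityMeasure ν] {K : ℝ} (hK0 : 0 < K)
    (hK : ∀ t : ℝ, ∫⁻ x, eexp (t * x) ∂ν ≤ eexp (K * t ^ 2)) {v : ℝ} (hv : 0 ≤ v)
    (hvar : ∫ x, x ^ 2 ∂ν = v) (hint : Integrable (fun x : ℝ => x ^ 2) ν) :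
    ∃ C c : ℝ, 0 < C ∧ 0 < c ∧ ∀ (ι : Type) [Fintype ι] (A : ι → ι → ℂ) (t : ℝ), 0 ≤ t →
      Measure.pi (fun _ : ι => ν) {x | t * √(∑ i, ∑ j, ‖A i j‖ ^ 2)
        < ‖∑ i, ∑ j, A i j * x i * x j - v * ∑ i, A i i‖}
      ≤ ENNReal.ofReal (C * Real.exp (-c * t)) := by
  classical
  obtain ⟨D, u₀, hD0, hu₀, hD⟩ := exists_lintegral_eexp_sq_sub_le hK0 hK hv hvar hint
  set c₀ := min (1 / (16 * K)) u₀ with hc₀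
  have hc₀pos : 0 < c₀ := lt_min (by positivity) hu₀
  set C₀ := 4 + Real.exp (D * u₀ ^ 2) with hC₀
  refine ⟨4 * C₀, c₀ / 4, by positivity, by positivity, fun ι _ A t ht => ?_⟩
  set S := ∑ i, ∑ j, ‖A i j‖ ^ 2 with hS
  have hS0 : 0 ≤ S := Finset.sum_nonneg fun i _ => Finset.sum_nonneg fun j _ => sq_nonneg _
  rcases hS0.eq_or_lt with h0 | hpos
  · have hz : ∀ i j, A i j = 0 := fun i j => by
      have h1 := (Finset.sum_eq_zero_iff_of_nonneg
        (fun i _ => Finset.sum_nonneg fun j _ => sq_nonneg _)).mp h0.symm i (Finset.mem_univ i)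
      have h2 := (Finset.sum_eq_zero_iff_of_nonneg
        (fun j _ => sq_nonneg _)).mp h1 j (Finset.mem_univ j)
      simpa using h2
    simp [← h0, hz]
  set h := √S with hh
  have hhpos : 0 < h := Real.sqrt_pos.mpr hpos
  -- For a unit functional `φ` (plus or minus the real or the imaginary part).
  have key : ∀ φ : ℂ →ₗ[ℝ] ℝ, (∀ z, |φ z| ≤ ‖z‖) → Measure.pi (fun _ : ι => ν)
      {x | t / 2 * h ≤ φ (∑ i, ∑ j, A i j * x i * x j - v * ∑ i, A i i)}
      ≤ ENNReal.ofReal (C₀ * Real.exp (-(c₀ / 4) * t)) := by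
    intro φ hφ
    have h1 := measure_quadratic_ge_le hK0 hK hD0 hu₀ hD (fun i j => φ (A i j) / h)
      (by
        simp_rw [div_pow, ← Finset.sum_div]
        rw [div_le_one (by positivity), hh, Real.sq_sqrt hS0, hS]
        refine Finset.sum_le_sum fun i _ => Finset.sum_le_sum fun j _ => ?_
        rw [← sq_abs]
        exact pow_le_pow_left₀ (abs_nonneg _) (hφ _) 2) (t := t / 2) (by positivity)
    rw [← hc₀, ← hC₀, show -(c₀ / 2 * (t / 2)) = -(c₀ / 4) * t by ring] at h1
    refine (measure_mono fun x hx => ?_).trans h1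
    have h2 : φ (∑ i, ∑ j, A i j * x i * x j - v * ∑ i, A i i)
        = ∑ i, ∑ j, φ (A i j) * x i * x j - v * ∑ i, φ (A i i) := by
      have e1 : ∀ (r : ℝ) (z : ℂ), φ (z * r) = φ z * r := fun r z => by
        rw [mul_comm z, ← Complex.real_smul, map_smul, smul_eq_mul, mul_comm]
      rw [map_sub, mul_comm (v : ℂ), e1, map_sum, map_sum]
      simp_rw [map_sum, e1]
      rw [mul_comm v]
    rw [Set.mem_ofPred_eq, h2, ← le_div_iff₀ hhpos] at hx
    refine hx.trans (le_of_eq ?_)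
    rw [sub_div, Finset.sum_div, mul_div_assoc, Finset.sum_div]
    congr 1
    refine Finset.sum_congr rfl fun i _ => ?_
    rw [Finset.sum_div]
    exact Finset.sum_congr rfl fun j _ => by ring
  have k1 := key Complex.reLm Complex.abs_re_le_norm
  have k2 := key (-Complex.reLm) (fun z => by simpa using Complex.abs_re_le_norm z)
  have k3 := key Complex.imLm Complex.abs_im_le_norm
  have k4 := key (-Complex.imLm) (fun z => by simpa using Complex.abs_im_le_norm z)
  refine (measure_mono (t := ((_ ∪ _) ∪ (_ ∪ _))) ?_).trans ((measure_union_le _ _).trans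
    ((add_le_add ((measure_union_le _ _).trans (add_le_add k1 k2))
      ((measure_union_le _ _).trans (add_le_add k3 k4))).trans (le_of_eq ?_)))
  · intro x hx
    rw [Set.mem_ofPred_eq] at hx
    simp only [Set.mem_union, Set.mem_ofPred_eq, Complex.reLm_coe, LinearMap.neg_apply,
      Complex.imLm_coe]
    generalize ∑ i, ∑ j, A i j * x i * x j - v * ∑ i, A i i = z at hx ⊢
    by_contra! hcon
    have h5 : |z.re| ≤ t / 2 * h := abs_le.mpr ⟨by linarith [hcon.1.2], by linarith [hcon.1.1]⟩
    have h6 : |z.im| ≤ t / 2 * h := abs_le.mpr ⟨by linarith [hcon.2.2], by linarith [hcon.2.1]⟩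
    have := Complex.norm_le_abs_re_add_abs_im z
    linarith
  · rw [← ENNReal.ofReal_add (by positivity) (by positivity),
      ← ENNReal.ofReal_add (by positivity) (by positivity)]
    congr 1; ring

/-! ### Resolvents of Hermitian matrices -/

/-- The principal minor obtained by deleting the row and the column `i`. -/
def minor {n : Type*} (H : Matrix n n ℂ) (i : n) : Matrix {j // j ≠ i} {j // j ≠ i} ℂ :=
  H.submatrix Subtype.val Subtype.val

theorem minor_isHermitian {n : Type*} {H : Matrix n n ℂ} (hH : H.IsHermitian) (i : n) :
    (minor H i).IsHermitian := hH.submatrix _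

theorem sub_smul_one_minor {n : Type*} [DecidableEq n] (H : Matrix n n ℂ) (z : ℂ) (i : n)
    (j k : {j // j ≠ i}) :
    (minor H i - z • (1 : Matrix {j // j ≠ i} {j // j ≠ i} ℂ)) j k
      = (H - z • (1 : Matrix n n ℂ)) j k := by
  simp [minor, Matrix.one_apply, Subtype.ext_iff]

section Resolvent

variable {n : Type*} [Fintype n] [DecidableEq n]

/-- The resolvent (Green function) `(H - z)⁻¹` of a matrix. -/
noncomputable def green (H : Matrix n n ℂ) (z : ℂ) : Matrix n n ℂ :=
  (H - z • (1 : Matrix n n ℂ))⁻¹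

theorem green_eq_conj_diagonal {H : Matrix n n ℂ} (hH : H.IsHermitian) {z : ℂ} (hz : 0 < z.im) :
    (H - z • (1 : Matrix n n ℂ)) * Unitary.conjStarAlgAut ℂ (Matrix n n ℂ) hH.eigenvectorUnitary
        (Matrix.diagonal fun α => ((hH.eigenvalues α : ℂ) - z)⁻¹) = 1 ∧
    green H z = Unitary.conjStarAlgAut ℂ (Matrix n n ℂ) hH.eigenvectorUnitary
        (Matrix.diagonal fun α => ((hH.eigenvalues α : ℂ) - z)⁻¹) := by
  set φ := Unitary.conjStarAlgAut ℂ (Matrix n n ℂ) hH.eigenvectorUnitary with hφ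
  have hne : ∀ α, ((hH.eigenvalues α : ℂ) - z) ≠ 0 := fun α h => by
    have := congrArg Complex.im h
    simp at this
    exact hz.ne' this
  have h1 : H - z • (1 : Matrix n n ℂ)
      = φ (Matrix.diagonal fun α => ((hH.eigenvalues α : ℂ) - z)) := by
    have h2 : (Matrix.diagonal fun α => ((hH.eigenvalues α : ℂ) - z))
        = Matrix.diagonal (RCLike.ofReal ∘ hH.eigenvalues) - z • (1 : Matrix n n ℂ) := by
      ext a b
      by_cases hab : a = b
      · subst hab; simp
      · simp [hab]
    rw [h2, map_sub, map_smul, map_one, hφ, ← hH.spectral_theorem]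
  have h3 : (H - z • (1 : Matrix n n ℂ)) *
      φ (Matrix.diagonal fun α => ((hH.eigenvalues α : ℂ) - z)⁻¹) = 1 := by
    rw [h1, ← map_mul, Matrix.diagonal_mul_diagonal]
    simp [hne]
  exact ⟨h3, Matrix.inv_eq_right_inv h3⟩

theorem mul_green {H : Matrix n n ℂ} (hH : H.IsHermitian) {z : ℂ} (hz : 0 < z.im) :
    (H - z • (1 : Matrix n n ℂ)) * green H z = 1 := by
  rw [(green_eq_conj_diagonal hH hz).2, (green_eq_conj_diagonal hH hz).1]

theorem green_mul {H : Matrix n n ℂ} (hH : H.IsHermitian) {z : ℂ} (hz : 0 < z.im) :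
    green H z * (H - z • (1 : Matrix n n ℂ)) = 1 :=
  mul_eq_one_comm.mp (mul_green hH hz)

theorem trace_green {H : Matrix n n ℂ} (hH : H.IsHermitian) {z : ℂ} (hz : 0 < z.im) :
    (green H z).trace = ∑ α, ((hH.eigenvalues α : ℂ) - z)⁻¹ := by
  rw [(green_eq_conj_diagonal hH hz).2, Unitary.conjStarAlgAut_apply, Matrix.trace_mul_cycle]
  simp [Matrix.trace_diagonal]

/-- The Ward identity. -/
theorem sum_norm_sq_green {H : Matrix n n ℂ} (hH : H.IsHermitian) {z : ℂ} (hz : 0 < z.im) (i : n) :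
    ∑ j, ‖green H z i j‖ ^ 2 = (green H z i i).im / z.im ∧
    ∑ j, ‖green H z j i‖ ^ 2 = (green H z i i).im / z.im := by
  set G := green H z with hG
  have h1 := mul_green hH hz
  have h2 := green_mul hH hz
  rw [← hG] at h1 h2
  have hc : (H - z • (1 : Matrix n n ℂ)).conjTranspose = H - star z • (1 : Matrix n n ℂ) := by
    rw [Matrix.conjTranspose_sub, Matrix.conjTranspose_smul, Matrix.conjTranspose_one, hH.eq]
  have h1' := congrArg Matrix.conjTranspose h1
  have h2' := congrArg Matrix.conjTranspose h2
  rw [Matrix.conjTranspose_mul, Matrix.conjTranspose_one, hc] at h1' h2'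
  have hd : (H - star z • (1 : Matrix n n ℂ)) - (H - z • (1 : Matrix n n ℂ))
      = (z - star z) • (1 : Matrix n n ℂ) := by rw [sub_smul]; abel
  have w1 : G - G.conjTranspose = (z - star z) • (G * G.conjTranspose) := by
    calc G - G.conjTranspose = G * (H - star z • (1 : Matrix n n ℂ)) * G.conjTranspose
          - G * (H - z • (1 : Matrix n n ℂ)) * G.conjTranspose := by
          rw [h2, one_mul, mul_assoc, h2', mul_one]
      _ = G * ((H - star z • (1 : Matrix n n ℂ)) - (H - z • (1 : Matrix n n ℂ))) *
          G.conjTranspose := by rw [← sub_mul, ← mul_sub]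
      _ = _ := by rw [hd]; simp
  have w2 : G - G.conjTranspose = (z - star z) • (G.conjTranspose * G) := by
    calc G - G.conjTranspose = G.conjTranspose * (H - star z • (1 : Matrix n n ℂ)) * G
          - G.conjTranspose * (H - z • (1 : Matrix n n ℂ)) * G := by
          rw [h1', one_mul, mul_assoc, h1, mul_one]
      _ = G.conjTranspose * ((H - star z • (1 : Matrix n n ℂ)) - (H - z • (1 : Matrix n n ℂ))) *
          G := by rw [← sub_mul, ← mul_sub]
      _ = _ := by rw [hd]; simp
  have hzz : z - star z = ((2 * z.im : ℝ) : ℂ) * Complex.I := by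
    apply Complex.ext <;> simp
    ring
  have hGG : ∀ w : ℂ, w - star w = ((2 * w.im : ℝ) : ℂ) * Complex.I := fun w => by
    apply Complex.ext <;> simp
    ring
  have e1 := congrFun (congrFun w1 i) i
  have e2 := congrFun (congrFun w2 i) i
  simp only [Matrix.sub_apply, Matrix.conjTranspose_apply, Matrix.smul_apply, Matrix.mul_apply,
    smul_eq_mul, hGG] at e1 e2
  have f1 : ∀ w : ℂ, w * star w = ((‖w‖ ^ 2 : ℝ) : ℂ) := fun w => by
    rw [← starRingEnd_apply, Complex.mul_conj, Complex.normSq_eq_norm_sq]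
  have f2 : ∀ w : ℂ, star w * w = ((‖w‖ ^ 2 : ℝ) : ℂ) := fun w => by rw [mul_comm, f1]
  simp only [f1] at e1
  simp only [f2] at e2
  rw [← Complex.ofReal_sum, mul_right_comm] at e1 e2
  have e1' := mul_right_cancel₀ Complex.I_ne_zero e1
  have e2' := mul_right_cancel₀ Complex.I_ne_zero e2
  rw [← Complex.ofReal_mul, Complex.ofReal_inj] at e1' e2'
  constructor
  · rw [eq_div_iff hz.ne']; linarith
  · rw [eq_div_iff hz.ne']; linarith

/-- Schur's complement formula for a diagonal resolvent entry. -/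
theorem green_diag_mul_schur {H : Matrix n n ℂ} (hH : H.IsHermitian) {z : ℂ} (hz : 0 < z.im)
    (i : n) : green H z i i * (H i i - z - ∑ j : {j // j ≠ i}, ∑ k : {j // j ≠ i},
      H i j * green (minor H i) z j k * H k i) = 1 := by
  set G := green H z with hG
  set G' := green (minor H i) z with hG'
  have h1 : ∀ a b, ∑ c, (H - z • (1 : Matrix n n ℂ)) a c * G c b
      = if a = b then 1 else 0 := fun a b => by
    rw [← Matrix.mul_apply, hG, mul_green hH hz, Matrix.one_apply]
  have h2 : ∀ a b, ∑ c, G' a c * (minor H i - z • (1 : Matrix {j // j ≠ i} {j // j ≠ i} ℂ)) c b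
      = if a = b then 1 else 0 := fun a b => by
    rw [← Matrix.mul_apply, hG', green_mul (minor_isHermitian hH i) hz, Matrix.one_apply]
  have hoff : ∀ j : {j // j ≠ i}, (H - z • (1 : Matrix n n ℂ)) j i = H j i := fun j => by
    simp [j.2]
  have hoff' : ∀ j : {j // j ≠ i}, (H - z • (1 : Matrix n n ℂ)) i j = H i j := fun j => by
    simp [Ne.symm j.2]
  have hcol : ∀ j : {j // j ≠ i}, G j i = -(∑ k, G' j k * H k i) * G i i := by
    intro j
    have h3 : ∀ k : {j // j ≠ i}, ∑ l : {j // j ≠ i},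
        (minor H i - z • (1 : Matrix {j // j ≠ i} {j // j ≠ i} ℂ)) k l * G l i = -(H k i * G i i) := fun k => by
      have h4 := h1 k i
      rw [Fintype.sum_eq_add_sum_subtype_ne _ i, if_neg k.2, hoff] at h4
      simp_rw [sub_smul_one_minor]
      linear_combination h4
    calc G j i = ∑ l, (∑ k, G' j k * (minor H i - z • (1 : Matrix {j // j ≠ i} {j // j ≠ i} ℂ)) k l) * G l i := by
          simp_rw [h2]; simp
      _ = ∑ k, G' j k * ∑ l, (minor H i - z • (1 : Matrix {j // j ≠ i} {j // j ≠ i} ℂ)) k l * G l i := by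
          simp_rw [Finset.sum_mul, Finset.mul_sum]
          rw [Finset.sum_comm]
          simp_rw [mul_assoc]
      _ = _ := by
          simp_rw [h3]
          rw [← Finset.sum_neg_distrib, Finset.sum_mul]
          exact Finset.sum_congr rfl fun k _ => by ring
  have h5 := h1 i i
  rw [Fintype.sum_eq_add_sum_subtype_ne _ i, if_pos rfl] at h5
  simp_rw [hoff', hcol] at h5
  have h6 : (H - z • (1 : Matrix n n ℂ)) i i = H i i - z := by simp
  rw [h6] at h5
  rw [← h5, mul_comm (G i i), sub_mul, sub_eq_add_neg]
  congr 1
  rw [Finset.sum_mul, ← Finset.sum_neg_distrib]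
  refine Finset.sum_congr rfl fun j _ => ?_
  rw [Finset.sum_mul, ← Finset.sum_neg_distrib, ← Finset.sum_neg_distrib, Finset.sum_mul,
    Finset.mul_sum]
  exact Finset.sum_congr rfl fun k _ => by ring

theorem green_minor_apply {H : Matrix n n ℂ} (hH : H.IsHermitian) {z : ℂ} (hz : 0 < z.im)
    (i : n) (j k : {j // j ≠ i}) :
    green (minor H i) z j k = green H z j k - green H z j i * green H z i k / green H z i i := by
  have hne : green H z i i ≠ 0 := left_ne_zero_of_mul_eq_one (green_diag_mul_schur hH hz i)
  set G := green H z with hG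
  have h1 : ∀ a b, ∑ c, (H - z • (1 : Matrix n n ℂ)) a c * G c b
      = if a = b then 1 else 0 := fun a b => by
    rw [← Matrix.mul_apply, hG, mul_green hH hz, Matrix.one_apply]
  set R : Matrix {j // j ≠ i} {j // j ≠ i} ℂ :=
    Matrix.of fun j k => G j k - G j i * G i k / G i i with hR
  have hinv : (minor H i - z • (1 : Matrix {j // j ≠ i} {j // j ≠ i} ℂ)) * R = 1 := by
    ext a b
    rw [Matrix.mul_apply]
    have ea := h1 a b
    have eb := h1 a i
    rw [Fintype.sum_eq_add_sum_subtype_ne _ i] at ea eb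
    rw [if_neg a.2] at eb
    have hs : ∀ c : {j // j ≠ i}, (minor H i - z • (1 : Matrix {j // j ≠ i} {j // j ≠ i} ℂ)) a c * R c b
        = (H - z • (1 : Matrix n n ℂ)) a c * G c b
          - (H - z • (1 : Matrix n n ℂ)) a c * G c i * (G i b / G i i) := fun c => by
      rw [sub_smul_one_minor, hR, Matrix.of_apply]; ring
    simp_rw [hs]
    rw [Finset.sum_sub_distrib, ← Finset.sum_mul, Matrix.one_apply]
    have hab : (if a = b then (1 : ℂ) else 0) = if (a : n) = b then 1 else 0 := by
      simp [Subtype.ext_iff]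
    rw [hab, ← ea, ← sub_eq_zero]
    have : ∑ c : {j // j ≠ i}, (H - z • (1 : Matrix n n ℂ)) a c * G c i
        = -((H - z • (1 : Matrix n n ℂ)) a i * G i i) := by linear_combination eb
    rw [this]
    field_simp
    ring
  have : green (minor H i) z = R := Matrix.inv_eq_right_inv hinv
  rw [this, hR, Matrix.of_apply]

/-- Deleting a row and a column changes the trace of the resolvent by at most `1 / η`. -/
theorem norm_trace_green_sub_minor_le {H : Matrix n n ℂ} (hH : H.IsHermitian) {z : ℂ}
    (hz : 0 < z.im) (i : n) :
    ‖(green H z).trace - (green (minor H i) z).trace‖ ≤ 1 / z.im := by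
  have hne : green H z i i ≠ 0 := left_ne_zero_of_mul_eq_one (green_diag_mul_schur hH hz i)
  have hw := sum_norm_sq_green hH hz i
  have hm := green_minor_apply hH hz i
  set G := green H z with hG
  have h1 : G.trace - (green (minor H i) z).trace = (∑ j, G j i * G i j) / G i i := by
    simp only [Matrix.trace, Matrix.diag_apply, hm]
    rw [Fintype.sum_eq_add_sum_subtype_ne _ i, Fintype.sum_eq_add_sum_subtype_ne (fun j =>
      G j i * G i j) i, Finset.sum_sub_distrib, ← Finset.sum_div]
    field_simp
    ring
  rw [h1, norm_div]
  have hpos : 0 < ‖G i i‖ := norm_pos_iff.mpr hne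
  rw [div_le_iff₀ hpos]
  calc ‖∑ j, G j i * G i j‖ ≤ ∑ j, ‖G j i‖ * ‖G i j‖ := by
        refine (norm_sum_le _ _).trans (le_of_eq ?_)
        simp_rw [norm_mul]
    _ ≤ ∑ j, (‖G j i‖ ^ 2 + ‖G i j‖ ^ 2) / 2 :=
        Finset.sum_le_sum fun j _ => by nlinarith [sq_nonneg (‖G j i‖ - ‖G i j‖)]
    _ = (G i i).im / z.im := by
        rw [← Finset.sum_div, Finset.sum_add_distrib, hw.1, hw.2]; ring
    _ ≤ 1 / z.im * ‖G i i‖ := by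
        rw [div_mul_eq_mul_div, one_mul]
        gcongr
        exact Complex.im_le_norm _

theorem sum_sum_norm_sq_green {H : Matrix n n ℂ} (hH : H.IsHermitian) {z : ℂ} (hz : 0 < z.im) :
    ∑ i, ∑ j, ‖green H z i j‖ ^ 2 = (green H z).trace.im / z.im := by
  simp_rw [(sum_norm_sq_green hH hz _).1]
  rw [← Finset.sum_div, Matrix.trace, Complex.im_sum]
  rfl

end Resolvent

/-! ### The empirical Stieltjes transform -/

section Stieltjes

variable {N : ℕ} {H : Matrix (Fin N) (Fin N) ℂ}

theorem stieltjes_eq_green (H : Matrix (Fin N) (Fin N) ℂ) (z : ℂ) :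
    stieltjes H z = (N : ℂ)⁻¹ * (green H z).trace := rfl

theorem stieltjes_eq_sum (hH : H.IsHermitian) {z : ℂ} (hz : 0 < z.im) :
    stieltjes H z = (N : ℂ)⁻¹ * ∑ α, ((hH.eigenvalues α : ℂ) - z)⁻¹ := by
  rw [stieltjes_eq_green, trace_green hH hz]

theorem im_inv_ofReal_sub (μ : ℝ) (z : ℂ) :
    (((μ : ℂ) - z)⁻¹).im = z.im / ((μ - z.re) ^ 2 + z.im ^ 2) := by
  rw [Complex.inv_im, Complex.normSq_apply]
  simp
  ring_nf

theorem im_stieltjes (hH : H.IsHermitian) {z : ℂ} (hz : 0 < z.im) :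
    (stieltjes H z).im = (N : ℝ)⁻¹ * ∑ α, z.im / ((hH.eigenvalues α - z.re) ^ 2 + z.im ^ 2) := by
  rw [stieltjes_eq_sum hH hz, ← Complex.ofReal_natCast, ← Complex.ofReal_inv, Complex.im_ofReal_mul,
    Complex.im_sum]
  simp_rw [im_inv_ofReal_sub]

theorem im_stieltjes_nonneg (hH : H.IsHermitian) {z : ℂ} (hz : 0 < z.im) :
    0 ≤ (stieltjes H z).im := by
  rw [im_stieltjes hH hz]
  exact mul_nonneg (by positivity) (Finset.sum_nonneg fun α _ => by positivity)

theorem norm_inv_ofReal_sub_le (μ : ℝ) {z : ℂ} (hz : 0 < z.im) : ‖((μ : ℂ) - z)⁻¹‖ ≤ 1 / z.im := by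
  rw [norm_inv, ← one_div]
  refine one_div_le_one_div_of_le hz ?_
  have := Complex.abs_im_le_norm ((μ : ℂ) - z)
  simp [abs_of_pos hz] at this
  exact this

theorem norm_inv_ofReal_sub_sub_le (μ : ℝ) {z w : ℂ} (hz : 0 < z.im) (hw : 0 < w.im) :
    ‖((μ : ℂ) - z)⁻¹ - ((μ : ℂ) - w)⁻¹‖ ≤ ‖z - w‖ / (z.im * w.im) := by
  have h : ∀ v : ℂ, 0 < v.im → (μ : ℂ) - v ≠ 0 := fun v hv h => by
    have := congrArg Complex.im h
    simp at this
    exact hv.ne' this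
  have e : ((μ : ℂ) - z)⁻¹ - ((μ : ℂ) - w)⁻¹ = (z - w) * (((μ : ℂ) - z)⁻¹ * ((μ : ℂ) - w)⁻¹) := by
    have := h z hz
    have := h w hw
    field_simp
    ring
  rw [e, norm_mul, norm_mul, div_eq_mul_one_div, ← one_div_mul_one_div]
  gcongr <;> exact norm_inv_ofReal_sub_le μ ‹_›

theorem norm_stieltjes_sub_le (hH : H.IsHermitian) {z w : ℂ} (hz : 0 < z.im) (hw : 0 < w.im) :
    ‖stieltjes H z - stieltjes H w‖ ≤ ‖z - w‖ / (z.im * w.im) := by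
  rcases Nat.eq_zero_or_pos N with rfl | hN
  · simp [stieltjes]; positivity
  rw [stieltjes_eq_sum hH hz, stieltjes_eq_sum hH hw, ← mul_sub, ← Finset.sum_sub_distrib, norm_mul,
    norm_inv, Complex.norm_natCast, inv_mul_le_iff₀ (by positivity)]
  refine (norm_sum_le _ _).trans ((Finset.sum_le_sum fun α _ =>
    norm_inv_ofReal_sub_sub_le (hH.eigenvalues α) hz hw).trans ?_)
  simp

end Stieltjes

/-! ### The Stieltjes transform of the semicircle law -/

/-- The Joukowski parametrization `z = -(w + w⁻¹)` of the upper half plane. -/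
theorem exists_joukowski {z : ℂ} (hz : 0 < z.im) :
    ∃ w : ℂ, w ≠ 0 ∧ ‖w‖ < 1 ∧ 0 < w.im ∧ z = -(w + w⁻¹) := by
  obtain ⟨s, hs⟩ := IsAlgClosed.exists_pow_nat_eq (z ^ 2 - 4) (n := 2) (by norm_num)
  have himpos : ∀ w : ℂ, w ≠ 0 → z = -(w + w⁻¹) → z.im * Complex.normSq w
      = w.im * (1 - Complex.normSq w) := by
    intro w hw h
    have h1 := congrArg Complex.im h
    have : Complex.normSq w ≠ 0 := by simpa using hw
    simp only [Complex.neg_im, Complex.add_im, Complex.inv_im] at h1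
    rw [h1]; field_simp; ring
  have key : ∀ w : ℂ, w ≠ 0 → ‖w‖ < 1 → z = -(w + w⁻¹) →
      ∃ w : ℂ, w ≠ 0 ∧ ‖w‖ < 1 ∧ 0 < w.im ∧ z = -(w + w⁻¹) := by
    intro w hw h1 h2
    refine ⟨w, hw, h1, ?_, h2⟩
    have h3 := himpos w hw h2
    have h4 : 0 < Complex.normSq w := Complex.normSq_pos.mpr hw
    have h5 : Complex.normSq w < 1 := by
      rw [Complex.normSq_eq_norm_sq]; exact pow_lt_one₀ (norm_nonneg _) h1 two_ne_zero
    have h6 : 0 < w.im * (1 - Complex.normSq w) := h3 ▸ mul_pos hz h4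
    exact (pos_iff_pos_of_mul_pos h6).mpr (by linarith)
  set w := (-z + s) / 2 with hw
  have hmul : w * (-(z + w)) = 1 := by rw [hw]; linear_combination -hs / 4
  have hw0 : w ≠ 0 := left_ne_zero_of_mul_eq_one hmul
  have hinv : w⁻¹ = -(z + w) := inv_eq_of_mul_eq_one_right hmul
  have hzw : z = -(w + w⁻¹) := by rw [hinv]; ring
  rcases lt_trichotomy ‖w‖ 1 with h | h | h
  · exact key w hw0 h hzw
  · have h3 := himpos w hw0 hzw
    rw [Complex.normSq_eq_norm_sq, h] at h3
    norm_num at h3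
    exact absurd h3 hz.ne'
  · refine key w⁻¹ (inv_ne_zero hw0) ?_ (by rw [inv_inv, add_comm]; exact hzw)
    rw [norm_inv]; exact inv_lt_one_of_one_lt₀ h

theorem mSC_eq_intervalIntegral {z : ℂ} (hz : 0 < z.im) :
    mSC z = ∫ θ in (0 : ℝ)..Real.pi,
      (2 / Real.pi : ℂ) * ((Real.sin θ : ℂ) ^ 2 / (2 * Real.cos θ - z)) := by
  have hne : ∀ x : ℝ, (x : ℂ) - z ≠ 0 := fun x h => by
    have := congrArg Complex.im h
    simp at this
    exact hz.ne' this
  set g : ℝ → ℂ := fun x => (((2 * Real.pi)⁻¹ * √(4 - x ^ 2) : ℝ) : ℂ) / ((x : ℂ) - z) with hg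
  have hgc : Continuous g := by
    refine Continuous.div (Complex.continuous_ofReal.comp (by fun_prop)) (by fun_prop) hne
  have h1 : mSC z = ∫ x in (-2 : ℝ)..2, g x := by
    rw [intervalIntegral.integral_of_le (by norm_num), ← integral_Icc_eq_integral_Ioc,
      ← integral_indicator measurableSet_Icc, mSC]
    congr 1
    funext x
    by_cases hx : |x| ≤ 2
    · rw [Set.indicator_of_mem (s := Set.Icc (-2) 2) (abs_le.mp hx), hg, rhoSC, if_pos hx]
    · rw [Set.indicator_of_notMem (s := Set.Icc (-2) 2) (fun h => hx (abs_le.mpr h)), rhoSC, if_neg hx]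
      simp
  have h2 := intervalIntegral.integral_deriv_smul_comp (a := Real.pi) (b := 0)
    (f := fun θ => 2 * Real.cos θ) (f' := fun θ => 2 * -Real.sin θ) (g := g)
    (fun θ _ => (Real.hasDerivAt_cos θ).const_mul 2) (by fun_prop) hgc
  simp only [Real.cos_pi, Real.cos_zero, mul_neg, mul_one] at h2
  rw [h1, ← h2, intervalIntegral.integral_symm, ← intervalIntegral.integral_neg]
  refine intervalIntegral.integral_congr fun θ hθ => ?_
  rw [Set.uIcc_of_le Real.pi_pos.le] at hθ
  have hs : 0 ≤ Real.sin θ := Real.sin_nonneg_of_mem_Icc hθ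
  have h3 : √(4 - (2 * Real.cos θ) ^ 2) = 2 * Real.sin θ := by
    rw [show 4 - (2 * Real.cos θ) ^ 2 = (2 * Real.sin θ) ^ 2 by
      nlinarith [Real.sin_sq_add_cos_sq θ], Real.sqrt_sq (by positivity)]
  have hpi : (Real.pi : ℂ) ≠ 0 := by exact_mod_cast Real.pi_ne_zero
  have hden := hne (2 * Real.cos θ)
  push_cast at hden
  simp only [hg, Function.comp, h3, Complex.real_smul]
  push_cast
  field_simp

/-- The semicircle transform in Joukowski coordinates. -/
theorem mSC_joukowski {z w : ℂ} (hz : 0 < z.im) (hw0 : w ≠ 0) (hw : ‖w‖ < 1)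
    (hzw : z = -(w + w⁻¹)) : mSC z = w := by
  set g : ℂ → ℂ := fun ζ => 1 / 2 * (-ζ + (w - w⁻¹) / (1 + w * ζ)) with hg
  have hne : ∀ ζ : ℂ, ‖ζ‖ ≤ 1 → 1 + w * ζ ≠ 0 := fun ζ hζ h => by
    have h1 : ‖w * ζ‖ = 1 := by
      rw [show w * ζ = -1 by linear_combination h]; simp
    rw [norm_mul] at h1
    nlinarith [norm_nonneg w, norm_nonneg ζ]
  have hdiff : ∀ ζ : ℂ, ‖ζ‖ ≤ 1 → DifferentiableAt ℂ g ζ := fun ζ hζ => by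
    have := hne ζ hζ
    simp only [hg]
    fun_prop (disch := assumption)
  have havg : Real.circleAverage g 0 1 = g 0 := by
    refine circleAverage_of_differentiable_on_off_countable Set.countable_empty ?_ ?_
    · intro ζ hζ
      exact (hdiff ζ (by simpa using hζ)).continuousAt.continuousWithinAt
    · intro ζ hζ
      exact hdiff ζ (by simpa using (Metric.mem_ball.mp hζ.1).le)
  have hcirc : ∀ θ : ℝ, circleMap 0 1 θ = Complex.exp (θ * Complex.I) := fun θ => by
    simp [circleMap]
  have hnorm : ∀ θ : ℝ, ‖Complex.exp (θ * Complex.I)‖ = 1 := Complex.norm_exp_ofReal_mul_I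
  have hcont : Continuous fun θ : ℝ => g (Complex.exp (θ * Complex.I)) := by
    refine continuous_iff_continuousAt.mpr fun θ => ?_
    exact ContinuousAt.comp (f := fun θ : ℝ => Complex.exp (θ * Complex.I))
      (hdiff _ (hnorm θ).le).continuousAt (by fun_prop)
  have hcont' : Continuous fun θ : ℝ => g (Complex.exp (-θ * Complex.I)) := by
    have := hcont.comp continuous_neg
    simpa [Function.comp_def] using this
  have hint : ∫ θ in (0 : ℝ)..(2 * Real.pi), g (Complex.exp (θ * Complex.I))
      = 2 * Real.pi * g 0 := by
    rw [Real.circleAverage_def] at havg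
    simp_rw [hcirc] at havg
    rw [← havg, Complex.real_smul]
    have : (Real.pi : ℂ) ≠ 0 := by exact_mod_cast Real.pi_ne_zero
    push_cast
    rw [← mul_assoc, mul_inv_cancel₀ (by simp), one_mul]
  have hrefl : ∫ θ in (0 : ℝ)..Real.pi, g (Complex.exp (-θ * Complex.I))
      = ∫ θ in Real.pi..(2 * Real.pi), g (Complex.exp (θ * Complex.I)) := by
    have h := intervalIntegral.integral_comp_sub_left (a := 0) (b := Real.pi)
      (fun θ : ℝ => g (Complex.exp (θ * Complex.I))) (2 * Real.pi)
    rw [show 2 * Real.pi - Real.pi = Real.pi by ring, sub_zero] at h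
    rw [← h]
    refine intervalIntegral.integral_congr fun θ _ => ?_
    have : (((2 * Real.pi - θ : ℝ) : ℂ) * Complex.I) = -θ * Complex.I + 2 * Real.pi * Complex.I := by
      push_cast; ring
    simp only [this, Complex.exp_periodic _]
  have hpt : ∀ θ : ℝ, (2 / Real.pi : ℂ) * ((Real.sin θ : ℂ) ^ 2 / (2 * Real.cos θ - z))
      = (1 / Real.pi : ℂ) * (g (Complex.exp (θ * Complex.I)) + g (Complex.exp (-θ * Complex.I))
        + w⁻¹) := fun θ => by
    set ζ := Complex.exp (θ * Complex.I) with hζ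
    have hζ' : Complex.exp (-θ * Complex.I) = ζ⁻¹ := by rw [hζ, ← Complex.exp_neg]; congr 1; ring
    have hζ0 : ζ ≠ 0 := Complex.exp_ne_zero _
    have hcos : (2 : ℂ) * Real.cos θ = ζ + ζ⁻¹ := by
      rw [Complex.ofReal_cos, Complex.cos, ← hζ, hζ']; ring
    have hsin : (Real.sin θ : ℂ) ^ 2 = -(ζ - ζ⁻¹) ^ 2 / 4 := by
      rw [Complex.ofReal_sin, Complex.sin, ← hζ, hζ']
      linear_combination (ζ⁻¹ - ζ) ^ 2 / 4 * Complex.I_sq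
    have d1 : 1 + w * ζ ≠ 0 := hne ζ (hnorm θ).le
    have d1' : 1 + ζ * w ≠ 0 := by rwa [mul_comm ζ]
    have d2 : 1 + w * ζ⁻¹ ≠ 0 := hne _ (by rw [norm_inv, hnorm θ, inv_one])
    have d2' : ζ + w ≠ 0 := fun h => d2 (by
      rw [show w = -ζ by linear_combination h]; field_simp; ring)
    have hden : ζ + ζ⁻¹ - z = (ζ + w) * (1 + w * ζ) / (w * ζ) := by
      rw [hzw]; field_simp; ring
    have hpi : (Real.pi : ℂ) ≠ 0 := by exact_mod_cast Real.pi_ne_zero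
    have e2 : (w - w⁻¹) / (1 + w * ζ⁻¹) = (w - w⁻¹) * ζ / (ζ + w) := by
      rw [div_eq_div_iff d2 d2']; field_simp
    simp only [hg, hζ']
    rw [hcos, hsin, hden, e2]
    field_simp
    ring
  rw [mSC_eq_intervalIntegral hz, intervalIntegral.integral_congr fun θ _ => hpt θ,
    intervalIntegral.integral_const_mul,
    intervalIntegral.integral_add ((hcont.intervalIntegrable _ _).add
      (hcont'.intervalIntegrable _ _)) (intervalIntegrable_const),
    intervalIntegral.integral_add (hcont.intervalIntegrable _ _) (hcont'.intervalIntegrable _ _),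
    hrefl, intervalIntegral.integral_add_adjacent_intervals (hcont.intervalIntegrable _ _)
      (hcont.intervalIntegrable _ _), hint]
  have hpi : (Real.pi : ℂ) ≠ 0 := by exact_mod_cast Real.pi_ne_zero
  simp only [hg, intervalIntegral.integral_const, sub_zero, Complex.real_smul]
  field_simp
  ring

theorem mSC_spec {z : ℂ} (hz : 0 < z.im) :
    mSC z ≠ 0 ∧ ‖mSC z‖ < 1 ∧ 0 < (mSC z).im ∧ z = -(mSC z + (mSC z)⁻¹) := by
  obtain ⟨w, h0, h1, h2, h3⟩ := exists_joukowski hz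
  rw [mSC_joukowski hz h0 h1 h3]
  exact ⟨h0, h1, h2, h3⟩

theorem mSC_mul_add {z : ℂ} (hz : 0 < z.im) : mSC z * (z + mSC z) = -1 := by
  obtain ⟨h0, -, -, h3⟩ := mSC_spec hz
  nth_rewrite 2 [h3]
  field_simp
  ring

/-- The lower bound on the imaginary part of the semicircle transform in the bulk. -/
noncomputable def bulkConst (κ : ℝ) : ℝ := √(1 - (1 - κ / 2) ^ 2) / 4

theorem bulkConst_pos {κ : ℝ} (hκ : 0 < κ) (hκ2 : κ ≤ 2) : 0 < bulkConst κ := by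
  unfold bulkConst
  have : 0 < 1 - (1 - κ / 2) ^ 2 := by nlinarith
  positivity

theorem bulkConst_le_im_mSC {κ : ℝ} {z : ℂ} (hz : 0 < z.im) (hz1 : z.im ≤ 1)
    (hre : |z.re| ≤ 2 - κ) (hκ : 0 < κ) : bulkConst κ ≤ (mSC z).im := by
  obtain ⟨h0, h1, h2, h3⟩ := mSC_spec hz
  set w := mSC z with hw
  have hn : 0 < ‖w‖ := norm_pos_iff.mpr h0
  have hsq : ‖w‖ ^ 2 = w.re ^ 2 + w.im ^ 2 := by
    rw [← Complex.normSq_eq_norm_sq, Complex.normSq_apply]; ring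
  -- the real part of `z = -(w + w⁻¹)`
  have hre' : z.re * ‖w‖ ^ 2 = -(w.re * (1 + ‖w‖ ^ 2)) := by
    have h4 := congrArg Complex.re h3
    simp only [Complex.neg_re, Complex.add_re, Complex.inv_re, Complex.normSq_eq_norm_sq] at h4
    rw [h4]; field_simp; ring
  have hwre : |w.re| ≤ (1 - κ / 2) * ‖w‖ := by
    have h5 : |w.re| * (1 + ‖w‖ ^ 2) = |z.re| * ‖w‖ ^ 2 := by
      have := congrArg abs hre'
      rw [abs_mul, abs_neg, abs_mul, abs_of_nonneg (sq_nonneg ‖w‖),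
        abs_of_pos (by positivity : 0 < 1 + ‖w‖ ^ 2)] at this
      exact this.symm
    have h6 : |w.re| * (2 * ‖w‖) ≤ (2 - κ) * ‖w‖ ^ 2 := by
      calc |w.re| * (2 * ‖w‖) ≤ |w.re| * (1 + ‖w‖ ^ 2) := by
            gcongr; nlinarith [sq_nonneg (1 - ‖w‖)]
        _ ≤ _ := by rw [h5]; gcongr
    have : |w.re| * (2 * ‖w‖) ≤ ((1 - κ / 2) * ‖w‖) * (2 * ‖w‖) := by nlinarith
    exact le_of_mul_le_mul_right this (by positivity)
  have hwn : 1 / 4 ≤ ‖w‖ := by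
    have h7 : ‖z‖ ≤ 3 := (Complex.norm_le_abs_re_add_abs_im z).trans (by
      rw [abs_of_pos hz]; linarith)
    have h8 : w * (z + w) = -1 := mSC_mul_add hz
    have h9 : ‖w‖ * ‖z + w‖ = 1 := by rw [← norm_mul, h8]; simp
    have h10 : ‖z + w‖ ≤ 4 := (norm_add_le _ _).trans (by linarith)
    nlinarith
  have hκ1 : 0 ≤ (1 - κ / 2) := by
    have := (abs_nonneg _).trans hre; linarith
  have him : (1 - (1 - κ / 2) ^ 2) * ‖w‖ ^ 2 ≤ w.im ^ 2 := by
    have : w.re ^ 2 ≤ ((1 - κ / 2) * ‖w‖) ^ 2 := by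
      rw [← sq_abs]; exact pow_le_pow_left₀ (abs_nonneg _) hwre 2
    nlinarith
  have h11 : 0 ≤ 1 - (1 - κ / 2) ^ 2 := by
    have := (abs_nonneg _).trans hre; nlinarith
  rw [bulkConst]
  have h12 : √(1 - (1 - κ / 2) ^ 2) * ‖w‖ ≤ w.im := by
    rw [← pow_le_pow_iff_left₀ (by positivity) h2.le two_ne_zero, mul_pow, Real.sq_sqrt h11]
    exact him
  have := mul_le_mul_of_nonneg_left hwn (Real.sqrt_nonneg (1 - (1 - κ / 2) ^ 2))
  linarith

/-- Stability of the self-consistent equation `m (z + m) = -1` in the upper half plane. The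
second root of the equation has negative imaginary part, hence stays away from `m'`. -/
theorem norm_sub_mSC_le {z m' : ℂ} (hz : 0 < z.im) (hm : 0 ≤ m'.im) {r : ℝ}
    (hr : ‖m' * (z + m') + 1‖ ≤ r) : ‖m' - mSC z‖ * (mSC z).im ≤ r := by
  obtain ⟨h0, h1, h2, h3⟩ := mSC_spec hz
  set w := mSC z with hw
  have e : m' * (z + m') + 1 = (m' - w) * (m' - w⁻¹) := by
    rw [h3]; field_simp; ring
  have h4 : w.im ≤ ‖m' - w⁻¹‖ := by
    have h5 := Complex.abs_im_le_norm (m' - w⁻¹)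
    have h6 : (w⁻¹).im = -(w.im / Complex.normSq w) := by rw [Complex.inv_im]; ring
    have h7 : w.im ≤ w.im / Complex.normSq w := by
      rw [le_div_iff₀ (Complex.normSq_pos.mpr h0)]
      have : Complex.normSq w ≤ 1 := by
        rw [Complex.normSq_eq_norm_sq]; exact pow_le_one₀ (norm_nonneg _) h1.le
      nlinarith
    rw [Complex.sub_im, h6] at h5
    have := le_abs_self (m'.im - -(w.im / Complex.normSq w))
    linarith
  rw [e, norm_mul] at hr
  exact (mul_le_mul_of_nonneg_left h4 (norm_nonneg _)).trans hr

/-- Lipschitz continuity of the semicircle transform, in the form needed in the bulk. -/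
theorem norm_mSC_sub_le {z z' : ℂ} (hz : 0 < z.im) (hz' : 0 < z'.im) :
    ‖mSC z' - mSC z‖ * (mSC z).im ≤ ‖z - z'‖ := by
  obtain ⟨-, h1, h2, -⟩ := mSC_spec hz'
  refine norm_sub_mSC_le hz h2.le ?_
  have e : mSC z' * (z + mSC z') + 1 = mSC z' * (z - z') := by
    linear_combination mSC_mul_add hz'
  rw [e, norm_mul]
  exact mul_le_of_le_one_left (norm_nonneg _) h1.le

/-- Convergence of the smoothed semicircle density to the density, with rate. -/
theorem abs_im_mSC_sub_rhoSC_le {z : ℂ} (hz : 0 < z.im) (hre : |z.re| ≤ 2) :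
    |(mSC z).im / Real.pi - rhoSC z.re| * √(4 - z.re ^ 2) ≤ z.im := by
  obtain ⟨h0, h1, h2, h3⟩ := mSC_spec hz
  set w := mSC z with hw
  set s := √(4 - z.re ^ 2) with hs
  have hs2 : s ^ 2 = 4 - z.re ^ 2 := Real.sq_sqrt (by
    have := abs_le.mp hre; nlinarith)
  have hs0 : 0 ≤ s := Real.sqrt_nonneg _
  set m₀ : ℂ := ⟨-z.re / 2, s / 2⟩ with hm₀
  set m₁ : ℂ := ⟨-z.re / 2, -s / 2⟩ with hm₁
  have e : (w - m₀) * (w - m₁) = -(z.im * Complex.I) * w := by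
    have e0 : w * (z + w) = -1 := mSC_mul_add hz
    have e1 : m₀ + m₁ = -(z.re : ℂ) := by
      apply Complex.ext <;> simp [hm₀, hm₁]
      ring
    have e2 : m₀ * m₁ = 1 := by
      apply Complex.ext
      · simp [hm₀, hm₁]; nlinarith
      · simp [hm₀, hm₁]; ring
    have e3 : z = z.re + z.im * Complex.I := (Complex.re_add_im z).symm
    have e4 : (z : ℂ) - z.re = z.im * Complex.I := by linear_combination e3
    rw [← e4]
    linear_combination e0 - w * e1 + e2
  have h4 : ‖w - m₀‖ * ‖w - m₁‖ ≤ z.im := by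
    rw [← norm_mul, e, norm_mul]
    simp only [norm_neg, norm_mul, Complex.norm_I, mul_one, Complex.norm_real, Real.norm_eq_abs,
      abs_of_pos hz]
    exact mul_le_of_le_one_right hz.le h1.le
  have h5 : s / 2 ≤ ‖w - m₁‖ := by
    have := (le_abs_self _).trans (Complex.abs_im_le_norm (w - m₁))
    simp only [Complex.sub_im, hm₁] at this
    linarith
  have h6 : |w.im - s / 2| ≤ ‖w - m₀‖ := by
    simpa [hm₀] using Complex.abs_im_le_norm (w - m₀)
  have h7 : |w.im - s / 2| * (s / 2) ≤ z.im :=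
    (mul_le_mul h6 h5 (by positivity) (norm_nonneg _)).trans h4
  have h8 : w.im / Real.pi - rhoSC z.re = (w.im - s / 2) / Real.pi := by
    rw [rhoSC, if_pos hre, ← hs]; field_simp
  rw [h8, abs_div, abs_of_pos Real.pi_pos, div_mul_eq_mul_div, div_le_iff₀ Real.pi_pos]
  nlinarith [Real.pi_gt_three]

/-! ### The self-consistent equation -/

/-- The averaged resolvent equation. An error proportional to `√(Im m)` is harmless even without
an upper bound on `Im m`: if `Im m` were large then `|z + m| ≥ Im m` would force all the `G i`,
hence their average `m`, to be small. -/
theorem norm_selfConsistent_le {N : ℕ} (hN : 0 < N) {G δ : Fin N → ℂ} {z m : ℂ} {d : ℝ}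
    (hz : 0 < z.im) (hm : 0 ≤ m.im) (hmG : m = (N : ℂ)⁻¹ * ∑ i, G i)
    (hG : ∀ i, G i * (δ i - (z + m)) = 1) (hδ : ∀ i, ‖δ i‖ ≤ d * (1 + √m.im)) (hd0 : 0 ≤ d)
    (hd : d ≤ 1 / 12) (hlow : 1 / 2 ≤ ‖z + m‖) : ‖m * (z + m) + 1‖ ≤ 12 * d := by
  set y := m.im with hy
  have hsq : √y ^ 2 = y := Real.sq_sqrt hm
  have hs0 : 0 ≤ √y := Real.sqrt_nonneg _
  have hwy : y ≤ ‖z + m‖ := by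
    have := (le_abs_self _).trans (Complex.abs_im_le_norm (z + m))
    rw [Complex.add_im] at this
    linarith
  have hNr : (0 : ℝ) < N := by exact_mod_cast hN
  have hGle : ∀ B : ℝ, (∀ i, ‖G i‖ ≤ B) → ‖m‖ ≤ B := fun B hB => by
    rw [hmG, norm_mul, norm_inv, Complex.norm_natCast, inv_mul_le_iff₀ hNr]
    refine (norm_sum_le _ _).trans ((Finset.sum_le_sum fun i _ => hB i).trans ?_)
    simp
  have hinv : ∀ i, ‖δ i‖ ≤ ‖z + m‖ / 2 → ‖G i‖ * ‖z + m‖ ≤ 2 := fun i hi => by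
    have h1 : ‖G i‖ * ‖δ i - (z + m)‖ = 1 := by rw [← norm_mul, hG]; simp
    have h2 : ‖z + m‖ / 2 ≤ ‖δ i - (z + m)‖ := by
      have := norm_sub_norm_le (z + m) (δ i)
      rw [norm_sub_rev] at this
      linarith
    nlinarith [norm_nonneg (G i)]
  have hy2 : y ≤ 2 := by
    by_contra! h
    have h1 : ∀ i, ‖G i‖ ≤ 1 := fun i => by
      have h2 : ‖δ i‖ ≤ ‖z + m‖ / 2 := by
        refine (hδ i).trans ?_
        have : √y ≤ y := by nlinarith
        nlinarith
      have := hinv i h2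
      nlinarith [norm_nonneg (G i)]
    have := (le_abs_self _).trans ((Complex.abs_im_le_norm m).trans (hGle 1 h1))
    linarith
  have hδ3 : ∀ i, ‖δ i‖ ≤ 3 * d := fun i => by
    refine (hδ i).trans ?_
    have : √y ≤ 2 := by nlinarith
    nlinarith
  have hterm : ∀ i, ‖G i * (z + m) + 1‖ ≤ 12 * d := fun i => by
    have h1 : G i * (z + m) + 1 = δ i * G i := by linear_combination -(hG i)
    have h2 := hinv i (by linarith [hδ3 i])
    have h3 : ‖G i‖ ≤ 4 := by nlinarith [norm_nonneg (G i)]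
    rw [h1, norm_mul]
    nlinarith [hδ3 i, norm_nonneg (G i), norm_nonneg (δ i)]
  have hsum : m * (z + m) + 1 = (N : ℂ)⁻¹ * ∑ i, (G i * (z + m) + 1) := by
    have : (N : ℂ) ≠ 0 := by exact_mod_cast hN.ne'
    rw [Finset.sum_add_distrib, ← Finset.sum_mul, mul_add (N : ℂ)⁻¹, ← mul_assoc, ← hmG]
    simp [this]
  rw [hsum, norm_mul, norm_inv, Complex.norm_natCast, inv_mul_le_iff₀ hNr]
  refine (norm_sum_le _ _).trans ((Finset.sum_le_sum fun i _ => hterm i).trans ?_)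
  simp

/-- The quadratic form in the `i`-th column of the matrix and the resolvent of the `i`-th minor
that occurs in Schur's complement formula. -/
noncomputable def schurForm {N : ℕ} (H : Matrix (Fin N) (Fin N) ℂ) (z : ℂ) (i : Fin N) : ℂ :=
  ∑ j : {j // j ≠ i}, ∑ k : {j // j ≠ i}, H i j * green (minor H i) z j k * H k i

/-- The Hilbert–Schmidt norm of the resolvent of the `i`-th minor. -/
noncomputable def minorHS {N : ℕ} (H : Matrix (Fin N) (Fin N) ℂ) (z : ℂ) (i : Fin N) : ℝ :=
  √(∑ j, ∑ k, ‖green (minor H i) z j k‖ ^ 2)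

/-- The matrix is regular at the spectral parameter `z`: its diagonal entries are at most `τ`, and
the quadratic forms in Schur's formula deviate from their expectations by at most `t` units of the
Hilbert–Schmidt norm. -/
def RegularAt {N : ℕ} (H : Matrix (Fin N) (Fin N) ℂ) (t τ : ℝ) (z : ℂ) : Prop :=
  ∀ i, ‖H i i‖ ≤ τ ∧ ‖schurForm H z i - (N : ℂ)⁻¹ * (green (minor H i) z).trace‖
    ≤ t * (N : ℝ)⁻¹ * minorHS H z i

theorem RegularAt.norm_selfConsistent_le {N : ℕ} (hN : 0 < N) {H : Matrix (Fin N) (Fin N) ℂ}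
    (hH : H.IsHermitian) {t τ : ℝ} {z : ℂ} (hz : 0 < z.im) (h : RegularAt H t τ z) (ht : 1 ≤ t)
    (hτ : 0 ≤ τ) (hsmall : τ + 3 * (t / √(N * z.im)) ≤ 1 / 12)
    (hlow : 1 / 2 ≤ ‖z + stieltjes H z‖) :
    ‖stieltjes H z * (z + stieltjes H z) + 1‖ ≤ 12 * (τ + 3 * (t / √(N * z.im))) := by
  set m := stieltjes H z with hm
  set η := z.im with hη
  set s := t / √(N * η) with hs
  have hNr : (0 : ℝ) < N := by exact_mod_cast hN
  have hNη : 0 < N * η := by positivity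
  have hsq0 : 0 < √(N * η) := Real.sqrt_pos.mpr hNη
  have hs0 : 0 < s := by positivity
  have hm0 : 0 ≤ m.im := im_stieltjes_nonneg hH hz
  have hinvs : 1 / √(N * η) ≤ s := by rw [hs]; gcongr
  have hinvs2 : 1 / (N * η) ≤ s ^ 2 := by
    have := pow_le_pow_left₀ (by positivity) hinvs 2
    rwa [div_pow, one_pow, Real.sq_sqrt hNη.le] at this
  refine LocalSemicircle.norm_selfConsistent_le hN (G := fun i => green H z i i)
    (δ := fun i => H i i - schurForm H z i + m) hz hm0 (by rw [hm, stieltjes_eq_green]; rfl)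
    (fun i => ?_) (fun i => ?_) (by positivity) hsmall hlow
  · have := green_diag_mul_schur hH hz i
    rw [schurForm]
    rw [← this]; ring
  · obtain ⟨h1, h2⟩ := h i
    set T' := (green (minor H i) z).trace with hT'
    have h3 := norm_trace_green_sub_minor_le hH hz i
    rw [← hT', ← hη] at h3
    have hmT : m - (N : ℂ)⁻¹ * T' = (N : ℂ)⁻¹ * ((green H z).trace - T') := by
      rw [hm, stieltjes_eq_green]; ring
    have h4 : ‖m - (N : ℂ)⁻¹ * T'‖ ≤ s ^ 2 := by
      refine le_trans ?_ hinvs2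
      rw [hmT, norm_mul, norm_inv, Complex.norm_natCast, ← one_div, ← one_div_mul_one_div]
      gcongr
    have h5 : minorHS H z i ≤ N * (1 / √(N * η)) * (√m.im + 1 / √(N * η)) := by
      rw [minorHS, sum_sum_norm_sq_green (minor_isHermitian hH i) hz, ← hT']
      have h6 : T'.im ≤ N * m.im + 1 / η := by
        have e1 : ((green H z).trace).im = N * m.im := by
          rw [hm, stieltjes_eq_green, ← Complex.ofReal_natCast, ← Complex.ofReal_inv,
            Complex.im_ofReal_mul]
          field_simp
        have e2 := (neg_abs_le _).trans' (neg_le_neg ((Complex.abs_im_le_norm _).trans h3))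
        rw [Complex.sub_im, e1] at e2
        linarith
      refine Real.sqrt_le_iff.mpr ⟨by positivity, ?_⟩
      have e3 : (N * (1 / √(N * η)) * (√m.im + 1 / √(N * η))) ^ 2
          = N / η * (√m.im + 1 / √(N * η)) ^ 2 := by
        rw [mul_pow, mul_pow, div_pow, Real.sq_sqrt hNη.le]; field_simp
      have e4 : m.im + 1 / (N * η) ≤ (√m.im + 1 / √(N * η)) ^ 2 := by
        have a1 : √m.im ^ 2 = m.im := Real.sq_sqrt hm0
        have a2 : (1 / √(N * η)) ^ 2 = 1 / (N * η) := by
          rw [div_pow, one_pow, Real.sq_sqrt hNη.le]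
        have a3 : 0 ≤ √m.im * (1 / √(N * η)) := by positivity
        nlinarith
      rw [e3]
      calc T'.im / η ≤ (N * m.im + 1 / η) / η := by gcongr
        _ = N / η * (m.im + 1 / (N * η)) := by field_simp
        _ ≤ _ := by gcongr
    have h7 : t * (N : ℝ)⁻¹ * minorHS H z i ≤ s * (√m.im + s) := by
      calc t * (N : ℝ)⁻¹ * minorHS H z i
          ≤ t * (N : ℝ)⁻¹ * (N * (1 / √(N * η)) * (√m.im + 1 / √(N * η))) := by gcongr
        _ = s * (√m.im + 1 / √(N * η)) := by rw [hs]; field_simp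
        _ ≤ _ := by gcongr
    have h8 : H i i - schurForm H z i + m = H i i - (schurForm H z i - (N : ℂ)⁻¹ * T')
        + (m - (N : ℂ)⁻¹ * T') := by ring
    have hs1 : s ≤ 1 := by linarith
    calc ‖H i i - schurForm H z i + m‖ ≤ τ + s * (√m.im + s) + s ^ 2 := by
          rw [h8]
          refine (norm_add_le _ _).trans (add_le_add ((norm_sub_le _ _).trans
            (add_le_add h1 (h2.trans h7))) h4)
      _ ≤ (τ + 3 * s) * (1 + √m.im) := by
          have := Real.sqrt_nonneg m.im
          nlinarith [mul_nonneg hτ this, mul_nonneg hs0.le this]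

theorem continuousAt_mSC {z : ℂ} (hz : 0 < z.im) : ContinuousAt mSC z := by
  have hpos := (mSC_spec hz).2.2.1
  rw [ContinuousAt, tendsto_iff_norm_sub_tendsto_zero]
  have hlim : Tendsto (fun z' => ‖z - z'‖ / (mSC z).im) (𝓝 z) (𝓝 0) := by
    have : Tendsto (fun z' => ‖z - z'‖ / (mSC z).im) (𝓝 z) (𝓝 (‖z - z‖ / (mSC z).im)) :=
      (by fun_prop : Continuous fun z' => ‖z - z'‖ / (mSC z).im).tendsto z
    simpa using this
  refine squeeze_zero' (Eventually.of_forall fun _ => norm_nonneg _) ?_ hlim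
  filter_upwards [(isOpen_lt continuous_const Complex.continuous_im).mem_nhds hz] with z' hz'
  rw [le_div_iff₀ hpos]
  exact norm_mSC_sub_le hz hz'

theorem continuousAt_stieltjes {N : ℕ} {H : Matrix (Fin N) (Fin N) ℂ} (hH : H.IsHermitian) {z : ℂ}
    (hz : 0 < z.im) : ContinuousAt (stieltjes H) z := by
  rw [ContinuousAt, tendsto_iff_norm_sub_tendsto_zero]
  have hlim : Tendsto (fun z' => ‖z' - z‖ / (z'.im * z.im)) (𝓝 z) (𝓝 0) := by
    have hc : ContinuousAt (fun z' : ℂ => ‖z' - z‖ / (z'.im * z.im)) z := by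
      refine ContinuousAt.div (by fun_prop) (by fun_prop) (by positivity)
    have := hc.tendsto
    simpa using this
  refine squeeze_zero' (Eventually.of_forall fun _ => norm_nonneg _) ?_ hlim
  filter_upwards [(isOpen_lt continuous_const Complex.continuous_im).mem_nhds hz] with z' hz'
  exact norm_stieltjes_sub_le hH hz' hz

/-- Propagation from a net to the whole spectral domain. Near any point where `m` is within `1/5` of
`mSC` the net improves the distance to less than `ε`; since this holds at height one, continuity
along vertical lines carries it down to the smallest scale. -/
theorem norm_stieltjes_sub_mSC_lt_of_net {N : ℕ} {H : Matrix (Fin N) (Fin N) ℂ}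
    (hH : H.IsHermitian) {κ ε ρ : ℝ} (hκ : 0 < κ) (hκ2 : κ ≤ 2) (hε : 0 < ε) (hε1 : ε ≤ 1 / 10)
    (hscale : 0 < minScale N) (hρ : ρ ≤ 1 / 2)
    (hρ1 : ρ / minScale N ^ 2 ≤ ε / 8) (hρ2 : ρ / bulkConst κ ≤ ε / 8)
    (hnet : ∀ z ∈ spectralDomain N κ 1, ∃ z₀ : ℂ, ‖z - z₀‖ ≤ ρ ∧ minScale N ≤ z₀.im ∧
      (1 / 2 ≤ ‖z₀ + stieltjes H z₀‖ → ‖stieltjes H z₀ - mSC z₀‖ ≤ ε / 2)) :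
    ∀ z ∈ spectralDomain N κ 1, ‖stieltjes H z - mSC z‖ < ε := by
  have step : ∀ z ∈ spectralDomain N κ 1, (‖stieltjes H z - mSC z‖ ≤ 1 / 5 ∨ z.im = 1) →
      ‖stieltjes H z - mSC z‖ < ε := by
    intro z hz hor
    obtain ⟨z₀, hd, him₀, himp⟩ := hnet z hz
    obtain ⟨hre, him, him1⟩ := hz
    have hzpos : 0 < z.im := hscale.trans_le him
    have hz₀pos : 0 < z₀.im := hscale.trans_le him₀
    have hb := bulkConst_pos hκ hκ2
    have e1 : ‖stieltjes H z - stieltjes H z₀‖ ≤ ε / 8 := by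
      refine (norm_stieltjes_sub_le hH hzpos hz₀pos).trans (le_trans ?_ hρ1)
      rw [sq]
      gcongr
      exact (norm_nonneg _).trans hd
    have e2 : ‖mSC z₀ - mSC z‖ ≤ ε / 8 := by
      refine le_trans ?_ hρ2
      rw [le_div_iff₀ hb]
      refine le_trans ?_ ((norm_mSC_sub_le hzpos hz₀pos).trans hd)
      gcongr
      exact bulkConst_le_im_mSC hzpos him1 hre hκ
    have tri : ∀ a b c d : ℂ, ‖a - d‖ ≤ ‖a - b‖ + ‖b - c‖ + ‖c - d‖ := fun a b c d => by
      rw [show a - d = (a - b) + (b - c) + (c - d) by ring]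
      exact (norm_add_le _ _).trans (by gcongr; exact norm_add_le _ _)
    have hlow : 1 / 2 ≤ ‖z₀ + stieltjes H z₀‖ := by
      rcases hor with h | h
      · have e3 : ‖stieltjes H z₀ - mSC z₀‖ ≤ 1 / 4 := by
          have := tri (stieltjes H z₀) (stieltjes H z) (mSC z) (mSC z₀)
          rw [norm_sub_rev (stieltjes H z₀) (stieltjes H z), norm_sub_rev (mSC z)] at this
          linarith
        have e4 : 1 ≤ ‖z₀ + mSC z₀‖ := by
          have h1 : ‖mSC z₀‖ * ‖z₀ + mSC z₀‖ = 1 := by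
            rw [← norm_mul, mSC_mul_add hz₀pos]; simp
          have h2 := (mSC_spec hz₀pos).2.1
          nlinarith [norm_nonneg (mSC z₀), norm_nonneg (z₀ + mSC z₀)]
        have e5 : z₀ + mSC z₀ = (z₀ + stieltjes H z₀) - (stieltjes H z₀ - mSC z₀) := by ring
        have := norm_sub_le (z₀ + stieltjes H z₀) (stieltjes H z₀ - mSC z₀)
        rw [← e5] at this
        linarith
      · have h1 := (Complex.abs_im_le_norm (z - z₀)).trans hd
        rw [Complex.sub_im, h] at h1
        have h2 := (le_abs_self _).trans (Complex.abs_im_le_norm (z₀ + stieltjes H z₀))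
        rw [Complex.add_im] at h2
        have h3 := im_stieltjes_nonneg hH hz₀pos
        have := (abs_le.mp h1).2
        linarith
    have := tri (stieltjes H z) (stieltjes H z₀) (mSC z₀) (mSC z)
    have := himp hlow
    linarith
  intro z hz
  have hz' := hz
  obtain ⟨hre, him, him1⟩ := hz'
  have hzpos : 0 < z.im := hscale.trans_le him
  set φ : ℝ → ℝ := fun y => ‖stieltjes H (z.re + y * Complex.I) - mSC (z.re + y * Complex.I)‖
    with hφ
  have him' : ∀ y : ℝ, ((z.re : ℂ) + y * Complex.I).im = y := fun y => by simp
  have hre' : ∀ y : ℝ, ((z.re : ℂ) + y * Complex.I).re = z.re := fun y => by simp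
  have hmem : ∀ y ∈ Set.Icc z.im 1, ((z.re : ℂ) + y * Complex.I) ∈ spectralDomain N κ 1 :=
    fun y hy => ⟨by rw [hre']; exact hre, by rw [him']; exact him.trans hy.1,
      by rw [him']; exact hy.2⟩
  have hcont : ContinuousOn φ (Set.Icc z.im 1) := by
    intro y hy
    have hy0 : 0 < ((z.re : ℂ) + y * Complex.I).im := by rw [him']; exact hzpos.trans_le hy.1
    refine ContinuousAt.continuousWithinAt (ContinuousAt.norm ?_)
    exact (ContinuousAt.comp (f := fun y : ℝ => (z.re : ℂ) + y * Complex.I)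
      (continuousAt_stieltjes hH hy0) (by fun_prop)).sub
      (ContinuousAt.comp (f := fun y : ℝ => (z.re : ℂ) + y * Complex.I)
      (continuousAt_mSC hy0) (by fun_prop))
  have htop : φ 1 < ε := step _ (hmem 1 ⟨him1, le_rfl⟩) (Or.inr (him' 1))
  have hzz : φ z.im = ‖stieltjes H z - mSC z‖ := by simp only [hφ, Complex.re_add_im]
  rw [← hzz]
  by_contra! hbad
  rcases le_or_gt (φ z.im) (1 / 5) with h | h
  · exact absurd (step z hz (Or.inl (hzz ▸ h))) (by rw [← hzz]; exact hbad.not_gt)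
  · obtain ⟨y, hy, hy5⟩ := intermediate_value_Icc' him1 hcont
      (show (1 / 5 : ℝ) ∈ Set.Icc (φ 1) (φ z.im) from ⟨by linarith, h.le⟩)
    have := step _ (hmem y hy) (Or.inl hy5.le)
    have h5 : φ y < ε := this
    linarith

/-! ### The joint law of the matrix entries -/

/-- The index set of the independent entries: the real parts on and above the diagonal and the
imaginary parts above the diagonal. -/
abbrev EntryIndex (N : ℕ) : Type :=
  {p : Fin N × Fin N // p.1 ≤ p.2} ⊕ {p : Fin N × Fin N // p.1 < p.2}

/-- The law of each independent entry. -/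
noncomputable def entryLaw (ν ν' : Measure ℝ) {N : ℕ} : EntryIndex N → Measure ℝ :=
  Sum.elim (fun p => if p.1.1 = p.1.2 then ν' else ν) (fun _ => ν)

instance (ν ν' : Measure ℝ) [IsProbabilityMeasure ν] [IsProbabilityMeasure ν'] {N : ℕ}
    (k : EntryIndex N) : IsProbabilityMeasure (entryLaw ν ν' k) := by
  rcases k with p | p
  · simp only [entryLaw, Sum.elim_inl]; split_ifs <;> infer_instance
  · simp only [entryLaw, Sum.elim_inr]; infer_instance

/-- The Wigner matrix as a function of its independent entries. -/
noncomputable def entryMatrix {N : ℕ} (θ : EntryIndex N → ℝ) : Matrix (Fin N) (Fin N) ℂ :=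
  wignerMatrix (fun i j => if h : i ≤ j then θ (Sum.inl ⟨(i, j), h⟩) else 0)
    (fun i j => if h : i < j then θ (Sum.inr ⟨(i, j), h⟩) else 0)

theorem entryMatrix_isHermitian {N : ℕ} (θ : EntryIndex N → ℝ) : (entryMatrix θ).IsHermitian :=
  wignerMatrix_isHermitian _ _

theorem IsWignerFamily.measure_le {Ω : Type*} [MeasurableSpace Ω] {P : Measure Ω}
    [IsProbabilityMeasure P] {ν ν' : Measure ℝ} [IsProbabilityMeasure ν] [IsProbabilityMeasure ν']
    {N : ℕ} {x y : Fin N → Fin N → Ω → ℝ} (h : IsWignerFamily P ν ν' x y)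
    (B : Set (Matrix (Fin N) (Fin N) ℂ)) :
    P {ω | randomMatrix x y ω ∈ B}
      ≤ Measure.pi (entryLaw ν ν') {θ : EntryIndex N → ℝ | entryMatrix θ ∈ B} := by
  set f : EntryIndex N → Ω → ℝ :=
    Sum.elim (fun p => x p.1.1 p.1.2) (fun p => y p.1.1 p.1.2) with hf
  have hlaw : ∀ k, HasLaw (f k) (entryLaw ν ν' k) P := by
    rintro (⟨⟨i, j⟩, hij⟩ | ⟨⟨i, j⟩, hij⟩)
    · simp only [hf, entryLaw, Sum.elim_inl]
      split_ifs with he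
      · have he' : i = j := he
        subst he'
        exact h.law_diag i
      · exact h.law_re i j (lt_of_le_of_ne hij he)
    · simp only [hf, entryLaw, Sum.elim_inr]
      exact h.law_im i j hij
  have hmap : P.map (fun ω k => f k ω) = Measure.pi (entryLaw ν ν') := by
    rw [h.indep.map_fun_eq_pi_map fun k => (hlaw k).aemeasurable]
    congr 1
    funext k
    exact (hlaw k).map_eq
  have hmat : ∀ ω, randomMatrix x y ω = entryMatrix (fun k => f k ω) := fun ω => by
    ext i j
    rcases lt_trichotomy i j with hij | hij | hij
    · simp [randomMatrix, entryMatrix, wignerMatrix, hij, hij.le, hf]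
    · subst hij; simp [randomMatrix, entryMatrix, wignerMatrix, hf]
    · simp [randomMatrix, entryMatrix, wignerMatrix, hij, hij.le, hij.not_gt, hf]
  rw [← hmap]
  simp_rw [hmat]
  exact Measure.le_map_apply (aemeasurable_pi_iff.mpr fun k => (hlaw k).aemeasurable)
    {θ | entryMatrix θ ∈ B}

section Row

variable {N : ℕ}

/-- The entries in the `i`-th row off the diagonal. -/
def rowIndex (i : Fin N) : {j // j ≠ i} ⊕ {j // j ≠ i} → EntryIndex N
  | Sum.inl j => Sum.inl ⟨(min i j, max i j), min_le_max⟩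
  | Sum.inr j => Sum.inr ⟨(min i j, max i j), min_lt_max.mpr (Ne.symm j.2)⟩

theorem min_max_inj {α : Type*} [LinearOrder α] {i j k : α} (h1 : min i j = min i k)
    (h2 : max i j = max i k) : j = k := by
  rcases le_total i j with hj | hj <;> rcases le_total i k with hk | hk <;>
    simp_all
  exact le_antisymm (by assumption) (by assumption)

theorem rowIndex_injective (i : Fin N) : Function.Injective (rowIndex i) := by
  rintro (j | j) (k | k) h
  · simp only [rowIndex, Sum.inl.injEq, Subtype.mk.injEq, Prod.mk.injEq] at h
    rw [Subtype.ext (min_max_inj h.1 h.2)]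
  · simp [rowIndex] at h
  · simp [rowIndex] at h
  · simp only [rowIndex, Sum.inr.injEq, Subtype.mk.injEq, Prod.mk.injEq] at h
    rw [Subtype.ext (min_max_inj h.1 h.2)]

theorem entryLaw_rowIndex (ν ν' : Measure ℝ) (i : Fin N) (k : {j // j ≠ i} ⊕ {j // j ≠ i}) :
    entryLaw ν ν' (rowIndex i k) = ν := by
  rcases k with j | j
  · simp only [rowIndex, entryLaw, Sum.elim_inl]
    rw [if_neg]
    exact (min_lt_max.mpr (Ne.symm j.2)).ne
  · simp [rowIndex, entryLaw]

/-- The set of coordinates occurring in the `i`-th row off the diagonal. -/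
def rowSet (i : Fin N) : Finset (EntryIndex N) := Finset.univ.image (rowIndex i)

theorem mem_or_of_mem_rowSet_inl {i j k : Fin N} {h : j ≤ k}
    (hmem : (Sum.inl ⟨(j, k), h⟩ : EntryIndex N) ∈ rowSet i) : j = i ∨ k = i := by
  obtain ⟨l | l, -, hl⟩ := Finset.mem_image.mp hmem
  · simp only [rowIndex, Sum.inl.injEq, Subtype.mk.injEq, Prod.mk.injEq] at hl
    rcases le_total i (l : Fin N) with h1 | h1
    · left; rw [← hl.1, min_eq_left h1]
    · right; rw [← hl.2, max_eq_left h1]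
  · simp [rowIndex] at hl

theorem mem_or_of_mem_rowSet_inr {i j k : Fin N} {h : j < k}
    (hmem : (Sum.inr ⟨(j, k), h⟩ : EntryIndex N) ∈ rowSet i) : j = i ∨ k = i := by
  obtain ⟨l | l, -, hl⟩ := Finset.mem_image.mp hmem
  · simp [rowIndex] at hl
  · simp only [rowIndex, Sum.inr.injEq, Subtype.mk.injEq, Prod.mk.injEq] at hl
    rcases le_total i (l : Fin N) with h1 | h1
    · left; rw [← hl.1, min_eq_left h1]
    · right; rw [← hl.2, max_eq_left h1]

/-- The minor does not depend on the entries of the deleted row. -/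
theorem minor_entryMatrix_piecewise (i : Fin N) (θ θ' : EntryIndex N → ℝ) :
    minor (entryMatrix ((rowSet i).piecewise θ θ')) i = minor (entryMatrix θ') i := by
  have hl : ∀ {j k : Fin N} (h : j ≤ k), j ≠ i → k ≠ i →
      (rowSet i).piecewise θ θ' (Sum.inl ⟨(j, k), h⟩) = θ' (Sum.inl ⟨(j, k), h⟩) :=
    fun h hj hk => Finset.piecewise_eq_of_notMem _ _ _ fun hm =>
      (mem_or_of_mem_rowSet_inl hm).elim hj hk
  have hr : ∀ {j k : Fin N} (h : j < k), j ≠ i → k ≠ i →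
      (rowSet i).piecewise θ θ' (Sum.inr ⟨(j, k), h⟩) = θ' (Sum.inr ⟨(j, k), h⟩) :=
    fun h hj hk => Finset.piecewise_eq_of_notMem _ _ _ fun hm =>
      (mem_or_of_mem_rowSet_inr hm).elim hj hk
  ext ⟨j, hj⟩ ⟨k, hk⟩
  simp only [minor, Matrix.submatrix_apply, entryMatrix, wignerMatrix, Matrix.of_apply]
  rcases lt_trichotomy j k with h | h | h
  · simp only [h, h.le, if_true, dif_pos, hl _ hj hk, hr _ hj hk]
  · subst h
    simp only [lt_irrefl, if_false, le_refl, dif_pos, hl _ hj hk]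
  · simp only [h, h.le, h.not_gt, if_true, if_false, dif_pos, hl _ hk hj, hr _ hk hj]

/-- The phase with which a real coordinate enters the `i`-th column of the matrix. -/
noncomputable def rowPhase (i : Fin N) : {j // j ≠ i} ⊕ {j // j ≠ i} → ℂ
  | Sum.inl _ => 1
  | Sum.inr j => if (j : Fin N) < i then Complex.I else -Complex.I

theorem norm_rowPhase (i : Fin N) (k : {j // j ≠ i} ⊕ {j // j ≠ i}) : ‖rowPhase i k‖ = 1 := by
  rcases k with j | j
  · simp [rowPhase]
  · simp only [rowPhase]; split_ifs <;> simp

theorem entryMatrix_column (i : Fin N) (θ : EntryIndex N → ℝ) (j : {j // j ≠ i}) :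
    entryMatrix θ j i = ((Real.sqrt N)⁻¹ : ℂ) *
      (rowPhase i (Sum.inl j) * θ (rowIndex i (Sum.inl j))
        + rowPhase i (Sum.inr j) * θ (rowIndex i (Sum.inr j))) := by
  rcases lt_or_gt_of_ne j.2 with h | h
  · simp [entryMatrix, wignerMatrix, rowPhase, rowIndex, h, h.le]
  · simp [entryMatrix, wignerMatrix, rowPhase, rowIndex, h, h.le, h.not_gt]
    exact Or.inl (by ring)

theorem entryMatrix_row (i : Fin N) (θ : EntryIndex N → ℝ) (j : {j // j ≠ i}) :
    entryMatrix θ i j = ((Real.sqrt N)⁻¹ : ℂ) *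
      (star (rowPhase i (Sum.inl j)) * θ (rowIndex i (Sum.inl j))
        + star (rowPhase i (Sum.inr j)) * θ (rowIndex i (Sum.inr j))) := by
  rw [← (entryMatrix_isHermitian θ).apply, entryMatrix_column]
  simp

/-- The coefficient matrix of the Schur form as a quadratic form in the real coordinates. -/
noncomputable def rowCoeff (i : Fin N) (G : Matrix {j // j ≠ i} {j // j ≠ i} ℂ)
    (k l : {j // j ≠ i} ⊕ {j // j ≠ i}) : ℂ :=
  star (rowPhase i k) * G (Sum.elim id id k) (Sum.elim id id l) * rowPhase i l

theorem sum_norm_sq_rowCoeff (i : Fin N) (G : Matrix {j // j ≠ i} {j // j ≠ i} ℂ) :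
    ∑ k, ∑ l, ‖rowCoeff i G k l‖ ^ 2 = 2 ^ 2 * ∑ j, ∑ k, ‖G j k‖ ^ 2 := by
  have : ∀ k l, ‖rowCoeff i G k l‖ ^ 2 = ‖G (Sum.elim id id k) (Sum.elim id id l)‖ ^ 2 := by
    intro k l
    rw [rowCoeff, norm_mul, norm_mul, norm_star, norm_rowPhase, norm_rowPhase, one_mul, mul_one]
  simp only [this, Fintype.sum_sum_type, Sum.elim_inl, Sum.elim_inr, id]
  simp only [Finset.sum_add_distrib]
  ring

theorem sum_rowCoeff_diag (i : Fin N) (G : Matrix {j // j ≠ i} {j // j ≠ i} ℂ) :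
    ∑ k, rowCoeff i G k k = 2 * G.trace := by
  have : ∀ k, rowCoeff i G k k = G (Sum.elim id id k) (Sum.elim id id k) := by
    intro k
    have h : star (rowPhase i k) * rowPhase i k = 1 := by
      rw [mul_comm, ← starRingEnd_apply, Complex.mul_conj, Complex.normSq_eq_norm_sq,
        norm_rowPhase]
      simp
    rw [rowCoeff, mul_right_comm, h, one_mul]
  simp only [this, Fintype.sum_sum_type, Sum.elim_inl, Sum.elim_inr, id, Matrix.trace,
    Matrix.diag_apply]
  ring

theorem schurForm_entryMatrix (hN : 0 < N) (i : Fin N) (θ : EntryIndex N → ℝ) (z : ℂ) :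
    schurForm (entryMatrix θ) z i = (N : ℂ)⁻¹ * ∑ k, ∑ l,
      rowCoeff i (green (minor (entryMatrix θ) i) z) k l * θ (rowIndex i k) * θ (rowIndex i l) := by
  have hs : ((Real.sqrt N)⁻¹ : ℂ) * ((Real.sqrt N)⁻¹ : ℂ) = (N : ℂ)⁻¹ := by
    rw [← mul_inv, ← Complex.ofReal_mul, Real.mul_self_sqrt (by positivity)]
    simp
  simp only [schurForm, entryMatrix_row, entryMatrix_column, rowCoeff, Fintype.sum_sum_type,
    Sum.elim_inl, Sum.elim_inr, id, ← hs]
  simp only [← Finset.sum_add_distrib, Finset.mul_sum]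
  refine Finset.sum_congr rfl fun j _ => Finset.sum_congr rfl fun k _ => ?_
  ring

end Row

/-! ### Measurability of resolvents -/

theorem measurable_inv_apply {α n : Type*} [MeasurableSpace α] [Fintype n] [DecidableEq n]
    {F : α → Matrix n n ℂ} (hF : ∀ i j, Measurable fun a => F a i j) (i j : n) :
    Measurable fun a => (F a)⁻¹ i j := by
  have hdet : ∀ {F : α → Matrix n n ℂ}, (∀ i j, Measurable fun a => F a i j) →
      Measurable fun a => (F a).det := fun {F} hF => by
    simp only [Matrix.det_apply]
    refine Finset.measurable_sum _ fun σ _ => ?_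
    exact (Finset.measurable_prod _ fun i _ => hF _ _).const_smul _
  simp only [Matrix.inv_def, Matrix.smul_apply, smul_eq_mul, Ring.inverse_eq_inv',
    Matrix.adjugate_apply]
  refine (hdet hF).inv.mul (hdet fun k l => ?_)
  by_cases hk : k = j
  · subst hk; simp
  · simpa [Matrix.updateRow_ne hk] using hF k l

theorem measurable_entryMatrix {N : ℕ} (i j : Fin N) :
    Measurable fun θ : EntryIndex N → ℝ => entryMatrix θ i j := by
  have h1 : ∀ i j : Fin N, Measurable fun θ : EntryIndex N → ℝ =>
      ((if h : i ≤ j then θ (Sum.inl ⟨(i, j), h⟩) else 0 : ℝ) : ℂ) := fun i j => by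
    by_cases h : i ≤ j
    · simp only [dif_pos h]; fun_prop
    · simp only [dif_neg h]; fun_prop
  have h2 : ∀ i j : Fin N, Measurable fun θ : EntryIndex N → ℝ =>
      ((if h : i < j then θ (Sum.inr ⟨(i, j), h⟩) else 0 : ℝ) : ℂ) := fun i j => by
    by_cases h : i < j
    · simp only [dif_pos h]; fun_prop
    · simp only [dif_neg h]; fun_prop
  simp only [entryMatrix, wignerMatrix, Matrix.of_apply]
  by_cases h3 : i < j
  · simp only [if_pos h3]
    exact ((h1 i j).add ((h2 i j).const_mul _)).const_mul _
  · by_cases h4 : j < i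
    · simp only [if_neg h3, if_pos h4]
      exact ((h1 j i).sub ((h2 j i).const_mul _)).const_mul _
    · simp only [if_neg h3, if_neg h4]
      exact (h1 i i).const_mul _

theorem measurable_green_minor {N : ℕ} (i : Fin N) (z : ℂ) (j k : {j // j ≠ i}) :
    Measurable fun θ : EntryIndex N → ℝ => green (minor (entryMatrix θ) i) z j k := by
  refine measurable_inv_apply (F := fun θ : EntryIndex N → ℝ =>
    minor (entryMatrix θ) i - z • (1 : Matrix {j // j ≠ i} {j // j ≠ i} ℂ)) (fun a b => ?_) j k
  exact (measurable_entryMatrix a.1 b.1).sub measurable_const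

theorem measurable_schurForm {N : ℕ} (i : Fin N) (z : ℂ) :
    Measurable fun θ : EntryIndex N → ℝ => schurForm (entryMatrix θ) z i :=
  Finset.measurable_sum _ fun j _ => Finset.measurable_sum _ fun k _ =>
    ((measurable_entryMatrix i j).mul (measurable_green_minor i z j k)).mul
      (measurable_entryMatrix k i)

theorem measurable_minorHS {N : ℕ} (i : Fin N) (z : ℂ) :
    Measurable fun θ : EntryIndex N → ℝ => minorHS (entryMatrix θ) z i :=
  (Finset.measurable_sum _ fun j _ => Finset.measurable_sum _ fun k _ =>
    (measurable_green_minor i z j k).norm.pow_const 2).sqrt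

/-! ### Concentration of the Schur forms -/

/-- Conditionally on the minor, the Schur form is a quadratic form in independent variables, to
which the Hanson–Wright bound `hHW` applies. -/
theorem measure_schurForm_le {ν ν' : Measure ℝ} [IsProbabilityMeasure ν] [IsProbabilityMeasure ν']
    {C c : ℝ} (hHW : ∀ (ι : Type) [Fintype ι] (A : ι → ι → ℂ) (t : ℝ), 0 ≤ t →
      Measure.pi (fun _ : ι => ν) {x | t * √(∑ i, ∑ j, ‖A i j‖ ^ 2)
        < ‖∑ i, ∑ j, A i j * x i * x j - (1 / 2 : ℝ) * ∑ i, A i i‖}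
      ≤ ENNReal.ofReal (C * Real.exp (-c * t)))
    {N : ℕ} (hN : 0 < N) (i : Fin N) (z : ℂ) {t : ℝ} (ht : 0 ≤ t) :
    Measure.pi (entryLaw ν ν') {θ : EntryIndex N → ℝ | t * (N : ℝ)⁻¹ * minorHS (entryMatrix θ) z i
        < ‖schurForm (entryMatrix θ) z i - (N : ℂ)⁻¹ * (green (minor (entryMatrix θ) i) z).trace‖}
      ≤ ENNReal.ofReal (C * Real.exp (-(c / 2) * t)) := by
  set π := Measure.pi (entryLaw ν ν' (N := N)) with hπ
  set B := {θ : EntryIndex N → ℝ | t * (N : ℝ)⁻¹ * minorHS (entryMatrix θ) z i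
        < ‖schurForm (entryMatrix θ) z i - (N : ℂ)⁻¹ * (green (minor (entryMatrix θ) i) z).trace‖}
    with hB
  have hBm : MeasurableSet B := by
    refine measurableSet_lt ((measurable_minorHS i z).const_mul _) ?_
    refine ((measurable_schurForm i z).sub (Measurable.const_mul ?_ _)).norm
    exact Finset.measurable_sum _ fun j _ => measurable_green_minor i z j j
  have hrow : π.map (fun θ k => θ (rowIndex i k)) = Measure.pi (fun _ => ν) := by
    have h1 : iIndepFun (fun (k : EntryIndex N) (θ : EntryIndex N → ℝ) => θ k) π :=
      iIndepFun_pi (X := fun _ => id) fun _ => aemeasurable_id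
    rw [(h1.precomp (rowIndex_injective i)).map_fun_eq_pi_map
      fun k => (measurable_pi_apply _).aemeasurable]
    congr 1
    funext k
    rw [hπ, (measurePreserving_eval (entryLaw ν ν') (rowIndex i k)).map_eq, entryLaw_rowIndex]
  have hpw := measurePreserving_piecewise (entryLaw ν ν' (N := N)) (rowSet i)
  rw [← hπ] at hpw
  rw [← hpw.measure_preimage hBm.nullMeasurableSet, Measure.prod_apply_symm (hpw.measurable hBm)]
  have hslice : ∀ θ' : EntryIndex N → ℝ,
      π ((fun θ => (θ, θ')) ⁻¹' ((fun p : (EntryIndex N → ℝ) × (EntryIndex N → ℝ) =>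
        (rowSet i).piecewise p.1 p.2) ⁻¹' B)) ≤ ENNReal.ofReal (C * Real.exp (-(c / 2) * t)) := by
    intro θ'
    set G := green (minor (entryMatrix θ') i) z with hG
    have h2 := hHW ({j // j ≠ i} ⊕ {j // j ≠ i}) (rowCoeff i G) (t / 2) (by positivity)
    rw [sum_norm_sq_rowCoeff, Real.sqrt_mul (by positivity), Real.sqrt_sq (by norm_num),
      sum_rowCoeff_diag, ← hrow, show -c * (t / 2) = -(c / 2) * t by ring] at h2
    refine le_trans ?_ (h2.trans' (Measure.le_map_apply
      (measurable_pi_iff.mpr fun k => measurable_pi_apply _).aemeasurable _))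
    refine measure_mono fun θ hθ => ?_
    simp only [Set.mem_preimage, hB, Set.mem_ofPred_eq, minorHS, schurForm_entryMatrix hN,
      minor_entryMatrix_piecewise, ← hG] at hθ ⊢
    have hmem : ∀ k, (rowSet i).piecewise θ θ' (rowIndex i k) = θ (rowIndex i k) := fun k =>
      Finset.piecewise_eq_of_mem _ _ _ (Finset.mem_image_of_mem _ (Finset.mem_univ k))
    simp only [hmem] at hθ
    have hNr : (0 : ℝ) < N := by exact_mod_cast hN
    rw [← mul_sub, norm_mul, norm_inv, Complex.norm_natCast, mul_comm t, mul_assoc,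
      mul_lt_mul_iff_right₀ (by positivity)] at hθ
    have e : ((1 / 2 : ℝ) : ℂ) * (2 * G.trace) = G.trace := by push_cast; ring
    rw [e]
    calc t / 2 * (2 * √(∑ j, ∑ k, ‖G j k‖ ^ 2)) = t * √(∑ j, ∑ k, ‖G j k‖ ^ 2) := by ring
      _ < _ := hθ
  calc _ ≤ ∫⁻ _, ENNReal.ofReal (C * Real.exp (-(c / 2) * t)) ∂π := lintegral_mono hslice
    _ = _ := by simp

/-- Tail bound for the diagonal entries. -/
theorem measure_diag_le {ν ν' : Measure ℝ} [IsProbabilityMeasure ν] [IsProbabilityMeasure ν']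
    {δ : ℝ} (hδ : 0 < δ) {M : ℝ} (hM : ∫⁻ x, eexp (δ * x ^ 2) ∂ν' ≤ ENNReal.ofReal M)
    {N : ℕ} (hN : 0 < N) (i : Fin N) {τ : ℝ} (hτ : 0 ≤ τ) :
    Measure.pi (entryLaw ν ν') {θ : EntryIndex N → ℝ | τ < ‖entryMatrix θ i i‖}
      ≤ ENNReal.ofReal (M * Real.exp (-(δ * (N * τ ^ 2)))) := by
  set k : EntryIndex N := Sum.inl ⟨(i, i), le_rfl⟩ with hk
  have hNr : (0 : ℝ) < N := by exact_mod_cast hN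
  have hlaw : entryLaw ν ν' k = ν' := by simp [hk, entryLaw]
  have h1 := measure_le_eexp_of_lintegral_le (μ := ν') (f := fun x => δ * x ^ 2)
    (l := δ * (N * τ ^ 2)) (by fun_prop) hM
  have h2 := (measurePreserving_eval (entryLaw ν ν' (N := N)) k).map_eq
  rw [hlaw] at h2
  rw [← h2] at h1
  have h3 := (Measure.le_map_apply (measurable_pi_apply k).aemeasurable _).trans h1
  rw [ENNReal.ofReal_mul' (Real.exp_pos _).le]
  refine (measure_mono fun θ hθ => ?_).trans h3
  have h4 : ‖entryMatrix θ i i‖ = (Real.sqrt N)⁻¹ * |θ k| := by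
    simp [entryMatrix, wignerMatrix, hk, abs_of_nonneg]
  rw [Set.mem_ofPred_eq, h4, ← div_eq_inv_mul, lt_div_iff₀ (Real.sqrt_pos.mpr hNr)] at hθ
  simp only [Set.mem_preimage, Set.mem_ofPred_eq]
  have h5 := pow_le_pow_left₀ (by positivity) hθ.le 2
  rw [mul_pow, Real.sq_sqrt hNr.le, sq_abs] at h5
  have : N * τ ^ 2 ≤ θ k ^ 2 := by linarith
  gcongr

/-- The union bound over the rows. -/
theorem measure_not_regularAt_le {ν ν' : Measure ℝ} [IsProbabilityMeasure ν]
    [IsProbabilityMeasure ν'] {C c : ℝ} (hC : 0 ≤ C)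
    (hHW : ∀ (ι : Type) [Fintype ι] (A : ι → ι → ℂ) (t : ℝ), 0 ≤ t →
      Measure.pi (fun _ : ι => ν) {x | t * √(∑ i, ∑ j, ‖A i j‖ ^ 2)
        < ‖∑ i, ∑ j, A i j * x i * x j - (1 / 2 : ℝ) * ∑ i, A i i‖}
      ≤ ENNReal.ofReal (C * Real.exp (-c * t)))
    {δ : ℝ} (hδ : 0 < δ) {M : ℝ} (hM0 : 0 ≤ M)
    (hM : ∫⁻ x, eexp (δ * x ^ 2) ∂ν' ≤ ENNReal.ofReal M)
    {N : ℕ} (hN : 0 < N) (z : ℂ) {t τ : ℝ} (ht : 0 ≤ t) (hτ : 0 ≤ τ) :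
    Measure.pi (entryLaw ν ν') {θ : EntryIndex N → ℝ | ¬ RegularAt (entryMatrix θ) t τ z}
      ≤ ENNReal.ofReal (N * (M * Real.exp (-(δ * (N * τ ^ 2))) + C * Real.exp (-(c / 2) * t))) := by
  have hsub : {θ : EntryIndex N → ℝ | ¬ RegularAt (entryMatrix θ) t τ z}
      ⊆ ⋃ i : Fin N, ({θ | τ < ‖entryMatrix θ i i‖} ∪
        {θ | t * (N : ℝ)⁻¹ * minorHS (entryMatrix θ) z i < ‖schurForm (entryMatrix θ) z i
          - (N : ℂ)⁻¹ * (green (minor (entryMatrix θ) i) z).trace‖}) := by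
    intro θ hθ
    rw [Set.mem_ofPred_eq, RegularAt] at hθ
    push Not at hθ
    obtain ⟨i, hi⟩ := hθ
    refine Set.mem_iUnion.mpr ⟨i, ?_⟩
    by_cases h : ‖entryMatrix θ i i‖ ≤ τ
    · exact Or.inr (hi h)
    · exact Or.inl (not_le.mp h)
  refine (measure_mono hsub).trans ((measure_iUnion_fintype_le _ _).trans ?_)
  calc _ ≤ ∑ _i : Fin N, ENNReal.ofReal
        (M * Real.exp (-(δ * (N * τ ^ 2))) + C * Real.exp (-(c / 2) * t)) := by
        refine Finset.sum_le_sum fun i _ => (measure_union_le _ _).trans ?_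
        rw [ENNReal.ofReal_add (by positivity) (by positivity)]
        exact add_le_add (measure_diag_le hδ hM hN i hτ) (measure_schurForm_le hHW hN i z ht)
    _ = _ := by
        rw [Finset.sum_const, Finset.card_univ, Fintype.card_fin, nsmul_eq_mul,
          ENNReal.ofReal_mul (by positivity), ENNReal.ofReal_natCast]

/-! ### A polynomial net in the spectral domain -/

/-- The lattice points of mesh `N⁻⁴` in the rectangle `[-2, 2] × (0, 1]`. -/
noncomputable def spectralNet (N : ℕ) : Finset ℂ :=
  (Finset.Icc (-(2 * (N : ℤ) ^ 4)) (2 * (N : ℤ) ^ 4) ×ˢ Finset.Icc (1 : ℤ) ((N : ℤ) ^ 4)).image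
    fun p : ℤ × ℤ => (⟨p.1 / (N : ℝ) ^ 4, p.2 / (N : ℝ) ^ 4⟩ : ℂ)

theorem card_spectralNet_le {N : ℕ} (hN : 0 < N) : ((spectralNet N).card : ℝ) ≤ 5 * (N : ℝ) ^ 8 := by
  have h : (spectralNet N).card ≤ (4 * N ^ 4 + 1) * N ^ 4 := by
    refine Finset.card_image_le.trans (le_of_eq ?_)
    rw [Finset.card_product, Int.card_Icc, Int.card_Icc]
    have h1 : (2 * (N : ℤ) ^ 4 + 1 - -(2 * (N : ℤ) ^ 4)) = ((4 * N ^ 4 + 1 : ℕ) : ℤ) := by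
      push_cast; ring
    have h2 : ((N : ℤ) ^ 4 + 1 - 1) = ((N ^ 4 : ℕ) : ℤ) := by push_cast; ring
    rw [h1, h2, Int.toNat_natCast, Int.toNat_natCast]
  have h1 : ((spectralNet N).card : ℝ) ≤ (4 * (N : ℝ) ^ 4 + 1) * (N : ℝ) ^ 4 := by exact_mod_cast h
  have h2 : (1 : ℝ) ≤ (N : ℝ) ^ 4 := one_le_pow₀ (by exact_mod_cast hN)
  nlinarith

theorem exists_mem_spectralNet {N : ℕ} (hN : 0 < N) {z : ℂ} (hre : |z.re| ≤ 2) (him : 0 < z.im)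
    (him1 : z.im ≤ 1) : ∃ z₀ ∈ spectralNet N, ‖z - z₀‖ ≤ 2 / (N : ℝ) ^ 4 ∧ z.im ≤ z₀.im ∧
      z₀.im ≤ 1 ∧ |z₀.re| ≤ |z.re| + 1 / (N : ℝ) ^ 4 := by
  set R := (N : ℝ) ^ 4 with hR
  have hR0 : 0 < R := by positivity
  have hRZ : (((N : ℤ) ^ 4 : ℤ) : ℝ) = R := by push_cast; rfl
  set a := ⌈R * z.re⌉ with ha
  set b := ⌈R * z.im⌉ with hb
  have ha1 : R * z.re ≤ a := Int.le_ceil _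
  have ha2 : (a : ℝ) < R * z.re + 1 := Int.ceil_lt_add_one _
  have hb1 : R * z.im ≤ b := Int.le_ceil _
  have hb2 : (b : ℝ) < R * z.im + 1 := Int.ceil_lt_add_one _
  have hbR : (b : ℝ) ≤ R := by
    have : b ≤ (N : ℤ) ^ 4 := Int.ceil_le.mpr (by rw [hRZ]; nlinarith)
    rw [← hRZ]; exact_mod_cast this
  obtain ⟨hre1, hre2⟩ := abs_le.mp hre
  refine ⟨⟨a / R, b / R⟩, ?_, ?_, ?_, ?_, ?_⟩
  · refine Finset.mem_image.mpr ⟨(a, b), ?_, rfl⟩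
    rw [Finset.mem_product, Finset.mem_Icc, Finset.mem_Icc]
    refine ⟨⟨?_, ?_⟩, ?_, ?_⟩
    · have h0 : ((-(2 * (N : ℤ) ^ 4) : ℤ) : ℝ) = -(2 * R) := by push_cast; rfl
      have : ((-(2 * (N : ℤ) ^ 4) : ℤ) : ℝ) ≤ a := by rw [h0]; nlinarith
      exact_mod_cast this
    · have h0 : ((2 * (N : ℤ) ^ 4 : ℤ) : ℝ) = 2 * R := by push_cast; rfl
      exact Int.ceil_le.mpr (by rw [h0]; nlinarith)
    · exact Int.one_le_ceil_iff.mpr (by positivity)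
    · exact Int.ceil_le.mpr (by rw [hRZ]; nlinarith)
  · have h1 : |z.re - a / R| ≤ 1 / R := by
      rw [show z.re - a / R = (R * z.re - a) / R by field_simp, abs_div, abs_of_pos hR0]
      gcongr
      rw [abs_le]; constructor <;> linarith
    have h2 : |z.im - b / R| ≤ 1 / R := by
      rw [show z.im - b / R = (R * z.im - b) / R by field_simp, abs_div, abs_of_pos hR0]
      gcongr
      rw [abs_le]; constructor <;> linarith
    refine (Complex.norm_le_abs_re_add_abs_im _).trans ?_
    simp only [Complex.sub_re, Complex.sub_im]
    calc _ ≤ 1 / R + 1 / R := add_le_add h1 h2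
      _ = 2 / R := by ring
  · simp only; rw [le_div_iff₀ hR0]; linarith
  · simp only; rw [div_le_one hR0]; exact hbR
  · simp only
    rw [show a / R = z.re + (a - R * z.re) / R by field_simp; ring]
    refine (abs_add_le _ _).trans ?_
    gcongr
    rw [abs_div, abs_of_pos hR0]
    gcongr
    rw [abs_le]; constructor <;> linarith

/-! ### Asymptotics -/

theorem tendsto_log_natCast : Tendsto (fun N : ℕ => Real.log N) atTop atTop :=
  Real.tendsto_log_atTop.comp tendsto_natCast_atTop_atTop

theorem eventually_pow_mul_exp_le {δ : ℝ} (hδ : 0 < δ) (B : ℝ) :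
    ∀ᶠ N : ℕ in atTop, B * ((N : ℝ) ^ 9 * Real.exp (-(δ * √N)))
      ≤ Real.exp (-(Real.log N) ^ 2) := by
  have hx : Tendsto (fun N : ℕ => √(N : ℝ)) atTop atTop :=
    Real.tendsto_sqrt_atTop.comp tendsto_natCast_atTop_atTop
  have h1 : ∀ᶠ x : ℝ in atTop, Real.log x ^ 1 ≤ δ / 72 * x := by
    filter_upwards [(Real.isLittleO_pow_log_id_atTop (n := 1)).bound (by positivity : 0 < δ / 72),
      eventually_gt_atTop 0] with x hx h0
    simp only [id, Real.norm_eq_abs, abs_of_pos h0] at hx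
    exact (le_abs_self _).trans hx
  have h2 : ∀ᶠ x : ℝ in atTop, Real.log x ^ 2 ≤ δ / 16 * x := by
    filter_upwards [(Real.isLittleO_pow_log_id_atTop (n := 2)).bound (by positivity : 0 < δ / 16),
      eventually_gt_atTop 0] with x hx h0
    simp only [id, Real.norm_eq_abs, abs_of_pos h0] at hx
    exact (le_abs_self _).trans hx
  have h3 : Tendsto (fun N : ℕ => |B| * Real.exp (-(δ / 2 * √N))) atTop (𝓝 0) := by
    have h := (Real.tendsto_exp_neg_atTop_nhds_zero.comp
      (hx.const_mul_atTop (by positivity : 0 < δ / 2))).const_mul |B|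
    simpa [Function.comp_def] using h
  filter_upwards [hx.eventually h1, hx.eventually h2, h3.eventually_le_const one_pos,
    eventually_gt_atTop 0] with N e1 e2 e3 hN
  have hNr : (0 : ℝ) < N := by exact_mod_cast hN
  have hlog : Real.log N = 2 * Real.log √N := by
    rw [Real.log_sqrt hNr.le]; ring
  have hpow : (N : ℝ) ^ 9 = Real.exp (9 * Real.log N) := by
    rw [mul_comm, Real.exp_mul, Real.exp_log hNr]; norm_cast
  rw [pow_one] at e1
  calc B * ((N : ℝ) ^ 9 * Real.exp (-(δ * √N)))
      ≤ |B| * ((N : ℝ) ^ 9 * Real.exp (-(δ * √N))) := by gcongr; exact le_abs_self _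
    _ ≤ |B| * (Real.exp (-(δ / 2 * √N)) * Real.exp (-(Real.log N) ^ 2)) := by
        rw [hpow, ← Real.exp_add, ← Real.exp_add]
        refine mul_le_mul_of_nonneg_left (Real.exp_le_exp.mpr ?_) (abs_nonneg B)
        rw [hlog]
        nlinarith
    _ = (|B| * Real.exp (-(δ / 2 * √N))) * Real.exp (-(Real.log N) ^ 2) := by ring
    _ ≤ 1 * Real.exp (-(Real.log N) ^ 2) := by gcongr
    _ = _ := one_mul _

theorem eventually_pow_mul_exp_log_le (B : ℝ) :
    ∀ᶠ N : ℕ in atTop, B * ((N : ℝ) ^ 9 * Real.exp (-(3 * (Real.log N) ^ 2)))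
      ≤ Real.exp (-(Real.log N) ^ 2) := by
  have h3 : Tendsto (fun N : ℕ => |B| * Real.exp (-(Real.log N))) atTop (𝓝 0) := by
    have h := (Real.tendsto_exp_neg_atTop_nhds_zero.comp tendsto_log_natCast).const_mul |B|
    simpa [Function.comp_def] using h
  filter_upwards [h3.eventually_le_const one_pos, eventually_gt_atTop 0,
    tendsto_log_natCast.eventually_ge_atTop 5] with N e3 hN hL
  have hNr : (0 : ℝ) < N := by exact_mod_cast hN
  have hpow : (N : ℝ) ^ 9 = Real.exp (9 * Real.log N) := by
    rw [mul_comm, Real.exp_mul, Real.exp_log hNr]; norm_cast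
  calc B * ((N : ℝ) ^ 9 * Real.exp (-(3 * (Real.log N) ^ 2)))
      ≤ |B| * ((N : ℝ) ^ 9 * Real.exp (-(3 * (Real.log N) ^ 2))) := by
        gcongr; exact le_abs_self _
    _ ≤ |B| * (Real.exp (-(Real.log N)) * Real.exp (-(Real.log N) ^ 2)) := by
        rw [hpow, ← Real.exp_add, ← Real.exp_add]
        refine mul_le_mul_of_nonneg_left (Real.exp_le_exp.mpr ?_) (abs_nonneg B)
        nlinarith
    _ = (|B| * Real.exp (-(Real.log N))) * Real.exp (-(Real.log N) ^ 2) := by ring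
    _ ≤ 1 * Real.exp (-(Real.log N) ^ 2) := by gcongr
    _ = _ := one_mul _

theorem eventually_error_le (A : ℝ) {r : ℝ} (hr : 0 < r) :
    ∀ᶠ N : ℕ in atTop, 1 / √(√(N : ℝ)) + 3 * (A / (Real.log N) ^ 2) ≤ r := by
  have hx : Tendsto (fun N : ℕ => √(√(N : ℝ))) atTop atTop :=
    Real.tendsto_sqrt_atTop.comp (Real.tendsto_sqrt_atTop.comp tendsto_natCast_atTop_atTop)
  have h1 : Tendsto (fun N : ℕ => 1 / √(√(N : ℝ))) atTop (𝓝 0) := by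
    simpa only [one_div] using! hx.inv_tendsto_atTop
  have h2 : Tendsto (fun N : ℕ => A / (Real.log N) ^ 2) atTop (𝓝 0) :=
    tendsto_const_nhds.div_atTop ((tendsto_pow_atTop two_ne_zero).comp tendsto_log_natCast)
  have h3 := h1.add (h2.const_mul 3)
  rw [mul_zero, add_zero] at h3
  exact h3.eventually_le_const hr

/-! ### The local law on the product space -/

theorem eventually_measure_not_close_le {ν ν' : Measure ℝ} [IsProbabilityMeasure ν]
    [IsProbabilityMeasure ν'] {C c : ℝ} (hC : 0 ≤ C) (hc : 0 < c)
    (hHW : ∀ (ι : Type) [Fintype ι] (A : ι → ι → ℂ) (t : ℝ), 0 ≤ t →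
      Measure.pi (fun _ : ι => ν) {x | t * √(∑ i, ∑ j, ‖A i j‖ ^ 2)
        < ‖∑ i, ∑ j, A i j * x i * x j - (1 / 2 : ℝ) * ∑ i, A i i‖}
      ≤ ENNReal.ofReal (C * Real.exp (-c * t)))
    {δ : ℝ} (hδ : 0 < δ) {M : ℝ} (hM0 : 0 ≤ M)
    (hM : ∫⁻ x, eexp (δ * x ^ 2) ∂ν' ≤ ENNReal.ofReal M)
    {κ ε : ℝ} (hκ : 0 < κ) (hκ2 : κ ≤ 2) (hε : 0 < ε) (hε1 : ε ≤ 1 / 10) :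
    ∀ᶠ N : ℕ in atTop, Measure.pi (entryLaw ν ν') {θ : EntryIndex N → ℝ |
      ¬ ∀ z ∈ spectralDomain N κ 1, ‖stieltjes (entryMatrix θ) z - mSC z‖ < ε}
      ≤ ENNReal.ofReal (Real.exp (-(Real.log N) ^ 2)) := by
  -- The deviation parameter is `t = A (log N)²`; the tail exponent `c / 2 * A = 3` beats the
  -- cardinality of the net.
  set A : ℝ := 6 / c with hA
  have hA0 : 0 < A := by positivity
  set b := bulkConst (κ / 2) with hb
  have hb0 : 0 < b := bulkConst_pos (by positivity) (by linarith)
  have hb' := bulkConst_pos hκ hκ2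
  have hN4 : Tendsto (fun N : ℕ => 2 / (N : ℝ) ^ 4) atTop (𝓝 0) :=
    tendsto_const_nhds.div_atTop
      ((tendsto_pow_atTop (by norm_num)).comp tendsto_natCast_atTop_atTop)
  have hN2 : Tendsto (fun N : ℕ => 2 / (N : ℝ) ^ 2) atTop (𝓝 0) :=
    tendsto_const_nhds.div_atTop
      ((tendsto_pow_atTop (by norm_num)).comp tendsto_natCast_atTop_atTop)
  filter_upwards [eventually_gt_atTop 0, tendsto_log_natCast.eventually_ge_atTop 1,
    (((tendsto_pow_atTop two_ne_zero).comp tendsto_log_natCast).const_mul_atTop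
      hA0).eventually_ge_atTop 1,
    eventually_error_le A (by norm_num : (0 : ℝ) < 1 / 12),
    eventually_error_le A (by positivity : 0 < ε * b / 24),
    hN4.eventually_le_const (by norm_num : (0 : ℝ) < 1 / 2),
    hN4.eventually_le_const (by positivity : 0 < κ / 2),
    hN4.eventually_le_const (by positivity : 0 < ε / 8 * bulkConst κ),
    hN2.eventually_le_const (by positivity : 0 < ε / 8),
    eventually_pow_mul_exp_le hδ (10 * M), eventually_pow_mul_exp_log_le (10 * C)]
    with N hN hL ht hs1 hs2 hρ hρκ hρb hρε hp1 hp2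
  have hNr : (0 : ℝ) < N := by exact_mod_cast hN
  have hN1 : (1 : ℝ) ≤ N := by exact_mod_cast hN
  set L := Real.log N with hLdef
  have hL0 : 0 < L := by linarith
  set t := A * L ^ 2 with htdef
  have ht1 : 1 ≤ t := ht
  set τ := 1 / √(√(N : ℝ)) with hτ
  have hτ0 : 0 ≤ τ := by positivity
  have hscale : 1 / (N : ℝ) ≤ minScale N := by
    rw [minScale]
    gcongr
    exact one_le_pow₀ hL
  have hscale0 : 0 < minScale N := lt_of_lt_of_le (by positivity) hscale
  have hsub : {θ : EntryIndex N → ℝ | ¬ ∀ z ∈ spectralDomain N κ 1,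
      ‖stieltjes (entryMatrix θ) z - mSC z‖ < ε}
      ⊆ ⋃ z ∈ spectralNet N, {θ | ¬ RegularAt (entryMatrix θ) t τ z} := by
    intro θ hθ
    by_contra hgood
    simp only [Set.mem_iUnion, Set.mem_ofPred_eq, not_exists, not_not] at hgood
    refine hθ (norm_stieltjes_sub_mSC_lt_of_net (entryMatrix_isHermitian θ) hκ hκ2 hε hε1 hscale0
      (ρ := 2 / (N : ℝ) ^ 4) hρ ?_ ((div_le_iff₀ hb').mpr hρb) ?_)
    · refine le_trans ?_ hρε
      rw [div_le_iff₀ (by positivity)]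
      calc 2 / (N : ℝ) ^ 4 = 2 / (N : ℝ) ^ 2 * (1 / (N : ℝ)) ^ 2 := by field_simp
        _ ≤ _ := by gcongr
    · intro z hz
      obtain ⟨hre, him, him1⟩ := hz
      obtain ⟨z₀, hz₀, hd, h1, h2, h3⟩ :=
        exists_mem_spectralNet hN (by linarith) (hscale0.trans_le him) him1
      have hz₀im : minScale N ≤ z₀.im := him.trans h1
      have hz₀pos : 0 < z₀.im := hscale0.trans_le hz₀im
      refine ⟨z₀, hd, hz₀im, fun hlow => ?_⟩
      have hst : t / √(N * z₀.im) ≤ A / L ^ 2 := by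
        have h4 : L ^ 4 ≤ √(N * z₀.im) := by
          refine Real.le_sqrt_of_sq_le ?_
          calc (L ^ 4) ^ 2 = N * minScale N := by rw [minScale]; field_simp; ring
            _ ≤ _ := by gcongr
        calc t / √(N * z₀.im) ≤ t / L ^ 4 := by gcongr
          _ = A / L ^ 2 := by rw [htdef]; field_simp
      have herr : τ + 3 * (t / √(N * z₀.im)) ≤ τ + 3 * (A / L ^ 2) := by gcongr
      have hsc := (hgood z₀ hz₀).norm_selfConsistent_le hN (entryMatrix_isHermitian θ) hz₀pos ht1 hτ0
        (herr.trans hs1) hlow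
      have hstab := norm_sub_mSC_le hz₀pos
        (im_stieltjes_nonneg (entryMatrix_isHermitian θ) hz₀pos) hsc
      have hbz : b ≤ (mSC z₀).im := by
        refine bulkConst_le_im_mSC hz₀pos h2 ?_ (by positivity)
        have : 1 / (N : ℝ) ^ 4 ≤ 2 / (N : ℝ) ^ 4 := by gcongr; norm_num
        linarith
      have h5 := (mul_le_mul_of_nonneg_left hbz (norm_nonneg
        (stieltjes (entryMatrix θ) z₀ - mSC z₀))).trans hstab
      have h6 : ‖stieltjes (entryMatrix θ) z₀ - mSC z₀‖ * b ≤ ε / 2 * b := by linarith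
      exact le_of_mul_le_mul_right h6 hb0
  have hterm := fun z => measure_not_regularAt_le (ν := ν) (ν' := ν') hC hHW hδ hM0 hM hN z
    (by positivity : 0 ≤ t) hτ0
  have hNτ : N * τ ^ 2 = √N := by
    rw [hτ, div_pow, one_pow, Real.sq_sqrt (Real.sqrt_nonneg _), mul_one_div, Real.div_sqrt]
  have hct : -(c / 2) * t = -(3 * L ^ 2) := by rw [htdef, hA]; field_simp; norm_num
  rw [hNτ, hct] at hterm
  refine (measure_mono hsub).trans ((measure_biUnion_finset_le _ _).trans
    ((Finset.sum_le_sum fun z _ => hterm z).trans ?_))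
  rw [Finset.sum_const, nsmul_eq_mul, ← ENNReal.ofReal_natCast, ← ENNReal.ofReal_mul (by positivity)]
  refine ENNReal.ofReal_le_ofReal ?_
  calc ((spectralNet N).card : ℝ) * (N * (M * Real.exp (-(δ * √N)) + C * Real.exp (-(3 * L ^ 2))))
      ≤ 5 * (N : ℝ) ^ 8 * (N * (M * Real.exp (-(δ * √N)) + C * Real.exp (-(3 * L ^ 2)))) := by
        gcongr
        exact card_spectralNet_le hN
    _ = (10 * M * ((N : ℝ) ^ 9 * Real.exp (-(δ * √N)))
          + 10 * C * ((N : ℝ) ^ 9 * Real.exp (-(3 * L ^ 2)))) / 2 := by ring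
    _ ≤ _ := by linarith

/-! ### Counting eigenvalues with the Poisson kernel -/

/-- The Poisson kernel of width `η` around `x`, integrated over `[E - ρ, E + ρ]`: a smoothed
indicator function of this interval. -/
noncomputable def poissonMass (η E ρ x : ℝ) : ℝ :=
  ∫ y in (E - ρ)..(E + ρ), Real.pi⁻¹ * (η / ((x - y) ^ 2 + η ^ 2))

theorem continuous_poisson {η : ℝ} (hη : 0 < η) (x : ℝ) :
    Continuous fun y : ℝ => Real.pi⁻¹ * (η / ((x - y) ^ 2 + η ^ 2)) :=
  continuous_const.mul (continuous_const.div (by fun_prop) fun y => by positivity)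

theorem poissonMass_eq {η : ℝ} (hη : 0 < η) (E ρ x : ℝ) :
    poissonMass η E ρ x
      = Real.pi⁻¹ * (Real.arctan ((E + ρ - x) / η) - Real.arctan ((E - ρ - x) / η)) := by
  rw [poissonMass, mul_sub]
  refine intervalIntegral.integral_eq_sub_of_hasDerivAt
    (f := fun y => Real.pi⁻¹ * Real.arctan ((y - x) / η)) (fun y _ => ?_)
    ((continuous_poisson hη x).intervalIntegrable _ _)
  have h := ((((hasDerivAt_id y).sub_const x).div_const η).arctan).const_mul Real.pi⁻¹
  refine h.congr_deriv ?_
  simp only [id]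
  have : (x - y) ^ 2 + η ^ 2 ≠ 0 := by positivity
  have : 1 + ((y - x) / η) ^ 2 ≠ 0 := by positivity
  field_simp
  ring

theorem poissonMass_le_one {η : ℝ} (hη : 0 < η) (E ρ x : ℝ) : poissonMass η E ρ x ≤ 1 := by
  rw [poissonMass_eq hη, inv_mul_le_iff₀ Real.pi_pos, mul_one]
  have := Real.arctan_lt_pi_div_two ((E + ρ - x) / η)
  have := Real.neg_pi_div_two_lt_arctan ((E - ρ - x) / η)
  linarith

theorem poissonMass_nonneg {η : ℝ} (hη : 0 < η) {ρ : ℝ} (hρ : 0 ≤ ρ) (E x : ℝ) :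
    0 ≤ poissonMass η E ρ x :=
  intervalIntegral.integral_nonneg (by linarith) fun y _ => by positivity

theorem pi_div_two_sub_inv_le_arctan {u : ℝ} (hu : 0 < u) : Real.pi / 2 - u⁻¹ ≤ Real.arctan u := by
  have h1 := Real.arctan_inv_of_pos hu
  have h2 : Real.arctan u⁻¹ ≤ u⁻¹ := by
    have := Real.le_tan (Real.arctan_nonneg.mpr (by positivity : 0 ≤ u⁻¹))
      (Real.arctan_lt_pi_div_two _)
    rwa [Real.tan_arctan] at this
  linarith

/-- Points well inside the interval carry almost full Poisson mass. -/
theorem one_sub_sq_le_poissonMass {a r E x : ℝ} (ha : 0 < a) (hr : 0 < r) (hx : |x - E| ≤ r) :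
    1 - a ^ 2 ≤ poissonMass (a ^ 3 * r) E ((1 + a) * r) x := by
  have hη : 0 < a ^ 3 * r := by positivity
  obtain ⟨hx1, hx2⟩ := abs_le.mp hx
  rw [poissonMass_eq hη]
  have hu : (a ^ 2)⁻¹ ≤ (E + (1 + a) * r - x) / (a ^ 3 * r) := by
    rw [le_div_iff₀ hη, show (a ^ 2)⁻¹ * (a ^ 3 * r) = a * r by field_simp]
    nlinarith
  have hv : (a ^ 2)⁻¹ ≤ -((E - (1 + a) * r - x) / (a ^ 3 * r)) := by
    rw [← neg_div, le_div_iff₀ hη, show (a ^ 2)⁻¹ * (a ^ 3 * r) = a * r by field_simp]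
    nlinarith
  have h0 := pi_div_two_sub_inv_le_arctan (u := (a ^ 2)⁻¹) (by positivity)
  rw [inv_inv] at h0
  have h1 := Real.arctan_strictMono.monotone hu
  have h2 := Real.arctan_strictMono.monotone hv
  rw [Real.arctan_neg] at h2
  rw [← div_eq_inv_mul, le_div_iff₀ Real.pi_pos]
  nlinarith [Real.pi_gt_three, sq_nonneg a]

/-- Points outside `[E - r, E + r]` carry little mass of the shrunk interval, in a way that is
summable against the Poisson kernel of width `r`. -/
theorem poissonMass_le_of_lt {a r E x : ℝ} (ha : 0 < a) (ha1 : a ≤ 1) (hr : 0 < r)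
    (hx : r < |x - E|) :
    poissonMass (a ^ 3 * r) E ((1 - a) * r) x
      ≤ 4 * a * r * (Real.pi⁻¹ * (r / ((E - x) ^ 2 + r ^ 2))) := by
  have hη : 0 < a ^ 3 * r := by positivity
  set X := |x - E| with hX
  have hX0 : 0 < X := hr.trans hx
  have hXsq : (E - x) ^ 2 = X ^ 2 := by rw [hX, sq_abs]; ring
  have h1 := intervalIntegral.norm_integral_le_of_norm_le_const (a := E - (1 - a) * r)
    (b := E + (1 - a) * r) (f := fun y => Real.pi⁻¹ * (a ^ 3 * r / ((x - y) ^ 2 + (a ^ 3 * r) ^ 2)))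
    (C := Real.pi⁻¹ * (a ^ 3 * r / (a * X) ^ 2)) (fun y hy => by
      rw [Set.uIoc_of_le (by nlinarith)] at hy
      rw [Real.norm_eq_abs, abs_of_nonneg (by positivity)]
      have hyE : |y - E| ≤ (1 - a) * r := abs_le.mpr ⟨by linarith [hy.1], by linarith [hy.2]⟩
      have hxy : a * X ≤ |x - y| := by
        have : X ≤ |x - y| + |y - E| := by
          rw [hX]; exact (abs_sub_le x y E)
        nlinarith
      gcongr
      calc (a * X) ^ 2 ≤ |x - y| ^ 2 := by gcongr
        _ = (x - y) ^ 2 := sq_abs _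
        _ ≤ _ := by nlinarith [sq_nonneg (a ^ 3 * r)])
  have h2 := (le_abs_self _).trans h1
  rw [← poissonMass] at h2
  refine h2.trans ?_
  have h3 : |E + (1 - a) * r - (E - (1 - a) * r)| ≤ 2 * r := by
    rw [abs_of_nonneg (by nlinarith)]; nlinarith
  have h4 : r / X ^ 2 ≤ 2 * (r / (X ^ 2 + r ^ 2)) := by
    rw [← mul_div_assoc, div_le_div_iff₀ (by positivity) (by positivity)]
    nlinarith [mul_pos hr hr, mul_pos hr (mul_pos hX0 hX0), pow_le_pow_left₀ hr.le hx.le 2]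
  calc Real.pi⁻¹ * (a ^ 3 * r / (a * X) ^ 2) * |E + (1 - a) * r - (E - (1 - a) * r)|
      ≤ Real.pi⁻¹ * (a ^ 3 * r / (a * X) ^ 2) * (2 * r) := by gcongr
    _ = 2 * a * r * (Real.pi⁻¹ * (r / X ^ 2)) := by field_simp
    _ ≤ 2 * a * r * (Real.pi⁻¹ * (2 * (r / (X ^ 2 + r ^ 2)))) := by gcongr
    _ = _ := by rw [hXsq]; ring

section Count

variable {N : ℕ} {H : Matrix (Fin N) (Fin N) ℂ}

theorem densityOfStates_eq_sum (hH : H.IsHermitian) {η : ℝ} (hη : 0 < η) (E : ℝ) :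
    densityOfStates H η E
      = (N : ℝ)⁻¹ * ∑ α, Real.pi⁻¹ * (η / ((hH.eigenvalues α - E) ^ 2 + η ^ 2)) := by
  have him : ((E : ℂ) + η * Complex.I).im = η := by simp
  have hre : ((E : ℂ) + η * Complex.I).re = E := by simp
  rw [densityOfStates, im_stieltjes hH (by rw [him]; exact hη), him, hre, ← Finset.mul_sum]
  field_simp

theorem sum_poissonMass (hN : 0 < N) (hH : H.IsHermitian) {η : ℝ} (hη : 0 < η) (E ρ : ℝ) :
    IntervalIntegrable (fun y => densityOfStates H η y) volume (E - ρ) (E + ρ) ∧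
    ∑ α, poissonMass η E ρ (hH.eigenvalues α)
      = N * ∫ y in (E - ρ)..(E + ρ), densityOfStates H η y := by
  have hNr : (N : ℝ) ≠ 0 := by positivity
  have hint : ∀ α, IntervalIntegrable
      (fun y => Real.pi⁻¹ * (η / ((hH.eigenvalues α - y) ^ 2 + η ^ 2))) volume (E - ρ) (E + ρ) :=
    fun α => (continuous_poisson hη _).intervalIntegrable _ _
  simp_rw [densityOfStates_eq_sum hH hη]
  refine ⟨Continuous.intervalIntegrable (continuous_const.mul
    (continuous_finsetSum _ fun α _ => continuous_poisson hη _)) _ _, ?_⟩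
  rw [intervalIntegral.integral_const_mul, mul_inv_cancel_left₀ hNr,
    intervalIntegral.integral_finsetSum fun α _ => hint α]
  rfl

/-- The eigenvalue count in a window of half-width `r` is controlled by the smoothed density of
states on the much smaller scale `a³ r`. -/
theorem abs_eigenvalueCount_sub_le (hN : 0 < N) (hH : H.IsHermitian) {a r E d ε : ℝ} (ha : 0 < a)
    (ha1 : a ≤ 1 / 2) (hr : 0 < r) (hd1 : d ≤ 1) (hε0 : 0 ≤ ε) (hε1 : ε ≤ 1)
    (hclose : ∀ y, |y - E| ≤ 2 * r → |densityOfStates H (a ^ 3 * r) y - d| ≤ ε)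
    (hbound : densityOfStates H r E ≤ 2) :
    |(eigenvalueCount hH r E : ℝ) / (2 * N * r) - d| ≤ ε + 8 * a := by
  have hη : 0 < a ^ 3 * r := by positivity
  have hNr : (0 : ℝ) < N := by exact_mod_cast hN
  set n : ℝ := (eigenvalueCount hH r E : ℝ) with hn
  set S := Finset.univ.filter fun α : Fin N => |hH.eigenvalues α - E| ≤ r with hS
  have hnS : n = ∑ α ∈ S, (1 : ℝ) := by
    rw [hn, eigenvalueCount, Finset.sum_const, nsmul_eq_mul, mul_one]
  have hn0 : 0 ≤ n := by rw [hn]; positivity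
  have hupper : n * (1 - a ^ 2) ≤ N * (2 * ((1 + a) * r) * (d + ε)) := by
    obtain ⟨hi, hs⟩ := sum_poissonMass hN hH hη E ((1 + a) * r)
    calc n * (1 - a ^ 2) = ∑ α ∈ S, (1 - a ^ 2) := by rw [hnS, Finset.sum_mul, one_mul]
      _ ≤ ∑ α ∈ S, poissonMass (a ^ 3 * r) E ((1 + a) * r) (hH.eigenvalues α) :=
          Finset.sum_le_sum fun α hα =>
            one_sub_sq_le_poissonMass ha hr (Finset.mem_filter.mp hα).2
      _ ≤ ∑ α, poissonMass (a ^ 3 * r) E ((1 + a) * r) (hH.eigenvalues α) :=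
          Finset.sum_le_sum_of_subset_of_nonneg (Finset.subset_univ _)
            fun α _ _ => poissonMass_nonneg hη (by positivity) _ _
      _ = _ := hs
      _ ≤ N * ∫ y in (E - (1 + a) * r)..(E + (1 + a) * r), (d + ε) := by
          gcongr
          refine intervalIntegral.integral_mono_on (by nlinarith) hi (by simp) fun y hy => ?_
          have := (abs_le.mp (hclose y (abs_le.mpr ⟨by nlinarith [hy.1], by nlinarith [hy.2]⟩))).2
          linarith
      _ = _ := by rw [intervalIntegral.integral_const, smul_eq_mul]; ring
  have hlower : N * (2 * ((1 - a) * r) * (d - ε)) ≤ n + 8 * a * r * N := by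
    obtain ⟨hi, hs⟩ := sum_poissonMass hN hH hη E ((1 - a) * r)
    calc N * (2 * ((1 - a) * r) * (d - ε))
        = N * ∫ y in (E - (1 - a) * r)..(E + (1 - a) * r), (d - ε) := by
          rw [intervalIntegral.integral_const, smul_eq_mul]; ring
      _ ≤ N * ∫ y in (E - (1 - a) * r)..(E + (1 - a) * r), densityOfStates H (a ^ 3 * r) y := by
          gcongr
          refine intervalIntegral.integral_mono_on (by nlinarith) (by simp) hi fun y hy => ?_
          have := (abs_le.mp (hclose y (abs_le.mpr ⟨by nlinarith [hy.1], by nlinarith [hy.2]⟩))).1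
          linarith
      _ = ∑ α, poissonMass (a ^ 3 * r) E ((1 - a) * r) (hH.eigenvalues α) := hs.symm
      _ ≤ ∑ α, ((if α ∈ S then 1 else 0) + 4 * a * r *
            (Real.pi⁻¹ * (r / ((hH.eigenvalues α - E) ^ 2 + r ^ 2)))) := by
          refine Finset.sum_le_sum fun α _ => ?_
          by_cases hα : α ∈ S
          · rw [if_pos hα]
            have : 0 ≤ 4 * a * r * (Real.pi⁻¹ * (r / ((hH.eigenvalues α - E) ^ 2 + r ^ 2))) := by
              positivity
            linarith [poissonMass_le_one hη E ((1 - a) * r) (hH.eigenvalues α)]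
          · rw [if_neg hα, zero_add]
            have hlt : r < |hH.eigenvalues α - E| := by
              by_contra! h
              exact hα (Finset.mem_filter.mpr ⟨Finset.mem_univ _, h⟩)
            have := poissonMass_le_of_lt ha (by linarith) hr hlt
            rwa [show (E - hH.eigenvalues α) ^ 2 = (hH.eigenvalues α - E) ^ 2 by ring] at this
      _ = n + 4 * a * r * (N * densityOfStates H r E) := by
          rw [Finset.sum_add_distrib, ← Finset.mul_sum, densityOfStates_eq_sum hH hr,
            mul_inv_cancel_left₀ hNr.ne', hnS, Finset.sum_ite_mem, Finset.univ_inter]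
      _ ≤ n + 4 * a * r * (N * 2) := by gcongr
      _ = _ := by ring
  have hden : 0 < 2 * N * r := by positivity
  rw [abs_le]
  constructor
  · rw [le_sub_iff_add_le, le_div_iff₀ hden]
    have h1 : d - ε - a - 4 * a ≤ (1 - a) * (d - ε) - 4 * a := by nlinarith
    have h2 : (-(ε + 8 * a) + d) ≤ (1 - a) * (d - ε) - 4 * a := by nlinarith
    calc (-(ε + 8 * a) + d) * (2 * N * r) ≤ ((1 - a) * (d - ε) - 4 * a) * (2 * N * r) := by gcongr
      _ ≤ n := by nlinarith
  · rw [sub_le_iff_le_add, div_le_iff₀ hden]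
    -- `(1 + a) / (1 - a²) = 1 / (1 - a) ≤ 1 + 2 a`
    have h1 : n * (1 - a) ≤ 2 * N * r * (d + ε) := by
      have : (n * (1 - a)) * (1 + a) ≤ (2 * N * r * (d + ε)) * (1 + a) := by nlinarith
      exact le_of_mul_le_mul_right this (by linarith)
    have h2 : n ≤ 2 * N * r * (d + ε) * (1 + 2 * a) := by
      have h3 : n * (1 - a) * (1 + 2 * a) ≤ 2 * N * r * (d + ε) * (1 + 2 * a) := by gcongr
      have h4 : n ≤ n * (1 - a) * (1 + 2 * a) := by
        have : 1 ≤ (1 - a) * (1 + 2 * a) := by nlinarith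
        nlinarith
      exact h4.trans h3
    calc n ≤ (2 * N * r) * ((d + ε) * (1 + 2 * a)) := by rw [← mul_assoc]; exact h2
      _ ≤ (2 * N * r) * (ε + 8 * a + d) := by
          gcongr
          nlinarith
      _ = _ := by ring

end Count

/-! ### The semicircle density in the bulk -/

theorem sqrt_bulk_le {κ E : ℝ} (hE : |E| ≤ 2 - κ) : √(4 - (2 - κ) ^ 2) ≤ √(4 - E ^ 2) := by
  refine Real.sqrt_le_sqrt ?_
  have := pow_le_pow_left₀ (abs_nonneg E) hE 2
  rw [sq_abs] at this
  linarith

theorem rhoSC_le_one (E : ℝ) : rhoSC E ≤ 1 := by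
  rw [rhoSC]
  split_ifs
  · have h1 : √(4 - E ^ 2) ≤ 2 := Real.sqrt_le_iff.mpr ⟨by norm_num, by nlinarith [sq_nonneg E]⟩
    rw [inv_mul_le_iff₀ (by positivity)]
    nlinarith [Real.pi_gt_three]
  · exact zero_le_one

theorem abs_rhoSC_sub_le {y E : ℝ} (hy : |y| ≤ 2) (hE : |E| ≤ 2) :
    |rhoSC y - rhoSC E| * √(4 - E ^ 2) ≤ 4 * |y - E| := by
  obtain ⟨hy1, hy2⟩ := abs_le.mp hy
  obtain ⟨hE1, hE2⟩ := abs_le.mp hE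
  have hA : √(4 - y ^ 2) ^ 2 = 4 - y ^ 2 := Real.sq_sqrt (by nlinarith)
  have hB : √(4 - E ^ 2) ^ 2 = 4 - E ^ 2 := Real.sq_sqrt (by nlinarith)
  set A := √(4 - y ^ 2) with hAdef
  set B := √(4 - E ^ 2) with hBdef
  have hA0 : 0 ≤ A := Real.sqrt_nonneg _
  have hB0 : 0 ≤ B := Real.sqrt_nonneg _
  have h1 : |A - B| * B ≤ 4 * |y - E| := by
    calc |A - B| * B ≤ |A - B| * (A + B) := by gcongr; linarith
      _ = |(A - B) * (A + B)| := by rw [abs_mul, abs_of_nonneg (by positivity : 0 ≤ A + B)]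
      _ = |E + y| * |y - E| := by
          rw [← abs_mul, show (A - B) * (A + B) = -((E + y) * (y - E)) by nlinarith, abs_neg]
      _ ≤ 4 * |y - E| := by
          gcongr
          rw [abs_le]; constructor <;> linarith
  rw [rhoSC, rhoSC, if_pos hy, if_pos hE, ← mul_sub, abs_mul, mul_assoc,
    abs_of_pos (by positivity : 0 < (2 * Real.pi)⁻¹)]
  refine (mul_le_of_le_one_left (by positivity) ?_).trans h1
  refine inv_le_one_of_one_le₀ ?_
  linarith [Real.pi_gt_three]

/-! ### The local semicircle law -/

theorem randomMatrix_isHermitian {Ω : Type*} {N : ℕ} (x y : Fin N → Fin N → Ω → ℝ) (ω : Ω) :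
    (randomMatrix x y ω).IsHermitian := wignerMatrix_isHermitian _ _

/-- The local law for the Stieltjes transform, uniformly in the spectral domain. -/
theorem eventually_forall_measure_not_close_le {ν ν' : Measure ℝ} [IsProbabilityMeasure ν]
    [IsProbabilityMeasure ν'] (hmean : ∫ t, t ∂ν = 0) (hvar : variance id ν = 1 / 2)
    (hC2 : CondC2 ν') (hC4 : CondC4 ν) {κ ε : ℝ} (hκ : 0 < κ) (hε : 0 < ε) :
    ∀ᶠ N : ℕ in atTop, ∀ (Ω : Type*) [MeasurableSpace Ω] (P : Measure Ω) [IsProbabilityMeasure P]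
      (x y : Fin N → Fin N → Ω → ℝ), IsWignerFamily P ν ν' x y →
      P {ω | ¬ ∀ z ∈ spectralDomain N κ 1, ‖stieltjes (randomMatrix x y ω) z - mSC z‖ < ε}
        ≤ ENNReal.ofReal (Real.exp (-(Real.log N) ^ 2)) := by
  rcases lt_or_ge 2 κ with hκ2 | hκ2
  · refine Eventually.of_forall fun N Ω _ P _ x y _ => ?_
    have : ∀ z, z ∉ spectralDomain N κ 1 := fun z hz => by
      have := (abs_nonneg _).trans hz.1
      linarith
    simp [this]
  -- A junk value of the variance would be zero, so the second moment is finite.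
  have hL2 : MemLp (id : ℝ → ℝ) 2 ν := by
    by_contra h
    have h1 := evariance_eq_top (μ := ν) (X := id) aestronglyMeasurable_id h
    rw [variance, h1] at hvar
    norm_num at hvar
  have hint : Integrable (fun x : ℝ => x) ν := hL2.integrable (by norm_num)
  have hint2 : Integrable (fun x : ℝ => x ^ 2) ν := hL2.integrable_sq
  have hvar2 : ∫ x, x ^ 2 ∂ν = 1 / 2 := by
    rw [← hvar, variance_of_integral_eq_zero aemeasurable_id hmean]
    rfl
  obtain ⟨K, hK0, hK⟩ := hC4.exists_subgaussian hint hmean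
  obtain ⟨C, c, hC, hc, hHW⟩ := exists_hansonWright hK0 hK (by norm_num) hvar2 hint2
  obtain ⟨δ, hδ, hδint⟩ := hC2
  have hM : ∫⁻ x, eexp (δ * x ^ 2) ∂ν' ≤ ENNReal.ofReal (∫ x, Real.exp (δ * x ^ 2) ∂ν') :=
    (ofReal_integral_eq_lintegral_ofReal hδint
      (Eventually.of_forall fun x => (Real.exp_pos _).le)).ge
  filter_upwards [eventually_measure_not_close_le hC.le hc hHW hδ
    (integral_nonneg fun x => (Real.exp_pos _).le) hM hκ hκ2 (lt_min hε (by norm_num))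
    (min_le_right ε (1 / 10))] with N hN Ω _ P _ x y hW
  refine le_trans ?_ ((hW.measure_le {H | ¬ ∀ z ∈ spectralDomain N κ 1,
    ‖stieltjes H z - mSC z‖ < min ε (1 / 10)}).trans hN)
  exact measure_mono fun ω hω h => hω fun z hz => (h z hz).trans_le (min_le_left _ _)

theorem abs_densityOfStates_sub_le {N : ℕ} (H : Matrix (Fin N) (Fin N) ℂ) (z : ℂ) :
    |densityOfStates H z.im z.re - (mSC z).im / Real.pi| ≤ ‖stieltjes H z - mSC z‖ := by
  rw [densityOfStates, Complex.re_add_im, ← sub_div, abs_div, abs_of_pos Real.pi_pos,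
    div_le_iff₀ Real.pi_pos, ← Complex.sub_im]
  have := Complex.abs_im_le_norm (stieltjes H z - mSC z)
  nlinarith [Real.pi_gt_three, norm_nonneg (stieltjes H z - mSC z)]

/-- A supremum of errors exceeds `ε` only where some error exceeds `ε / 2`. -/
theorem setOf_le_iSup_subset {Ω α : Type*} {S : Set α} {f : Ω → α → ℝ} {g : Ω → α → ℂ} {ε : ℝ}
    (hε : 0 < ε) {B : Set Ω} (h : ∀ ω ∉ B, ∀ z ∈ S, |f ω z| ≤ ε / 2 ∧ ‖g ω z‖ ≤ ε / 2) :
    {ω | ENNReal.ofReal ε ≤ ⨆ z ∈ S, ‖f ω z‖ₑ} ⊆ B ∧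
    {ω | ENNReal.ofReal ε ≤ ⨆ z ∈ S, ‖g ω z‖ₑ} ⊆ B := by
  have hlt : ENNReal.ofReal (ε / 2) < ENNReal.ofReal ε :=
    (ENNReal.ofReal_lt_ofReal_iff hε).mpr (by linarith)
  constructor
  all_goals
    intro ω hω
    by_contra hB
    refine absurd (le_trans hω (iSup₂_le fun z hz => ?_)) hlt.not_ge
    rw [← ofReal_norm]
    refine ENNReal.ofReal_le_ofReal ?_
  · exact (h ω hB z hz).1
  · exact (h ω hB z hz).2

/-- On the event of the local law, the density of states is close to the semicircle density. -/
theorem abs_densityOfStates_sub_rhoSC_le {N : ℕ} {H : Matrix (Fin N) (Fin N) ℂ} {κ ε : ℝ}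
    (hκ : 0 < κ) (hκ2 : κ ≤ 2) (hscale : 0 < minScale N)
    (hH : ∀ z ∈ spectralDomain N κ 1, ‖stieltjes H z - mSC z‖ < ε) {η E : ℝ}
    (hE : |E| ≤ 2 - κ) (hη : minScale N ≤ η) (hη1 : η ≤ 1) :
    |densityOfStates H η E - rhoSC E| ≤ ε + η / √(4 - (2 - κ) ^ 2) := by
  set z : ℂ := ⟨E, η⟩ with hz
  have hs : 0 < √(4 - (2 - κ) ^ 2) := Real.sqrt_pos.mpr (by nlinarith)
  have h1 : |densityOfStates H η E - (mSC z).im / Real.pi| ≤ ε :=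
    (abs_densityOfStates_sub_le H z).trans (hH z ⟨hE, hη, hη1⟩).le
  have h2 : |(mSC z).im / Real.pi - rhoSC E| ≤ η / √(4 - (2 - κ) ^ 2) := by
    rw [le_div_iff₀ hs]
    refine le_trans ?_ (abs_im_mSC_sub_rhoSC_le (z := z) (hscale.trans_le hη)
      (hE.trans (by linarith)))
    exact mul_le_mul_of_nonneg_left (sqrt_bulk_le hE) (abs_nonneg _)
  exact (abs_sub_le _ _ _).trans (add_le_add h1 h2)

end LocalSemicircle

theorem theorem1p1
    (ν ν' : Measure ℝ) (g g' : ℝ → ℝ)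
    (hν : HasDensityExpNeg ν g) (hν' : HasDensityExpNeg ν' g')
    (hmean : ∫ t, t ∂ν = 0) (hvar : variance id ν = 1 / 2)
    (hmean' : ∫ t, t ∂ν' = 0)
    (hC1 : CondC1 g) (hC2 : CondC2 ν') (hC4 : CondC4 ν)
    (κ ε : ℝ) (hκ : 0 < κ) (hε : 0 < ε) :
    ∃ c : ℝ, 0 < c ∧
      (∀ᶠ N : ℕ in atTop,
        ∀ (Ω : Type*) [MeasurableSpace Ω] (P : Measure Ω) [IsProbabilityMeasure P]
          (x y : Fin N → Fin N → Ω → ℝ), IsWignerFamily P ν ν' x y →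
          P {ω | ENNReal.ofReal ε ≤
              ⨆ z ∈ spectralDomain N κ 1, ‖stieltjes (randomMatrix x y ω) z - mSC z‖ₑ}
            ≤ ENNReal.ofReal (Real.exp (-c * (Real.log N) ^ 2)) ∧
          P {ω | ENNReal.ofReal ε ≤
              ⨆ z ∈ spectralDomain N κ 1,
                ‖densityOfStates (randomMatrix x y ω) z.im z.re - (mSC z).im / Real.pi‖ₑ}
            ≤ ENNReal.ofReal (Real.exp (-c * (Real.log N) ^ 2))) ∧
      (∀ ηs : ℕ → ℝ, Tendsto (fun N => ηs N / minScale N) atTop atTop →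
        Tendsto ηs atTop (𝓝 0) →
        ∀ᶠ N : ℕ in atTop,
          ∀ (Ω : Type*) [MeasurableSpace Ω] (P : Measure Ω) [IsProbabilityMeasure P]
            (x y : Fin N → Fin N → Ω → ℝ), IsWignerFamily P ν ν' x y →
            P {ω | ENNReal.ofReal ε ≤
                ⨆ z ∈ spectralDomain N κ (ηs N),
                  ‖densityOfStates (randomMatrix x y ω) z.im z.re - rhoSC z.re‖ₑ}
              ≤ ENNReal.ofReal (Real.exp (-c * (Real.log N) ^ 2)) ∧
            P {ω | ENNReal.ofReal ε ≤
                ⨆ E ∈ Set.Icc (-(2 - κ)) (2 - κ),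
                  ‖(randomCount x y ω (ηs N) E : ℝ) / (2 * N * ηs N) - rhoSC E‖ₑ}
              ≤ ENNReal.ofReal (Real.exp (-c * (Real.log N) ^ 2))) := by
  have := hν.isProbabilityMeasure
  have := hν'.isProbabilityMeasure
  -- The logarithmic power in the deviation parameter is chosen so that `c = 1` is possible.
  refine ⟨1, one_pos, ?_, ?_⟩
  · filter_upwards [eventually_forall_measure_not_close_le hmean hvar hC2 hC4 hκ (half_pos hε)]
      with N hN Ω _ P _ x y hW
    rw [neg_one_mul]
    have hB := setOf_le_iSup_subset (S := spectralDomain N κ 1) hε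
      (f := fun ω z => densityOfStates (randomMatrix x y ω) z.im z.re - (mSC z).im / Real.pi)
      (g := fun ω z => stieltjes (randomMatrix x y ω) z - mSC z)
      (B := {ω | ¬ ∀ z ∈ spectralDomain N κ 1,
        ‖stieltjes (randomMatrix x y ω) z - mSC z‖ < ε / 2})
      (fun ω hω z hz => by
        have h1 : ‖stieltjes (randomMatrix x y ω) z - mSC z‖ < ε / 2 := not_not.mp hω z hz
        exact ⟨(abs_densityOfStates_sub_le _ z).trans h1.le, h1.le⟩)
    exact ⟨(measure_mono hB.2).trans (hN Ω P x y hW), (measure_mono hB.1).trans (hN Ω P x y hW)⟩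
  · intro ηs hη hη0
    rcases lt_or_ge 2 κ with hκ2 | hκ2
    · refine Eventually.of_forall fun N Ω _ P _ x y _ => ?_
      have h1 : ∀ z, z ∉ spectralDomain N κ (ηs N) := fun z hz => by
        have := (abs_nonneg _).trans hz.1
        linarith
      have h2 : Set.Icc (-(2 - κ)) (2 - κ) = ∅ := Set.Icc_eq_empty (by linarith)
      have hB1 := setOf_le_iSup_subset (S := spectralDomain N κ (ηs N)) (B := ∅) hε
        (f := fun ω z => densityOfStates (randomMatrix x y ω) z.im z.re - rhoSC z.re)
        (g := fun ω z => 0) (fun ω _ z hz => absurd hz (h1 z))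
      have hB2 := setOf_le_iSup_subset (S := Set.Icc (-(2 - κ)) (2 - κ)) (B := ∅) hε
        (f := fun ω E => (randomCount x y ω (ηs N) E : ℝ) / (2 * N * ηs N) - rhoSC E)
        (g := fun ω z => 0) (fun ω _ z hz => absurd hz (h2 ▸ Set.notMem_empty z))
      exact ⟨(measure_mono hB1.1).trans (by simp), (measure_mono hB2.1).trans (by simp)⟩
    set s := √(4 - (2 - κ / 2) ^ 2) with hs
    have hs0 : 0 < s := Real.sqrt_pos.mpr (by nlinarith)
    -- The window `a³ η*` is where the local law is used; the smoothing costs `O(a)`.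
    set a := min (ε / 64) (1 / 2) with ha
    have ha0 : 0 < a := lt_min (by positivity) (by norm_num)
    have ha2 : a ≤ 1 / 2 := min_le_right _ _
    have haε : a ≤ ε / 64 := min_le_left _ _
    set ε' := min (ε / 16) (1 / 8) with hε'
    have hε'0 : 0 < ε' := lt_min (by positivity) (by norm_num)
    have hε'1 : ε' ≤ 1 / 8 := min_le_right _ _
    have hε'ε : ε' ≤ ε / 16 := min_le_left _ _
    filter_upwards [eventually_forall_measure_not_close_le hmean hvar hC2 hC4 (half_pos hκ) hε'0,
      eventually_ge_atTop 2, hη.eventually_ge_atTop (1 / a ^ 3),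
      hη0.eventually_le_const (by positivity : 0 < κ / 4), hη0.eventually_le_const one_pos,
      hη0.eventually_le_const (by positivity : 0 < ε' / 16 * s)]
      with N hN hN2 hηa hηκ hη1 hηs Ω _ P _ x y hW
    rw [neg_one_mul]
    have hN0 : 0 < N := by omega
    have hNr : (2 : ℝ) ≤ N := by exact_mod_cast hN2
    have hscale : 0 < minScale N := by
      have : 0 < Real.log N := Real.log_pos (by linarith)
      rw [minScale]; positivity
    set r := ηs N with hr
    have hra : minScale N ≤ a ^ 3 * r := by
      rw [div_le_div_iff₀ (by positivity) hscale] at hηa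
      linarith
    have hr0 : 0 < r := pos_of_mul_pos_right (hscale.trans_le hra) (by positivity)
    have ha31 : a ^ 3 ≤ 1 := pow_le_one₀ ha0.le (by linarith)
    have har : a ^ 3 * r ≤ r := by nlinarith
    have hηs' : r / s ≤ ε' / 16 := (div_le_iff₀ hs0).mpr hηs
    have hB : ∀ ω ∉ {ω | ¬ ∀ z ∈ spectralDomain N (κ / 2) 1,
        ‖stieltjes (randomMatrix x y ω) z - mSC z‖ < ε'},
        ∀ η E : ℝ, |E| ≤ 2 - κ / 2 → minScale N ≤ η → η ≤ r →
          |densityOfStates (randomMatrix x y ω) η E - rhoSC E| ≤ 2 * ε' := by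
      intro ω hω η E hE h1 h2
      have h3 := abs_densityOfStates_sub_rhoSC_le (half_pos hκ) (by linarith) hscale
        (not_not.mp hω) hE h1 (h2.trans hη1)
      have h4 : η / s ≤ r / s := by gcongr
      rw [← hs] at h3
      linarith
    have hB1 := setOf_le_iSup_subset (S := spectralDomain N κ r) hε
      (f := fun ω z => densityOfStates (randomMatrix x y ω) z.im z.re - rhoSC z.re)
      (g := fun ω z => 0) (fun ω hω z hz => ⟨by
        have := hB ω hω z.im z.re (hz.1.trans (by linarith)) hz.2.1 hz.2.2
        linarith, by simpa using (half_pos hε).le⟩)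
    have hB2 := setOf_le_iSup_subset (S := Set.Icc (-(2 - κ)) (2 - κ)) hε
      (f := fun ω E => (randomCount x y ω r E : ℝ) / (2 * N * r) - rhoSC E)
      (g := fun ω z => 0) (fun ω hω E hE => ⟨by
        have hEabs : |E| ≤ 2 - κ := abs_le.mpr hE
        have hE2 : |E| ≤ 2 - κ / 2 := by linarith
        have hsE : s ≤ √(4 - E ^ 2) := sqrt_bulk_le hE2
        have hcount := abs_eigenvalueCount_sub_le hN0 (randomMatrix_isHermitian x y ω) (E := E)
          (d := rhoSC E) (ε := 3 * ε') ha0 ha2 hr0 (rhoSC_le_one E) (by positivity) (by linarith)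
          (fun u hu => by
            have huabs : |u| ≤ 2 - κ / 2 := by
              have := abs_sub_abs_le_abs_sub u E
              linarith
            have h1 := hB ω hω (a ^ 3 * r) u huabs hra har
            have h2 : |rhoSC u - rhoSC E| ≤ ε' := by
              have h3 := abs_rhoSC_sub_le (y := u) (E := E) (by linarith) (by linarith)
              have h4 : |rhoSC u - rhoSC E| * s ≤ ε' * s :=
                (mul_le_mul_of_nonneg_left hsE (abs_nonneg _)).trans (by linarith)
              exact le_of_mul_le_mul_right h4 hs0
            have := abs_sub_le (densityOfStates (randomMatrix x y ω) (a ^ 3 * r) u) (rhoSC u)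
              (rhoSC E)
            linarith)
          (by
            have h1 := (abs_le.mp (hB ω hω r E hE2 (hra.trans har) le_rfl)).2
            have h2 := rhoSC_le_one E
            linarith)
        have heq : randomCount x y ω r E
            = eigenvalueCount (randomMatrix_isHermitian x y ω) r E := rfl
        rw [heq]
        linarith, by simpa using (half_pos hε).le⟩)
    exact ⟨(measure_mono hB1.1).trans (hN Ω P x y hW), (measure_mono hB2.1).trans (hN Ω P x y hW)⟩
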